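/- Let $d\ge 0$ and $k\ge 3$ be integers and let $f:\mathbb{R}^d\to[0,\infty)$ be a bounded measurable probability density. There is a constant $c$, depending only on $d$, $k$ and $f$, such that the following holds. Let $X_1,X_2,\dots$ be i.i.d. random vectors in $\mathbb{R}^d$ with density $f$, and let $(r_n)$ be a sequence of positive reals with $n r_n^d\to 0$ as $n\to\infty$. Let $\mathcal{C}_n$ be the Čech complex on $X_1,\dots,X_n$ at scale $r_n$: a nonempty set $\{X_i : i\in\sigma\}$ spans a face if and only if the closed balls of radius $r_n$ about the points $X_i$, $i\in\sigma$, have a common point. Let $\beta_{k-2}=\dim H_{k-2}(\mathcal{C}_n;\mathbb{Q})$. 1. If $n^k r_n^{d(k-1)}\to 0$ as $n\to\infty$, then $\beta_{k-2}=0$ asymptotically almost surely, i.e. $\mathbb{P}[\beta_{k-2}(\mathcal{C}_n)=0]\to 1$. 2. If $n^k r_n^{d(k-1)}\to\alpha$ for some $\alpha\in(0,\infty)$, then for all $n$ $$d_{TV}\big(\beta_{k-2}(\mathcal{C}_n),Y_n\big)\le c\, n r_n^d ,$$ where $Y_n$ is a Poisson random variable with $\mathbb{E}[Y_n]=\mathbb{E}[\beta_{k-2}(\mathcal{C}_n)]$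 and $d_{TV}(X,Y)=\sup_g|\mathbb{E}[g(X)]-\mathbb{E}[g(Y)]|$, the supremum being over continuous functions $g$ with $|g|\le 1$. 3. If $k\le d+1$ and $n^k r_n^{d(k-1)}\to\infty$, then $$\frac{\beta_{k-2}(\mathcal{C}_n)-\mathbb{E}[\beta_{k-2}(\mathcal{C}_n)]}{\sqrt{\mathrm{Var}(\beta_{k-2}(\mathcal{C}_n))}}\Longrightarrow\mathcal{N}(0,1)$$ in distribution. -/

import Mathlib

open MeasureTheory ProbabilityTheory Filter Topology

noncomputable section

/-- The Čech complex at scale `r` on a family of points `x : ι → E`: a nonempty finite set `σ` of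
indices is a face iff the closed balls of radius `r` about the points `x i`, `i ∈ σ`, have a
common point. -/
def cechComplex {ι E : Type*} [PseudoMetricSpace E] (x : ι → E) (r : ℝ) :
    PreAbstractSimplicialComplex ι where
  faces := {σ | σ.Nonempty ∧ (⋂ i ∈ σ, Metric.closedBall (x i) r).Nonempty}
  isRelLowerSet_faces := fun _ hσ =>
    ⟨hσ.1, fun _ hτσ hτ => ⟨hτ, hσ.2.mono (Set.biInter_subset_biInter_left hτσ)⟩⟩

/-- The simplicial boundary operator with rational coefficients, on formal combinations of finite
subsets of a linearly ordered vertex set. The facet of `σ` opposite to `i` appears with the sign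
`(-1) ^ p`, where `p` is the position of `i` in `σ`; the empty set is not a simplex, so the
boundary of a vertex is zero (the homology is not reduced). -/
def simplicialBoundary (ι : Type*) [LinearOrder ι] : (Finset ι →₀ ℚ) →ₗ[ℚ] (Finset ι →₀ ℚ) :=
  Finsupp.linearCombination ℚ fun σ =>
    ∑ i ∈ σ with (σ.erase i).Nonempty,
      Finsupp.single (σ.erase i) ((-1 : ℚ) ^ (σ.filter (· < i)).card)

namespace PreAbstractSimplicialComplex

variable {ι : Type*} [LinearOrder ι]

/-- The `k`-chains: rational combinations of the `k`-dimensional faces. -/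
def chains (K : PreAbstractSimplicialComplex ι) (k : ℕ) : Submodule ℚ (Finset ι →₀ ℚ) :=
  Finsupp.supported ℚ ℚ {σ | σ ∈ K ∧ σ.card = k + 1}

/-- The `k`-cycles. -/
def cycles (K : PreAbstractSimplicialComplex ι) (k : ℕ) : Submodule ℚ (Finset ι →₀ ℚ) :=
  K.chains k ⊓ LinearMap.ker (simplicialBoundary ι)

/-- The `k`-boundaries. -/
def boundaries (K : PreAbstractSimplicialComplex ι) (k : ℕ) : Submodule ℚ (Finset ι →₀ ℚ) :=
  (K.chains (k + 1)).map (simplicialBoundary ι)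

/-- The `k`-th Betti number `dim H_k(K; ℚ)`. -/
def betti (K : PreAbstractSimplicialComplex ι) (k : ℕ) : ℕ :=
  Module.finrank ℚ (K.cycles k ⧸ (K.boundaries k).submoduleOf (K.cycles k))

end PreAbstractSimplicialComplex

/-- The `j`-th Betti number of the Čech complex at scale `r` on the first `n` points of the random
sequence `X`. -/
def cechBetti {Ω E : Type*} [PseudoMetricSpace E] (X : ℕ → Ω → E) (n : ℕ) (r : ℝ) (j : ℕ)
    (ω : Ω) : ℕ :=
  (cechComplex (fun i : Fin n => X i ω) r).betti j

/-- Total variation distance of two laws: the supremum of the difference of the expectations of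
`g` over all continuous functions `g` bounded by one. -/
def tvDist {S : Type*} [TopologicalSpace S] [MeasurableSpace S] (μ ν : Measure S) : ℝ :=
  ⨆ g : {g : C(S, ℝ) // ∀ x, |g x| ≤ 1}, |∫ x, g.1 x ∂μ - ∫ x, g.1 x ∂ν|

end

/-!
The Betti number `β` in dimension `k - 2` is the number of holes on `k` vertices (`k` points whose
balls have no common point although the balls of any `k - 1` of them do) plus an excess, which is
controlled by the clusters of more than `k` points. The expected number of clusters of `k` points
is of order `n * (n * r ^ d) ^ (k - 1)`, and every further point of a cluster costs a factor
`n * r ^ d`. Hence `β` vanishes with high probability when that number tends to zero, by the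
Markov inequality.

Otherwise, with `λ = 𝔼[β]`, the identity `𝔼[β g(β)] = λ 𝔼[g(β + 1)]`, which characterizes the
Poisson law, holds up to an error of order `n * (n * r ^ d) ^ k` times the Lipschitz constant of
`g`: replacing the points near a hole by independent copies changes `β` only through points close
to both. Taking for `g` the solution of the Stein equation bounds the distance to the Poisson law
by a multiple of `n * (n * r ^ d) ^ k / λ`, and taking `g = id` compares the variance of `β` with
`λ`. When `k ≤ d + 1`, the vertices of a simplex inscribed in a sphere, with the center in its
interior, span a hole that survives small perturbations, so `λ` is at least of order
`n * (n * r ^ d) ^ (k - 1)` and both errors are of order `n * r ^ d`. When `k > d + 1`, `β = 0`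
because nerves of compact convex sets in dimension `d` are acyclic from dimension `d` on. If
`λ → ∞`, the normal limit of the standardized Poisson law passes to `β`.
-/

open scoped NNReal ENNReal

noncomputable section

namespace RandomCech

/-! ### Simplicial chains and Betti numbers -/

section Chains

lemma map_mem_of_mem_supported {α R M : Type*} [Semiring R] [AddCommMonoid M] [Module R M]
    {φ : (α →₀ R) →ₗ[R] M} {S : Set α} {N : Submodule R M}
    (h : ∀ a ∈ S, φ (Finsupp.single a 1) ∈ N) {z : α →₀ R} (hz : z ∈ Finsupp.supported R R S) :
    φ z ∈ N := by
  rw [Finsupp.supported_eq_span_single] at hz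
  have hspan : Submodule.span R ((fun a => Finsupp.single a 1) '' S) ≤ N.comap φ :=
    Submodule.span_le.2 (by rintro _ ⟨a, ha, rfl⟩; exact h a ha)
  exact hspan hz

lemma map_eq_of_mem_supported {α R M : Type*} [Semiring R] [AddCommMonoid M] [Module R M]
    {φ ψ : (α →₀ R) →ₗ[R] M} {S : Set α}
    (h : ∀ a ∈ S, φ (Finsupp.single a 1) = ψ (Finsupp.single a 1)) {z : α →₀ R}
    (hz : z ∈ Finsupp.supported R R S) : φ z = ψ z := by
  rw [Finsupp.supported_eq_span_single] at hz
  exact LinearMap.eqOn_span (by rintro _ ⟨a, ha, rfl⟩; exact h a ha) hz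

lemma eq_zero_of_mem_supported {α R : Type*} [Semiring R] {S : Set α} (hS : ∀ a, a ∉ S)
    {z : α →₀ R} (hz : z ∈ Finsupp.supported R R S) : z = 0 := by
  rwa [Set.eq_empty_iff_forall_notMem.2 hS, Finsupp.supported_empty, Submodule.mem_bot] at hz

variable {ι : Type*} [LinearOrder ι]

/-- The incidence number `(-1) ^ p` of `σ` and its facet opposite to `i`, where `p` is the position
of `i` in `σ`. -/
def facetSign (σ : Finset ι) (i : ι) : ℚ := (-1) ^ (σ.filter (· < i)).card

lemma facetSign_ne_zero (σ : Finset ι) (i : ι) : facetSign σ i ≠ 0 :=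
  pow_ne_zero _ (by norm_num)

lemma facetSign_eq_one {σ : Finset ι} {v : ι} (h : ∀ i ∈ σ, v ≤ i) : facetSign σ v = 1 := by
  rw [facetSign, Finset.filter_false_of_mem fun i hi => (h i hi).not_gt, Finset.card_empty,
    pow_zero]

lemma facetSign_erase_of_le {σ : Finset ι} {i j : ι} (h : j ≤ i) :
    facetSign (σ.erase i) j = facetSign σ j := by
  rw [facetSign, facetSign, Finset.filter_erase, Finset.erase_eq_of_notMem]
  simp [h]

lemma facetSign_insert_of_lt {σ : Finset ι} {i j : ι} (hj : j ∉ σ) (h : j < i) :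
    facetSign (insert j σ) i = -facetSign σ i := by
  rw [facetSign, facetSign, Finset.filter_insert, if_pos h,
    Finset.card_insert_of_notMem (by simp [hj]), pow_succ, mul_neg_one]

lemma facetSign_erase_of_lt {σ : Finset ι} {i j : ι} (hj : j ∈ σ) (h : j < i) :
    facetSign (σ.erase j) i = -facetSign σ i := by
  conv_rhs => rw [← Finset.insert_erase hj]
  rw [facetSign_insert_of_lt (Finset.notMem_erase j σ) h, neg_neg]

/-- The augmented simplicial boundary, in which the empty set counts as a simplex of dimension
`-1`. It differs from `simplicialBoundary` only on vertices, and it is the one for which cones are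
acyclic without exception. -/
def augBoundary (ι : Type*) [LinearOrder ι] : (Finset ι →₀ ℚ) →ₗ[ℚ] (Finset ι →₀ ℚ) :=
  Finsupp.linearCombination ℚ fun σ => ∑ i ∈ σ, Finsupp.single (σ.erase i) (facetSign σ i)

lemma augBoundary_single (σ : Finset ι) (c : ℚ) :
    augBoundary ι (Finsupp.single σ c) =
      ∑ i ∈ σ, Finsupp.single (σ.erase i) (c * facetSign σ i) := by
  simp [augBoundary, Finset.smul_sum]

lemma augBoundary_single_apply_erase {σ : Finset ι} {i : ι} (hi : i ∈ σ) (c : ℚ) :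
    augBoundary ι (Finsupp.single σ c) (σ.erase i) = c * facetSign σ i := by
  rw [augBoundary_single, Finsupp.finsetSum_apply, Finset.sum_eq_single_of_mem i hi,
    Finsupp.single_eq_same]
  intro m hm hmi
  exact Finsupp.single_eq_of_ne' fun e => hmi (Finset.erase_injOn σ hm hi e)

lemma augBoundary_augBoundary (z : Finset ι →₀ ℚ) : augBoundary ι (augBoundary ι z) = 0 := by
  induction z using Finsupp.induction_linear with
  | zero => simp only [map_zero]
  | add f g hf hg => rw [map_add, map_add, hf, hg, add_zero]
  | single σ c =>
    simp_rw [augBoundary_single, map_sum, augBoundary_single]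
    rw [Finset.sum_sigma']
    -- Removing `i` then `j` cancels against removing `j` then `i`.
    refine Finset.sum_involution (fun a _ => ⟨a.2, a.1⟩) ?_ ?_ ?_ fun _ _ => rfl
    · rintro ⟨i, j⟩ h
      simp only [Finset.mem_sigma, Finset.mem_erase] at h
      obtain ⟨hi, hji, hj⟩ := h
      rw [Finset.erase_right_comm, ← Finsupp.single_add, Finsupp.single_eq_zero]
      rcases lt_or_gt_of_ne hji with hlt | hlt
      · rw [facetSign_erase_of_le hlt.le, facetSign_erase_of_lt hj hlt]
        ring
      · rw [facetSign_erase_of_le hlt.le, facetSign_erase_of_lt hi hlt]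
        ring
    · rintro ⟨i, j⟩ h _ heq
      simp only [Finset.mem_sigma, Finset.mem_erase, Sigma.mk.injEq, heq_eq_eq] at h heq
      exact h.2.1 heq.1
    · rintro ⟨i, j⟩ h
      simp only [Finset.mem_sigma, Finset.mem_erase] at h ⊢
      exact ⟨h.2.2, h.2.1.symm, h.1⟩

lemma augBoundary_mem_supported {S T : Set (Finset ι)}
    (h : ∀ σ ∈ S, ∀ i ∈ σ, σ.erase i ∈ T) {z : Finset ι →₀ ℚ}
    (hz : z ∈ Finsupp.supported ℚ ℚ S) : augBoundary ι z ∈ Finsupp.supported ℚ ℚ T := by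
  refine map_mem_of_mem_supported (fun σ hσ => ?_) hz
  rw [augBoundary_single]
  exact Submodule.sum_mem _ fun i hi => Finsupp.single_mem_supported _ _ (h σ hσ i hi)

lemma simplicialBoundary_single (σ : Finset ι) (c : ℚ) :
    simplicialBoundary ι (Finsupp.single σ c) =
      ∑ i ∈ σ with (σ.erase i).Nonempty, Finsupp.single (σ.erase i) (c * facetSign σ i) := by
  simp [simplicialBoundary, Finset.smul_sum, facetSign]

lemma simplicialBoundary_mem_supported {S T : Set (Finset ι)}
    (h : ∀ σ ∈ S, ∀ i ∈ σ, (σ.erase i).Nonempty → σ.erase i ∈ T) {z : Finset ι →₀ ℚ}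
    (hz : z ∈ Finsupp.supported ℚ ℚ S) : simplicialBoundary ι z ∈ Finsupp.supported ℚ ℚ T := by
  refine map_mem_of_mem_supported (fun σ hσ => ?_) hz
  rw [simplicialBoundary_single]
  refine Submodule.sum_mem _ fun i hi => Finsupp.single_mem_supported _ _ ?_
  exact h σ hσ i (Finset.mem_filter.1 hi).1 (Finset.mem_filter.1 hi).2

lemma simplicialBoundary_single_eq_augBoundary {σ : Finset ι} (h : 2 ≤ σ.card) (c : ℚ) :
    simplicialBoundary ι (Finsupp.single σ c) = augBoundary ι (Finsupp.single σ c) := by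
  rw [simplicialBoundary_single, augBoundary_single, Finset.filter_true_of_mem]
  intro i hi
  rw [← Finset.card_pos, Finset.card_erase_of_mem hi]
  lia

lemma simplicialBoundary_single_of_card_le_one {σ : Finset ι} (h : σ.card ≤ 1) (c : ℚ) :
    simplicialBoundary ι (Finsupp.single σ c) = 0 := by
  rw [simplicialBoundary_single, Finset.filter_false_of_mem, Finset.sum_empty]
  intro i hi
  rw [← Finset.card_pos, Finset.card_erase_of_mem hi]
  lia

lemma simplicialBoundary_eq_augBoundary {S : Set (Finset ι)} (hS : ∀ σ ∈ S, 2 ≤ σ.card)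
    {z : Finset ι →₀ ℚ} (hz : z ∈ Finsupp.supported ℚ ℚ S) :
    simplicialBoundary ι z = augBoundary ι z :=
  map_eq_of_mem_supported (fun σ hσ => simplicialBoundary_single_eq_augBoundary (hS σ hσ) 1) hz

lemma simplicialBoundary_simplicialBoundary (z : Finset ι →₀ ℚ) :
    simplicialBoundary ι (simplicialBoundary ι z) = 0 := by
  induction z using Finsupp.induction_linear with
  | zero => simp only [map_zero]
  | add f g hf hg => rw [map_add, map_add, hf, hg, add_zero]
  | single σ c =>
    rcases le_or_gt σ.card 1 with h | h
    · rw [simplicialBoundary_single_of_card_le_one h, map_zero]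
    rw [simplicialBoundary_single_eq_augBoundary h]
    have hcard {i : ι} (hi : i ∈ σ) : (σ.erase i).card = σ.card - 1 := Finset.card_erase_of_mem hi
    rcases le_or_gt σ.card 2 with h2 | h2
    · rw [augBoundary_single, map_sum]
      exact Finset.sum_eq_zero fun i hi =>
        simplicialBoundary_single_of_card_le_one (by rw [hcard hi]; lia) _
    · rw [← augBoundary_augBoundary (Finsupp.single σ c), augBoundary_single, map_sum, map_sum]
      exact Finset.sum_congr rfl fun i hi =>
        simplicialBoundary_single_eq_augBoundary (by rw [hcard hi]; lia) _

/-- The cone operator with apex `v`, the contracting homotopy of a cone. It inserts `v` without a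
sign, so it is meant for simplices all of whose vertices are at least `v`. -/
def coneMap (v : ι) : (Finset ι →₀ ℚ) →ₗ[ℚ] (Finset ι →₀ ℚ) :=
  Finsupp.linearCombination ℚ fun σ => if v ∈ σ then 0 else Finsupp.single (insert v σ) 1

lemma coneMap_single (v : ι) (σ : Finset ι) (c : ℚ) :
    coneMap v (Finsupp.single σ c) = if v ∈ σ then 0 else Finsupp.single (insert v σ) c := by
  rw [coneMap, Finsupp.linearCombination_single]
  split_ifs <;> simp

lemma coneMap_mem_supported {S T : Set (Finset ι)} {v : ι}
    (h : ∀ σ ∈ S, v ∉ σ → insert v σ ∈ T) {z : Finset ι →₀ ℚ}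
    (hz : z ∈ Finsupp.supported ℚ ℚ S) : coneMap v z ∈ Finsupp.supported ℚ ℚ T := by
  refine map_mem_of_mem_supported (fun σ hσ => ?_) hz
  rw [coneMap_single]
  split_ifs with hv
  · exact Submodule.zero_mem _
  · exact Finsupp.single_mem_supported _ _ (h σ hσ hv)

lemma augBoundary_coneMap_single {v : ι} {σ : Finset ι} (h : ∀ i ∈ σ, v ≤ i) (c : ℚ) :
    augBoundary ι (coneMap v (Finsupp.single σ c)) + coneMap v (augBoundary ι (Finsupp.single σ c))
      = Finsupp.single σ c := by
  rw [coneMap_single, augBoundary_single, map_sum]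
  simp_rw [coneMap_single]
  by_cases hv : v ∈ σ
  · rw [if_pos hv, map_zero, zero_add, Finset.sum_eq_single_of_mem v hv]
    · simp [facetSign_eq_one h, Finset.insert_erase hv]
    · intro i _ hi
      rw [if_pos (Finset.mem_erase.2 ⟨hi.symm, hv⟩)]
  · rw [if_neg hv, augBoundary_single, Finset.sum_insert hv, Finset.erase_insert hv,
      facetSign_eq_one (by simpa using h), mul_one, add_assoc, ← Finset.sum_add_distrib,
      Finset.sum_eq_zero, add_zero]
    intro i hi
    have hvi : v ≠ i := fun e => hv (e ▸ hi)
    rw [if_neg fun hm => hv (Finset.mem_of_mem_erase hm),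
      facetSign_insert_of_lt hv (lt_of_le_of_ne (h i hi) hvi), Finset.erase_insert_of_ne hvi,
      ← Finsupp.single_add, Finsupp.single_eq_zero]
    ring

lemma augBoundary_coneMap_of_cycle {v : ι} {S : Set (Finset ι)} (h : ∀ σ ∈ S, ∀ i ∈ σ, v ≤ i)
    {z : Finset ι →₀ ℚ} (hz : z ∈ Finsupp.supported ℚ ℚ S) (hc : augBoundary ι z = 0) :
    augBoundary ι (coneMap v z) = z := by
  have hcone : (augBoundary ι ∘ₗ coneMap v + coneMap v ∘ₗ augBoundary ι) z = LinearMap.id z :=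
    map_eq_of_mem_supported (fun σ hσ => augBoundary_coneMap_single (h σ hσ) 1) hz
  simpa [hc] using hcone

end Chains

section Betti

variable {ι : Type*} {K L : PreAbstractSimplicialComplex ι} {σ τ : Finset ι} {j : ℕ}

lemma nonempty_of_mem (h : σ ∈ K) : σ.Nonempty := (K.isRelLowerSet_faces h).1

lemma mem_of_subset (h : σ ∈ K) (hτ : τ ⊆ σ) (hn : τ.Nonempty) : τ ∈ K :=
  (K.isRelLowerSet_faces h).2 hτ hn

lemma chains_mono (h : L ≤ K) (j : ℕ) : L.chains j ≤ K.chains j :=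
  Finsupp.supported_mono fun _ hσ => ⟨h hσ.1, hσ.2⟩

lemma chains_le_supported (K : PreAbstractSimplicialComplex ι) (j : ℕ) :
    K.chains j ≤ Finsupp.supported ℚ ℚ (K : Set (Finset ι)) :=
  Finsupp.supported_mono fun _ hσ => hσ.1

lemma chains_sup (K L : PreAbstractSimplicialComplex ι) (j : ℕ) :
    (K ⊔ L).chains j = K.chains j ⊔ L.chains j := by
  rw [PreAbstractSimplicialComplex.chains, PreAbstractSimplicialComplex.chains,
    PreAbstractSimplicialComplex.chains, ← Finsupp.supported_union]
  exact congrArg _ (Set.ext fun σ => or_and_right)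

variable [LinearOrder ι]

lemma simplicialBoundary_mem_supported_faces {z : Finset ι →₀ ℚ} (hz : z ∈ K.chains j) :
    simplicialBoundary ι z ∈ Finsupp.supported ℚ ℚ (K : Set (Finset ι)) :=
  simplicialBoundary_mem_supported
    (fun _ hσ _ _ hn => mem_of_subset hσ.1 (Finset.erase_subset _ _) hn) hz

lemma augBoundary_eq_zero_of_mem_cycles (hj : 1 ≤ j) {z : Finset ι →₀ ℚ} (hz : z ∈ K.cycles j) :
    augBoundary ι z = 0 := by
  rw [← simplicialBoundary_eq_augBoundary (fun σ hσ => ?_) hz.1]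
  · exact hz.2
  · rw [hσ.2]
    lia

lemma boundaries_le_cycles (K : PreAbstractSimplicialComplex ι) (j : ℕ) :
    K.boundaries j ≤ K.cycles j := by
  rintro _ ⟨z, hz, rfl⟩
  refine ⟨simplicialBoundary_mem_supported ?_ hz, simplicialBoundary_simplicialBoundary z⟩
  rintro σ ⟨hσ, hc⟩ i hi hn
  refine ⟨mem_of_subset hσ (Finset.erase_subset _ _) hn, ?_⟩
  rw [Finset.card_erase_of_mem hi, hc, Nat.add_sub_cancel]

lemma cycles_sup (hKL : Disjoint (K : Set (Finset ι)) L) (j : ℕ) :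
    (K ⊔ L).cycles j = K.cycles j ⊔ L.cycles j := by
  apply le_antisymm
  · rintro z ⟨hz, hzc⟩
    rw [chains_sup] at hz
    obtain ⟨z₁, h₁, z₂, h₂, rfl⟩ := Submodule.mem_sup.1 hz
    have hsum : simplicialBoundary ι z₁ + simplicialBoundary ι z₂ = 0 := by
      rw [← map_add]
      exact hzc
    have hz₁ : simplicialBoundary ι z₁ = 0 := by
      refine Submodule.disjoint_def.1 ((Finsupp.disjoint_supported_supported_iff (M := ℚ)).2 hKL) _
        (simplicialBoundary_mem_supported_faces h₁) ?_
      rw [eq_neg_of_add_eq_zero_left hsum]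
      exact Submodule.neg_mem _ (simplicialBoundary_mem_supported_faces h₂)
    rw [hz₁, zero_add] at hsum
    exact Submodule.add_mem_sup ⟨h₁, hz₁⟩ ⟨h₂, hsum⟩
  · exact sup_le (inf_le_inf_right _ (chains_mono le_sup_left j))
      (inf_le_inf_right _ (chains_mono le_sup_right j))

lemma boundaries_sup (K L : PreAbstractSimplicialComplex ι) (j : ℕ) :
    (K ⊔ L).boundaries j = K.boundaries j ⊔ L.boundaries j := by
  rw [PreAbstractSimplicialComplex.boundaries, chains_sup, Submodule.map_sup]
  rfl

variable [Finite ι]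

lemma finrank_boundaries_add_betti (K : PreAbstractSimplicialComplex ι) (j : ℕ) :
    Module.finrank ℚ (K.boundaries j) + K.betti j = Module.finrank ℚ (K.cycles j) := by
  rw [PreAbstractSimplicialComplex.betti,
    ← Submodule.finrank_quotient_add_finrank ((K.boundaries j).submoduleOf (K.cycles j)),
    (Submodule.submoduleOfEquivOfLe (boundaries_le_cycles K j)).finrank_eq, add_comm]

lemma betti_eq_zero_of_cycles_le (h : K.cycles j ≤ K.boundaries j) : K.betti j = 0 := by
  have := finrank_boundaries_add_betti K j
  have := Submodule.finrank_mono h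
  lia

lemma finrank_cycles_le {T : Finset (Finset ι)} (hT : ∀ σ ∈ K, σ ∉ L → σ.card = j + 1 → σ ∈ T) :
    Module.finrank ℚ (K.cycles j) ≤ Module.finrank ℚ (L.cycles j) + T.card := by
  let φ : (Finset ι →₀ ℚ) →ₗ[ℚ] (T → ℚ) := LinearMap.pi fun σ => Finsupp.lapply σ.1
  have hrank := LinearMap.finrank_range_add_finrank_ker (φ.domRestrict (K.cycles j))
  have hrange : Module.finrank ℚ (LinearMap.range (φ.domRestrict (K.cycles j))) ≤ T.card :=
    (Submodule.finrank_le _).trans (by simp)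
  have hker : Module.finrank ℚ (LinearMap.ker (φ.domRestrict (K.cycles j)))
      ≤ Module.finrank ℚ (L.cycles j) := by
    rw [(Submodule.equivMapOfInjective (K.cycles j).subtype (Submodule.subtype_injective _)
      (LinearMap.ker (φ.domRestrict (K.cycles j)))).finrank_eq]
    refine Submodule.finrank_mono ?_
    rintro _ ⟨⟨z, hz⟩, hφ, rfl⟩
    refine ⟨(Finsupp.mem_supported _ _).2 fun σ hσ => ?_, hz.2⟩
    have hK := (Finsupp.mem_supported _ _).1 hz.1 hσ
    refine ⟨by_contra fun hL => Finsupp.mem_support_iff.1 hσ ?_, hK.2⟩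
    exact congrFun (LinearMap.mem_ker.1 hφ) ⟨σ, hT σ hK.1 hL hK.2⟩
  lia

lemma finrank_boundaries_le {T : Finset (Finset ι)}
    (hT : ∀ σ ∈ K, σ ∉ L → σ.card = j + 2 → σ ∈ T) :
    Module.finrank ℚ (K.boundaries j) ≤ Module.finrank ℚ (L.boundaries j) + T.card := by
  have hchains :
      K.chains (j + 1) ≤ L.chains (j + 1) ⊔ Finsupp.supported ℚ ℚ (T : Set (Finset ι)) := by
    rw [PreAbstractSimplicialComplex.chains, PreAbstractSimplicialComplex.chains,
      ← Finsupp.supported_union]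
    exact Finsupp.supported_mono fun σ hσ => or_iff_not_imp_left.2 fun hL =>
      hT σ hσ.1 (fun h => hL ⟨h, hσ.2⟩) hσ.2
  have hboundaries : K.boundaries j ≤ L.boundaries j ⊔
      (Finsupp.supported ℚ ℚ (T : Set (Finset ι))).map (simplicialBoundary ι) :=
    (Submodule.map_mono hchains).trans_eq (Submodule.map_sup _ _ _)
  calc Module.finrank ℚ (K.boundaries j)
      ≤ Module.finrank ℚ (L.boundaries j) + Module.finrank ℚ
          ((Finsupp.supported ℚ ℚ (T : Set (Finset ι))).map (simplicialBoundary ι)) :=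
        (Submodule.finrank_mono hboundaries).trans
          (Submodule.finrank_add_le_finrank_add_finrank _ _)
    _ ≤ Module.finrank ℚ (L.boundaries j) +
          Module.finrank ℚ (Finsupp.supported ℚ ℚ (T : Set (Finset ι))) := by
        gcongr
        exact Submodule.finrank_map_le _ _
    _ = Module.finrank ℚ (L.boundaries j) + T.card := by
        rw [(Finsupp.supportedEquivFinsupp (M := ℚ) (R := ℚ) (T : Set (Finset ι))).finrank_eq]
        simp

lemma abs_betti_sub_betti_le (hLK : L ≤ K) {T : Finset (Finset ι)}
    (hT : ∀ σ ∈ K, σ ∉ L → σ.card = j + 1 ∨ σ.card = j + 2 → σ ∈ T) :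
    |(K.betti j : ℝ) - L.betti j| ≤ T.card := by
  have hK := finrank_boundaries_add_betti K j
  have hL := finrank_boundaries_add_betti L j
  have hcycles := finrank_cycles_le (K := K) (L := L) fun σ hK hL hc => hT σ hK hL (.inl hc)
  have hboundaries :=
    finrank_boundaries_le (K := K) (L := L) fun σ hK hL hc => hT σ hK hL (.inr hc)
  have hcycles_mono : Module.finrank ℚ (L.cycles j) ≤ Module.finrank ℚ (K.cycles j) :=
    Submodule.finrank_mono (inf_le_inf_right _ (chains_mono hLK j))
  have hboundaries_mono : Module.finrank ℚ (L.boundaries j) ≤ Module.finrank ℚ (K.boundaries j) :=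
    Submodule.finrank_mono (Submodule.map_mono (chains_mono hLK _))
  rw [abs_sub_le_iff, sub_le_iff_le_add, sub_le_iff_le_add]
  exact ⟨by exact_mod_cast (by lia : K.betti j ≤ T.card + L.betti j),
    by exact_mod_cast (by lia : L.betti j ≤ T.card + K.betti j)⟩

lemma finrank_sup_of_disjoint (hKL : Disjoint (K : Set (Finset ι)) L)
    {A B : Submodule ℚ (Finset ι →₀ ℚ)} (hA : A ≤ K.cycles j) (hB : B ≤ L.cycles j) :
    Module.finrank ℚ ↥(A ⊔ B) = Module.finrank ℚ A + Module.finrank ℚ B := by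
  have hAB : Disjoint A B :=
    ((Finsupp.disjoint_supported_supported_iff (M := ℚ)).2 hKL).mono
      (hA.trans (inf_le_left.trans (chains_le_supported K j)))
      (hB.trans (inf_le_left.trans (chains_le_supported L j)))
  rw [← Submodule.finrank_sup_add_finrank_inf_eq, hAB.eq_bot, finrank_bot, add_zero]

lemma betti_sup (hKL : Disjoint (K : Set (Finset ι)) L) (j : ℕ) :
    (K ⊔ L).betti j = K.betti j + L.betti j := by
  have hB := finrank_sup_of_disjoint hKL (boundaries_le_cycles K j) (boundaries_le_cycles L j)
  have hZ := finrank_sup_of_disjoint hKL (le_refl (K.cycles j)) (le_refl (L.cycles j))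
  rw [← boundaries_sup] at hB
  rw [← cycles_sup hKL] at hZ
  have := finrank_boundaries_add_betti (K ⊔ L) j
  have := finrank_boundaries_add_betti K j
  have := finrank_boundaries_add_betti L j
  lia

end Betti

section Holes

variable {ι : Type*} [LinearOrder ι] {K : PreAbstractSimplicialComplex ι} {A : Finset ι} {j : ℕ}

/-- `σ` is a hole (an empty simplex, a minimal non-face) of `K`: it is not a face, but all its
facets are faces. -/
def IsHole (K : PreAbstractSimplicialComplex ι) (σ : Finset ι) : Prop :=
  σ ∉ K ∧ ∀ i ∈ σ, σ.erase i ∈ K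

lemma exists_augBoundary_eq_of_mem_cycles (hj : 1 ≤ j) (hK : ∀ σ ∈ K, σ ⊆ A)
    {z : Finset ι →₀ ℚ} (hz : z ∈ K.cycles j) :
    ∃ w ∈ Finsupp.supported ℚ ℚ {σ : Finset ι | σ ⊆ A ∧ σ.card = j + 2}, augBoundary ι w = z := by
  rcases A.eq_empty_or_nonempty with rfl | hA
  · refine ⟨0, Submodule.zero_mem _, ?_⟩
    rw [map_zero, eq_zero_of_mem_supported (fun σ hσ => ?_) hz.1]
    exact (nonempty_of_mem hσ.1).ne_empty (Finset.subset_empty.1 (hK σ hσ.1))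
  refine ⟨coneMap (A.min' hA) z, coneMap_mem_supported ?_ hz.1, augBoundary_coneMap_of_cycle
    (fun σ hσ i hi => A.min'_le i (hK σ hσ.1 hi)) hz.1 (augBoundary_eq_zero_of_mem_cycles hj hz)⟩
  rintro σ ⟨hσ, hc⟩ hv
  exact ⟨Finset.insert_subset (A.min'_mem hA) (hK σ hσ),
    by rw [Finset.card_insert_of_notMem hv, hc]⟩

lemma cycles_le_span_augBoundary (hj : 1 ≤ j) (hA : A.card ≤ j + 2) (hK : ∀ σ ∈ K, σ ⊆ A) :
    K.cycles j ≤ Submodule.span ℚ {augBoundary ι (Finsupp.single A 1)} := by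
  intro z hz
  obtain ⟨w, hw, rfl⟩ := exists_augBoundary_eq_of_mem_cycles hj hK hz
  refine map_mem_of_mem_supported (fun σ hσ => ?_) hw
  rw [Finset.eq_of_subset_of_card_le hσ.1 (hA.trans_eq hσ.2.symm)]
  exact Submodule.mem_span_singleton_self _

lemma cycles_eq_bot_of_erase_notMem (hj : 1 ≤ j) (hA : A.card ≤ j + 2) (hK : ∀ σ ∈ K, σ ⊆ A)
    {i : ι} (hi : i ∈ A) (hiK : A.erase i ∉ K) : K.cycles j = ⊥ := by
  refine (Submodule.eq_bot_iff _).2 fun z hz => ?_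
  obtain ⟨c, rfl⟩ := Submodule.mem_span_singleton.1 (cycles_le_span_augBoundary hj hA hK hz)
  have hcoeff : c * facetSign A i = 0 := by
    rw [← one_mul (facetSign A i), ← augBoundary_single_apply_erase hi, ← smul_eq_mul,
      ← Finsupp.smul_apply]
    exact by_contra fun hne =>
      hiK ((Finsupp.mem_supported _ _).1 hz.1 (Finsupp.mem_support_iff.2 hne)).1
  rw [(mul_eq_zero_iff_right (facetSign_ne_zero A i)).1 hcoeff, zero_smul]

variable [Finite ι]

lemma betti_eq_zero_of_card_lt (hj : 1 ≤ j) (hA : A.card < j + 2) (hK : ∀ σ ∈ K, σ ⊆ A) :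
    K.betti j = 0 := by
  refine betti_eq_zero_of_cycles_le fun z hz => ?_
  obtain ⟨w, hw, rfl⟩ := exists_augBoundary_eq_of_mem_cycles hj hK hz
  rw [eq_zero_of_mem_supported (fun σ hσ => ?_) hw, map_zero]
  · exact Submodule.zero_mem _
  · exact hA.not_ge (hσ.2 ▸ Finset.card_le_card hσ.1)

lemma betti_eq_zero_of_mem (hj : 1 ≤ j) (hA : A.card = j + 2) (hK : ∀ σ ∈ K, σ ⊆ A) (hAK : A ∈ K) :
    K.betti j = 0 := by
  refine betti_eq_zero_of_cycles_le ((cycles_le_span_augBoundary hj hA.le hK).trans ?_)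
  rw [Submodule.span_singleton_le_iff_mem, ← simplicialBoundary_single_eq_augBoundary (by lia)]
  exact Submodule.mem_map_of_mem (Finsupp.single_mem_supported _ _ ⟨hAK, hA⟩)

lemma betti_eq_one_of_isHole (hj : 1 ≤ j) (hA : A.card = j + 2) (hK : ∀ σ ∈ K, σ ⊆ A)
    (hole : IsHole K A) : K.betti j = 1 := by
  obtain ⟨i, hi⟩ : A.Nonempty := Finset.card_pos.1 (by lia)
  have hcycles : K.cycles j = Submodule.span ℚ {augBoundary ι (Finsupp.single A 1)} := by
    refine (cycles_le_span_augBoundary hj hA.le hK).antisymm ?_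
    rw [Submodule.span_singleton_le_iff_mem]
    refine ⟨augBoundary_mem_supported (S := {A}) ?_ (Finsupp.single_mem_supported _ _ rfl), ?_⟩
    · rintro _ rfl m hm
      exact ⟨hole.2 m hm, by rw [Finset.card_erase_of_mem hm]; lia⟩
    · rw [← simplicialBoundary_single_eq_augBoundary (by lia)]
      exact simplicialBoundary_simplicialBoundary _
  have hboundaries : K.boundaries j = ⊥ := by
    have hchains : K.chains (j + 1) = ⊥ := by
      refine (Submodule.eq_bot_iff _).2 fun z hz => eq_zero_of_mem_supported ?_ hz
      rintro σ ⟨hσ, hc⟩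
      exact hole.1 (Finset.eq_of_subset_of_card_le (hK σ hσ) (by rw [hc, hA]) ▸ hσ)
    rw [PreAbstractSimplicialComplex.boundaries, hchains, Submodule.map_bot]
  have hne : augBoundary ι (Finsupp.single A 1) ≠ 0 := by
    refine Finsupp.ne_iff.2 ⟨A.erase i, ?_⟩
    rw [augBoundary_single_apply_erase hi, one_mul]
    exact facetSign_ne_zero A i
  rw [← finrank_span_singleton (K := ℚ) hne, ← hcycles, ← finrank_boundaries_add_betti,
    hboundaries, finrank_bot, zero_add]

lemma betti_eq_ite_isHole (hj : 1 ≤ j) (hA : A.card ≤ j + 2) (hK : ∀ σ ∈ K, σ ⊆ A)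
    [Decidable (A.card = j + 2 ∧ IsHole K A)] :
    K.betti j = if A.card = j + 2 ∧ IsHole K A then 1 else 0 := by
  split_ifs with h
  · exact betti_eq_one_of_isHole hj h.1 hK h.2
  rcases hA.lt_or_eq with hlt | hcard
  · exact betti_eq_zero_of_card_lt hj hlt hK
  by_cases hAK : A ∈ K
  · exact betti_eq_zero_of_mem hj hcard hK hAK
  obtain ⟨i, hi, hiK⟩ : ∃ i ∈ A, A.erase i ∉ K := by
    by_contra! hfacets
    exact h ⟨hcard, hAK, hfacets⟩
  exact betti_eq_zero_of_cycles_le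
    ((cycles_eq_bot_of_erase_notMem hj hA hK hi hiK).trans_le bot_le)

end Holes

/-! ### Nerves of convex sets -/

section Leray

variable {ι : Type*}

/-- The nerve of a family of sets: the finite sets of indices whose members of the family have a
common point. The empty index set belongs to it as soon as the ambient type is nonempty. -/
def nerve {E : Type*} (C : ι → Set E) : Set (Finset ι) := {σ | (⋂ i ∈ σ, C i).Nonempty}

lemma isLowerSet_nerve {E : Type*} (C : ι → Set E) : IsLowerSet (nerve C) :=
  fun _ _ hle hσ => hσ.mono (Set.biInter_subset_biInter_left hle)

/-- The slice of a set of vectors at height `t` of the zeroth coordinate. -/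
def slice {m : ℕ} (t : ℝ) (C : Set (Fin (m + 1) → ℝ)) : Set (Fin m → ℝ) :=
  {y | (Fin.cons t y : Fin (m + 1) → ℝ) ∈ C}

lemma slice_eq_image {m : ℕ} (t : ℝ) (C : Set (Fin (m + 1) → ℝ)) :
    slice t C = LinearMap.funLeft ℝ ℝ Fin.succ '' (C ∩ {x | x 0 = t}) := by
  ext y
  constructor
  · exact fun hy => ⟨Fin.cons t y, ⟨hy, rfl⟩, by ext i; simp [LinearMap.funLeft_apply]⟩
  · rintro ⟨x, ⟨hx, rfl⟩, rfl⟩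
    exact (Fin.cons_self_tail x).symm ▸ hx

lemma isLinearMap_apply_zero (m : ℕ) : IsLinearMap ℝ (fun x : Fin (m + 1) → ℝ => x 0) :=
  ⟨fun _ _ => rfl, fun _ _ => rfl⟩

lemma convex_slice {m : ℕ} (t : ℝ) {C : Set (Fin (m + 1) → ℝ)} (hC : Convex ℝ C) :
    Convex ℝ (slice t C) := by
  rw [slice_eq_image]
  exact (hC.inter (convex_hyperplane (isLinearMap_apply_zero m) t)).linear_image _

lemma isCompact_slice {m : ℕ} (t : ℝ) {C : Set (Fin (m + 1) → ℝ)} (hC : IsCompact C) :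
    IsCompact (slice t C) := by
  rw [slice_eq_image]
  refine (hC.inter_right (isClosed_eq (continuous_apply 0) continuous_const)).image ?_
  exact continuous_pi fun i => continuous_apply _

/-- The values of the zeroth coordinate on the common points of the sets `C i`, `i ∈ σ`. -/
def heights {m : ℕ} (C : ι → Set (Fin (m + 1) → ℝ)) (σ : Finset ι) : Set ℝ :=
  (fun x => x 0) '' ⋂ i ∈ σ, C i

lemma heights_nonempty_iff {m : ℕ} {C : ι → Set (Fin (m + 1) → ℝ)} {σ : Finset ι} :
    (heights C σ).Nonempty ↔ σ ∈ nerve C :=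
  Set.image_nonempty

lemma mem_nerve_slice_iff {m : ℕ} {C : ι → Set (Fin (m + 1) → ℝ)} {t : ℝ} {σ : Finset ι} :
    σ ∈ nerve (fun i => slice t (C i)) ↔ t ∈ heights C σ := by
  constructor
  · rintro ⟨y, hy⟩
    exact ⟨Fin.cons t y, by simpa [slice] using hy, rfl⟩
  · rintro ⟨x, hx, rfl⟩
    refine ⟨Fin.tail x, Set.mem_iInter₂.2 fun i hi => ?_⟩
    exact (Fin.cons_self_tail x).symm ▸ Set.mem_iInter₂.1 hx i hi

lemma mem_nerve_inter_halfSpace_iff {m : ℕ} {C : ι → Set (Fin (m + 1) → ℝ)} {s : ℝ} {σ : Finset ι}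
    (hσ : σ.Nonempty) :
    σ ∈ nerve (fun i => C i ∩ {x | x 0 ≤ s}) ↔ ∃ u ∈ heights C σ, u ≤ s := by
  have hinter : ⋂ i ∈ σ, C i ∩ {x | x 0 ≤ s} = (⋂ i ∈ σ, C i) ∩ {x | x 0 ≤ s} :=
    (Set.biInter_inter hσ C _)
  rw [heights, Set.exists_mem_image]
  exact Iff.of_eq (congrArg Set.Nonempty hinter)

lemma isCompact_heights {m : ℕ} {C : ι → Set (Fin (m + 1) → ℝ)} (hC : ∀ i, IsCompact (C i))
    {σ : Finset ι} (hσ : σ.Nonempty) : IsCompact (heights C σ) :=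
  have ⟨_, hi⟩ := hσ
  ((hC _).of_isClosed_subset (isClosed_biInter fun i _ => (hC i).isClosed)
    (Set.biInter_subset_of_mem hi)).image (continuous_apply 0)

lemma isConnected_heights {m : ℕ} {C : ι → Set (Fin (m + 1) → ℝ)} (hC : ∀ i, Convex ℝ (C i))
    {σ : Finset ι} (hσ : σ ∈ nerve C) : IsConnected (heights C σ) :=
  ⟨hσ.image _, (convex_iInter₂ fun i _ => hC i).isPreconnected.image _
    (continuous_apply 0).continuousOn⟩

/-- Take for `t` the largest left end point, and for `s` a number just below it. -/
lemma exists_cut {κ : Type*} [Finite κ] [Nonempty κ] {I : κ → Set ℝ}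
    (hcomp : ∀ k, IsCompact (I k)) (hconn : ∀ k, IsConnected (I k)) :
    ∃ s t, (∀ k, s ∈ I k ↔ t ∈ I k ∧ ∃ u ∈ I k, u ≤ s) ∧ (∀ k, t ∈ I k ∨ ∃ u ∈ I k, u ≤ s) ∧
      ∃ k, ∀ u ∈ I k, s < u := by
  obtain ⟨a, b, hab, rfl⟩ : ∃ a b : κ → ℝ, (∀ k, a k ≤ b k) ∧ I = fun k => Set.Icc (a k) (b k) := by
    have hI : ∀ k, I k = Set.Icc (sInf (I k)) (sSup (I k)) := fun k =>
      eq_Icc_of_connected_compact (hconn k) (hcomp k)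
    exact ⟨_, _, fun k => Set.nonempty_Icc.1 (hI k ▸ (hconn k).nonempty), funext hI⟩
  obtain ⟨k₀, hmax⟩ := Finite.exists_max a
  have eventually_lt : ∀ c, ∀ᶠ s in 𝓝[<] a k₀, c < a k₀ → c < s := fun c => by
    by_cases hc : c < a k₀
    · filter_upwards [Ioo_mem_nhdsLT hc] with s hs _ using hs.1
    · exact Eventually.of_forall fun s h => absurd h hc
  obtain ⟨s, hs, hst⟩ := ((eventually_all.2 fun k => (eventually_lt (a k)).and
    (eventually_lt (b k))).and (self_mem_nhdsWithin (s := Set.Iio (a k₀)))).exists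
  have hst : s < a k₀ := hst
  have exists_le_iff : ∀ k, (∃ u ∈ Set.Icc (a k) (b k), u ≤ s) ↔ a k ≤ s := fun k =>
    ⟨fun ⟨u, hu, hus⟩ => hu.1.trans hus, fun h => ⟨a k, ⟨le_rfl, hab k⟩, h⟩⟩
  refine ⟨s, a k₀, fun k => ?_, fun k => ?_, k₀, fun u hu => hst.trans_le hu.1⟩
  · rw [exists_le_iff, Set.mem_Icc, Set.mem_Icc]
    refine ⟨fun h => ⟨⟨hmax k, ?_⟩, h.1⟩, fun h => ⟨h.2, hst.le.trans h.1.2⟩⟩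
    exact le_of_not_gt fun hlt => ((hs k).2 hlt).not_ge h.2
  · rw [exists_le_iff]
    rcases (hmax k).eq_or_lt with heq | hlt
    · exact Or.inl ⟨heq.le, heq ▸ hab k⟩
    · exact Or.inr ((hs k).1 hlt).le

lemma exists_nerve_eq_union [Finite ι] {m : ℕ} {C : ι → Set (Fin (m + 1) → ℝ)}
    (hconv : ∀ i, Convex ℝ (C i)) (hcomp : ∀ i, IsCompact (C i))
    (hne : ∃ σ ∈ nerve C, σ.Nonempty) :
    ∃ s t, nerve C = nerve (fun i => slice t (C i)) ∪ nerve (fun i => C i ∩ {x | x 0 ≤ s}) ∧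
      nerve (fun i => slice s (C i)) =
        nerve (fun i => slice t (C i)) ∩ nerve (fun i => C i ∩ {x | x 0 ≤ s}) ∧
      nerve (fun i => C i ∩ {x | x 0 ≤ s}) ⊂ nerve C := by
  let κ := {σ : Finset ι // σ ∈ nerve C ∧ σ.Nonempty}
  have : Nonempty κ := let ⟨σ, hσ⟩ := hne; ⟨σ, hσ⟩
  obtain ⟨s, t, hinter, hunion, ⟨σ₀, hσ₀⟩, hlt⟩ := exists_cut
    (fun σ : κ => isCompact_heights hcomp σ.2.2) (fun σ : κ => isConnected_heights hconv σ.2.1)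
  have hsub : nerve (fun i => C i ∩ {x | x 0 ≤ s}) ⊆ nerve C := fun σ hσ =>
    hσ.mono (Set.iInter₂_mono fun i _ => Set.inter_subset_left)
  have hslice : ∀ u, nerve (fun i => slice u (C i)) ⊆ nerve C := fun u σ hσ =>
    heights_nonempty_iff.1 ⟨u, mem_nerve_slice_iff.1 hσ⟩
  have empty_mem : ∀ {n : ℕ} (D : ι → Set (Fin n → ℝ)), ∅ ∈ nerve D := fun D => ⟨0, by simp⟩
  refine ⟨s, t, (Set.union_subset (hslice t) hsub).antisymm' fun σ hσ => ?_,
    Set.ext fun σ => ?_, hsub, fun hsup => ?_⟩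
  · rcases σ.eq_empty_or_nonempty with rfl | hn
    · exact Or.inl (empty_mem _)
    · rw [Set.mem_union, mem_nerve_slice_iff, mem_nerve_inter_halfSpace_iff hn]
      exact hunion ⟨σ, hσ, hn⟩
  · rcases σ.eq_empty_or_nonempty with rfl | hn
    · exact iff_of_true (empty_mem _) ⟨empty_mem _, empty_mem _⟩
    by_cases hσ : σ ∈ nerve C
    · rw [Set.mem_inter_iff, mem_nerve_slice_iff, mem_nerve_slice_iff,
        mem_nerve_inter_halfSpace_iff hn]
      exact hinter ⟨σ, hσ, hn⟩
    · exact iff_of_false (fun h => hσ (hslice s h)) fun h => hσ (hsub h.2)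
  · obtain ⟨u, hu, hus⟩ := (mem_nerve_inter_halfSpace_iff hσ₀.2).1 (hsup hσ₀.1)
    exact (hlt u hu).not_ge hus

variable [LinearOrder ι]

/-- The family `𝒦` of simplices carries no reduced rational homology in dimension `j`. -/
def IsAcyclicAt (𝒦 : Set (Finset ι)) (j : ℕ) : Prop :=
  ∀ z ∈ Finsupp.supported ℚ ℚ {σ | σ ∈ 𝒦 ∧ σ.card = j + 1}, augBoundary ι z = 0 →
    ∃ w ∈ Finsupp.supported ℚ ℚ {σ | σ ∈ 𝒦 ∧ σ.card = j + 2}, augBoundary ι w = z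

lemma augBoundary_mem_supported_of_isLowerSet {𝒦 : Set (Finset ι)} (h𝒦 : IsLowerSet 𝒦) {c : ℕ}
    {z : Finset ι →₀ ℚ} (hz : z ∈ Finsupp.supported ℚ ℚ {σ | σ ∈ 𝒦 ∧ σ.card = c + 1}) :
    augBoundary ι z ∈ Finsupp.supported ℚ ℚ {σ | σ ∈ 𝒦 ∧ σ.card = c} := by
  refine augBoundary_mem_supported ?_ hz
  rintro σ ⟨hσ, hcard⟩ i hi
  exact ⟨h𝒦 (σ.erase_subset i) hσ, by rw [Finset.card_erase_of_mem hi, hcard, Nat.add_sub_cancel]⟩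

lemma isAcyclicAt_of_subset_singleton_empty {𝒦 : Set (Finset ι)} (h𝒦 : 𝒦 ⊆ {∅}) (j : ℕ) :
    IsAcyclicAt 𝒦 j := by
  intro z hz _
  refine ⟨0, Submodule.zero_mem _, (map_zero _).trans (eq_zero_of_mem_supported ?_ hz).symm⟩
  rintro σ ⟨hσ, hcard⟩
  simp [Set.mem_singleton_iff.1 (h𝒦 hσ)] at hcard

lemma isAcyclicAt_simplex {V : Set ι} (hV : V.Finite) (j : ℕ) :
    IsAcyclicAt {σ : Finset ι | ↑σ ⊆ V} j := by
  rcases V.eq_empty_or_nonempty with rfl | hne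
  · exact isAcyclicAt_of_subset_singleton_empty (fun σ hσ => by simpa using hσ) j
  · intro z hz hc
    obtain ⟨v, hv, hmin⟩ := hV.exists_minimalFor id V hne
    have hle : ∀ i ∈ V, v ≤ i := fun i hi => (le_total v i).elim id (hmin hi)
    refine ⟨coneMap v z, coneMap_mem_supported ?_ hz,
      augBoundary_coneMap_of_cycle (fun σ hσ i hi => hle i (hσ.1 hi)) hz hc⟩
    rintro σ ⟨hσ, hcard⟩ hvσ
    refine ⟨?_, by rw [Finset.card_insert_of_notMem hvσ, hcard]⟩
    exact (Finset.coe_insert v σ).trans_subset (Set.insert_subset hv hσ)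

/-- This is the Mayer–Vietoris sequence, on the level of chains. -/
lemma IsAcyclicAt.union {𝒦 ℒ : Set (Finset ι)} (h𝒦 : IsLowerSet 𝒦) (hℒ : IsLowerSet ℒ) {j : ℕ}
    (hinter : IsAcyclicAt (𝒦 ∩ ℒ) j) (h𝒦j : IsAcyclicAt 𝒦 (j + 1)) (hℒj : IsAcyclicAt ℒ (j + 1)) :
    IsAcyclicAt (𝒦 ∪ ℒ) (j + 1) := by
  intro z hz hc
  have hsup : ∀ c, {σ : Finset ι | σ ∈ 𝒦 ∪ ℒ ∧ σ.card = c} =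
      {σ | σ ∈ 𝒦 ∧ σ.card = c} ∪ {σ | σ ∈ ℒ ∧ σ.card = c} := fun c => by
    ext σ; exact or_and_right
  rw [hsup, Finsupp.supported_union, Submodule.mem_sup] at hz
  obtain ⟨x, hx, y, hy, rfl⟩ := hz
  have hxy : augBoundary ι x = -augBoundary ι y := by rwa [map_add, ← eq_neg_iff_add_eq_zero] at hc
  have hx_inter : augBoundary ι x ∈ Finsupp.supported ℚ ℚ {σ | σ ∈ 𝒦 ∩ ℒ ∧ σ.card = j + 1} := by
    have hx' := augBoundary_mem_supported_of_isLowerSet h𝒦 hx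
    have hy' := neg_mem (augBoundary_mem_supported_of_isLowerSet hℒ hy)
    rw [← hxy] at hy'
    exact fun σ hσ => ⟨⟨(hx' hσ).1, (hy' hσ).1⟩, (hx' hσ).2⟩
  obtain ⟨w, hw, hwx⟩ := hinter _ hx_inter (augBoundary_augBoundary x)
  obtain ⟨u, hu, hux⟩ := h𝒦j (x - w)
    (sub_mem hx (Finsupp.supported_mono (by grind) hw))
    (by rw [map_sub, hwx, sub_self])
  obtain ⟨v, hv, hvy⟩ := hℒj (w + y)
    (add_mem (Finsupp.supported_mono (by grind) hw) hy)
    (by rw [map_add, hwx, hxy, neg_add_cancel])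
  refine ⟨u + v, ?_, by rw [map_add, hux, hvy]; abel⟩
  rw [hsup, Finsupp.supported_union]
  exact Submodule.add_mem_sup hu hv

variable [Finite ι]

lemma isAcyclicAt_nerve_of_convex {m : ℕ} {C : ι → Set (Fin m → ℝ)} (hconv : ∀ i, Convex ℝ (C i))
    (hcomp : ∀ i, IsCompact (C i)) {j : ℕ} (hj : m ≤ j) : IsAcyclicAt (nerve C) j := by
  induction m generalizing j with
  | zero =>
    have hnerve : nerve C = {σ : Finset ι | ↑σ ⊆ {i | (C i).Nonempty}} := by
      ext σ
      simp only [nerve, Set.mem_ofPred_eq, Set.Nonempty, Unique.exists_iff, Set.mem_iInter]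
      rfl
    exact hnerve ▸ isAcyclicAt_simplex (Set.toFinite _) j
  | succ m ihm =>
    obtain ⟨j, rfl⟩ := Nat.exists_eq_add_of_le' (Nat.le_of_add_left_le hj)
    induction hN : (nerve C).ncard using Nat.strong_induction_on generalizing C with
    | _ N ih =>
    by_cases hne : ∃ σ ∈ nerve C, σ.Nonempty
    · obtain ⟨s, t, hunion, hinter, hlt⟩ := exists_nerve_eq_union hconv hcomp hne
      have acyclic_slice : ∀ u {i}, m ≤ i → IsAcyclicAt (nerve fun i => slice u (C i)) i :=
        fun u i hi => ihm (fun i => convex_slice u (hconv i))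
          (fun i => isCompact_slice u (hcomp i)) hi
      rw [hunion]
      refine .union (isLowerSet_nerve _) (isLowerSet_nerve _) ?_ (acyclic_slice t (by lia)) ?_
      · exact hinter ▸ acyclic_slice s (by lia)
      · exact ih _ (hN ▸ Set.ncard_lt_ncard hlt)
          (fun i => (hconv i).inter (convex_halfSpace_le (isLinearMap_apply_zero m) s))
          (fun i => (hcomp i).inter_right (isClosed_le (continuous_apply 0) continuous_const)) rfl
    · push Not at hne
      exact isAcyclicAt_of_subset_singleton_empty (fun σ hσ => hne σ hσ) _

theorem betti_cechComplex_eq_zero {E : Type*} [NormedAddCommGroup E] [NormedSpace ℝ E]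
    [FiniteDimensional ℝ E] (x : ι → E) (r : ℝ) {j : ℕ} (hj : 1 ≤ j)
    (hd : Module.finrank ℝ E ≤ j) : (cechComplex x r).betti j = 0 := by
  have := FiniteDimensional.proper_real E
  let e := (Module.finBasis ℝ E).equivFunL
  let C : ι → Set (Fin (Module.finrank ℝ E) → ℝ) := fun i => e '' Metric.closedBall (x i) r
  have mem_nerve : ∀ σ : Finset ι, σ ∈ nerve C ↔
      (⋂ i ∈ σ, Metric.closedBall (x i) r).Nonempty := fun σ => by
    rw [← Set.image_nonempty (f := e), Set.image_iInter₂ e.bijective]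
    rfl
  have hfaces : ∀ c, {σ | σ ∈ nerve C ∧ σ.card = c + 1} =
      {σ | σ ∈ cechComplex x r ∧ σ.card = c + 1} := fun c => by
    ext σ
    refine and_congr_left fun hcard => (mem_nerve σ).trans (and_iff_right ?_).symm
    exact Finset.card_pos.1 (by lia)
  have acyclic := isAcyclicAt_nerve_of_convex (C := C)
    (fun i => (convex_closedBall (x i) r).linear_image e.toLinearMap)
    (fun i => (isCompact_closedBall (x i) r).image e.continuous) hd
  refine betti_eq_zero_of_cycles_le fun z hz => ?_
  obtain ⟨w, hw, rfl⟩ := acyclic z (hfaces j ▸ hz.1) (augBoundary_eq_zero_of_mem_cycles hj hz)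
  refine ⟨w, (hfaces (j + 1)).subset.trans' hw, simplicialBoundary_eq_augBoundary ?_ hw⟩
  rintro σ ⟨-, hcard⟩
  lia

end Leray

/-! ### Holes and excess of Čech complexes -/

section ThresholdPow

/-- The function `N ↦ (1 + N) ^ a` cut off below `b`. It bounds the effect of a point with `N` other
points near it on a statistic that ignores points with fewer than `b` other points near them. -/
def thresholdPow (a b N : ℕ) : ℝ := if b ≤ N then (1 + N : ℝ) ^ a else 0

lemma thresholdPow_nonneg (a b N : ℕ) : 0 ≤ thresholdPow a b N := by
  unfold thresholdPow; split_ifs <;> positivity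

lemma thresholdPow_mono (a b : ℕ) {N M : ℕ} (h : N ≤ M) :
    thresholdPow a b N ≤ thresholdPow a b M := by
  unfold thresholdPow
  split_ifs with hbN hbM hbM
  · gcongr
  · exact absurd (hbN.trans h) hbM
  · positivity
  · exact le_rfl

lemma thresholdPow_zero (a N : ℕ) : thresholdPow a 0 N = (1 + N : ℝ) ^ a := by
  simp [thresholdPow]

lemma thresholdPow_mul (a a' b N : ℕ) :
    thresholdPow a b N * (1 + N : ℝ) ^ a' = thresholdPow (a + a') b N := by
  rw [thresholdPow, thresholdPow, ite_mul, zero_mul, pow_add]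

lemma thresholdPow_le_of_le (a : ℕ) {b b' : ℕ} (h : b ≤ b') (N : ℕ) :
    thresholdPow a b' N ≤ thresholdPow a b N := by
  unfold thresholdPow
  split_ifs with hN' hN
  · exact le_rfl
  · exact absurd (h.trans hN') hN
  · positivity
  · exact le_rfl

lemma choose_add_le_thresholdPow (N : ℕ) {a b c m : ℕ} (hc : c ≤ 1) (hb : b + c ≤ m) (hm : m ≤ a) :
    ((N + c).choose m : ℝ) ≤ thresholdPow a b N := by
  unfold thresholdPow
  split_ifs with hN
  · calc ((N + c).choose m : ℝ) ≤ ((N + c : ℕ) : ℝ) ^ m := by exact_mod_cast Nat.choose_le_pow _ _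
      _ ≤ (1 + N : ℝ) ^ m := by gcongr; exact_mod_cast (by lia : N + c ≤ 1 + N)
      _ ≤ (1 + N : ℝ) ^ a := pow_le_pow_right₀ (by simp) hm
  · rw [Nat.choose_eq_zero_of_lt (by lia), Nat.cast_zero]

end ThresholdPow

section Cech

variable {ι : Type*}

/-- The full subcomplex of `K` on the set of vertices `I`. -/
def induce (K : PreAbstractSimplicialComplex ι) (I : Finset ι) :
    PreAbstractSimplicialComplex ι where
  faces := {σ | σ ∈ K ∧ σ ⊆ I}
  isRelLowerSet_faces := fun _ hσ =>
    ⟨nonempty_of_mem hσ.1, fun _ hτσ hτ => ⟨mem_of_subset hσ.1 hτσ hτ, hτσ.trans hσ.2⟩⟩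

lemma mem_induce {K : PreAbstractSimplicialComplex ι} {I σ : Finset ι} :
    σ ∈ induce K I ↔ σ ∈ K ∧ σ ⊆ I := Iff.rfl

lemma induce_univ [Fintype ι] (K : PreAbstractSimplicialComplex ι) :
    induce K Finset.univ = K :=
  SetLike.ext fun _ => and_iff_left (Finset.subset_univ _)

lemma induce_mono (K : PreAbstractSimplicialComplex ι) {I J : Finset ι} (h : I ⊆ J) :
    induce K I ≤ induce K J :=
  fun _ hσ => ⟨hσ.1, hσ.2.trans h⟩

variable {E : Type*} [PseudoMetricSpace E] {x : ι → E} {r R : ℝ} {k : ℕ} {A I σ : Finset ι} {v : ι}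

lemma dist_le_of_mem_cechComplex (h : σ ∈ cechComplex x r) {u v : ι} (hu : u ∈ σ) (hv : v ∈ σ) :
    dist (x u) (x v) ≤ 2 * r := by
  obtain ⟨-, p, hp⟩ := h
  have hup := Metric.mem_closedBall.1 (Set.mem_iInter₂.1 hp u hu)
  have hvp := Metric.mem_closedBall.1 (Set.mem_iInter₂.1 hp v hv)
  linarith [dist_triangle_left (x u) (x v) p]

lemma induce_congr {x' : ι → E} (h : ∀ i ∈ I, x i = x' i) :
    induce (cechComplex x r) I = induce (cechComplex x' r) I := by
  refine SetLike.ext fun σ => and_congr_left fun hσ => and_congr_right fun _ => ?_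
  rw [Set.iInter₂_congr fun i hi => by rw [h i (hσ hi)]]

variable [LinearOrder ι]

/-- No point of index in `A` is within distance `R` of a point of index in `B`. -/
def Apart (x : ι → E) (R : ℝ) (A B : Finset ι) : Prop :=
  ∀ u ∈ A, ∀ w ∈ B, R < dist (x u) (x w)

lemma Apart.subset_or_subset_sdiff (h : Apart x R A (I \ A)) (hσI : σ ⊆ I)
    (hσ : ∀ u ∈ σ, ∀ w ∈ σ, dist (x u) (x w) ≤ R) : σ ⊆ A ∨ σ ⊆ I \ A := by
  refine or_iff_not_imp_left.2 fun hσA w hw => Finset.mem_sdiff.2 ⟨hσI hw, fun hwA => ?_⟩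
  obtain ⟨u, hu, huA⟩ := Finset.not_subset.1 hσA
  exact (h w hwA u (Finset.mem_sdiff.2 ⟨hσI hu, huA⟩)).not_ge (hσ w hw u hu)

/-- The indices in `I`, other than `v`, of the points at distance at most `R` from the point of
index `v`. -/
def near (x : ι → E) (R : ℝ) (v : ι) (I : Finset ι) : Finset ι :=
  (I.erase v).filter fun u => dist (x u) (x v) ≤ R

lemma mem_near {u : ι} : u ∈ near x R v I ↔ u ≠ v ∧ u ∈ I ∧ dist (x u) (x v) ≤ R := by
  rw [near, Finset.mem_filter, Finset.mem_erase, and_assoc]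

/-- The number of points of index in `I`, other than the one of index `v`, at distance at most `R`
from it. -/
def nearCount (x : ι → E) (R : ℝ) (v : ι) (I : Finset ι) : ℕ := (near x R v I).card

lemma nearCount_mono (x : ι → E) (R : ℝ) (v : ι) {I J : Finset ι} (h : I ⊆ J) :
    nearCount x R v I ≤ nearCount x R v J :=
  Finset.card_le_card (Finset.filter_subset_filter _ (Finset.erase_subset_erase _ h))

lemma erase_subset_near (hσ : σ ⊆ I) (h : ∀ u ∈ σ, dist (x u) (x v) ≤ R) :
    σ.erase v ⊆ near x R v I := fun u hu =>
  have hu := Finset.mem_erase.1 hu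
  mem_near.2 ⟨hu.1, hσ hu.2, h u hu.2⟩

/-- The Betti number in dimension `k - 2` of the Čech complex on the points of index in `I`. It is
meant for `3 ≤ k`, in view of the truncated subtraction. -/
def inducedBetti (x : ι → E) (r : ℝ) (k : ℕ) (I : Finset ι) : ℝ :=
  (induce (cechComplex x r) I).betti (k - 2)

/-- The holes of the Čech complex with `k` vertices, all in `I`: the local contributions to the
Betti number in dimension `k - 2`. -/
def holes (x : ι → E) (r : ℝ) (k : ℕ) (I : Finset ι) : Finset (Finset ι) :=
  open Classical in (I.powersetCard k).filter fun σ => IsHole (cechComplex x r) σ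

/-- The part of the Betti number that does not come from holes with `k` vertices. -/
def bettiExcess (x : ι → E) (r : ℝ) (k : ℕ) (I : Finset ι) : ℝ :=
  inducedBetti x r k I - (holes x r k I).card

lemma mem_holes : σ ∈ holes x r k I ↔ σ ⊆ I ∧ σ.card = k ∧ IsHole (cechComplex x r) σ := by
  simp only [holes, Finset.mem_filter, Finset.mem_powersetCard, and_assoc]

lemma isHole_induce_iff {K : PreAbstractSimplicialComplex ι} (h : σ ⊆ I) :
    IsHole (induce K I) σ ↔ IsHole K σ := by
  simp only [IsHole, mem_induce, h, and_true, (Finset.erase_subset _ σ).trans h]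

lemma inducedBetti_congr {x' : ι → E} (h : ∀ i ∈ I, x i = x' i) :
    inducedBetti x r k I = inducedBetti x' r k I := by
  rw [inducedBetti, inducedBetti, induce_congr h]

lemma isHole_congr {x' : ι → E} (h : ∀ i ∈ σ, x i = x' i) :
    IsHole (cechComplex x r) σ ↔ IsHole (cechComplex x' r) σ := by
  rw [← isHole_induce_iff subset_rfl, ← isHole_induce_iff (K := cechComplex x' r) subset_rfl,
    induce_congr h]

lemma holes_congr {x' : ι → E} (h : ∀ i ∈ I, x i = x' i) : holes x r k I = holes x' r k I := by
  ext σ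
  rw [mem_holes, mem_holes]
  exact and_congr_right fun hσ => and_congr_right fun _ => isHole_congr fun i hi => h i (hσ hi)

lemma bettiExcess_congr {x' : ι → E} (h : ∀ i ∈ I, x i = x' i) :
    bettiExcess x r k I = bettiExcess x' r k I := by
  rw [bettiExcess, bettiExcess, inducedBetti_congr h, holes_congr h]

lemma dist_le_of_isHole (h : IsHole (cechComplex x r) σ) (hσ : 3 ≤ σ.card) {u v : ι} (hu : u ∈ σ)
    (hv : v ∈ σ) : dist (x u) (x v) ≤ 2 * r := by
  obtain ⟨w, hw, hwuv⟩ : ∃ w ∈ σ, w ∉ ({u, v} : Finset ι) :=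
    Finset.exists_mem_notMem_of_card_lt_card (Finset.card_le_two.trans_lt hσ)
  rw [Finset.mem_insert, Finset.mem_singleton, not_or] at hwuv
  exact dist_le_of_mem_cechComplex (h.2 w hw) (Finset.mem_erase.2 ⟨Ne.symm hwuv.1, hu⟩)
    (Finset.mem_erase.2 ⟨Ne.symm hwuv.2, hv⟩)

lemma dist_le_of_mem_holes (hk : 3 ≤ k) (hσ : σ ∈ holes x r k I) {u v : ι} (hu : u ∈ σ)
    (hv : v ∈ σ) : dist (x u) (x v) ≤ 2 * r :=
  have ⟨_, hcard, hhole⟩ := mem_holes.1 hσ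
  dist_le_of_isHole hhole (hcard ▸ hk) hu hv

lemma holes_eq_singleton (h : IsHole (cechComplex x r) σ) : holes x r σ.card σ = {σ} := by
  ext τ
  rw [mem_holes, Finset.mem_singleton]
  exact ⟨fun hτ => Finset.eq_of_subset_of_card_le hτ.1 hτ.2.1.ge, by rintro rfl; simp [h]⟩

lemma holes_erase (x : ι → E) (r : ℝ) (k : ℕ) (I : Finset ι) (v : ι) :
    holes x r k (I.erase v) = (holes x r k I).filter fun σ => v ∉ σ := by
  ext σ
  rw [Finset.mem_filter, mem_holes, mem_holes, Finset.subset_erase]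
  tauto

lemma card_holes_mem_le (hk : 3 ≤ k) (hR : 2 * r ≤ R) (v : ι) (I : Finset ι) :
    (((holes x r k I).filter fun σ => v ∈ σ).card : ℝ)
      ≤ thresholdPow k (k - 1) (nearCount x R v I) := by
  refine le_trans ?_ (choose_add_le_thresholdPow (nearCount x R v I) zero_le_one le_rfl
    (Nat.sub_le k 1))
  rw [add_zero, nearCount, ← Finset.card_powersetCard, Nat.cast_le]
  refine Finset.card_le_card_of_injOn (fun σ => σ.erase v) (fun σ hσ => ?_)
    fun σ hσ τ hτ (heq : σ.erase v = τ.erase v) => ?_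
  · obtain ⟨hσ, hv⟩ := Finset.mem_filter.1 hσ
    obtain ⟨hσI, hcard, -⟩ := mem_holes.1 hσ
    exact Finset.mem_powersetCard.2
      ⟨erase_subset_near hσI fun u hu => (dist_le_of_mem_holes hk hσ hu hv).trans hR,
        by rw [Finset.card_erase_of_mem hv, hcard, add_zero]⟩
  · rw [← Finset.insert_erase (Finset.mem_filter.1 hσ).2, heq,
      Finset.insert_erase (Finset.mem_filter.1 hτ).2]

lemma sum_holes_le_sum_sum (hk : 0 < k) {F : Finset ι → ℝ} (hF : ∀ σ, 0 ≤ F σ) :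
    ∑ σ ∈ holes x r k I, F σ ≤ ∑ v ∈ I, ∑ σ ∈ (holes x r k I).filter (fun σ => v ∈ σ), F σ := by
  simp_rw [Finset.sum_filter]
  rw [Finset.sum_comm]
  refine Finset.sum_le_sum fun σ hσ => ?_
  obtain ⟨hσI, hcard, -⟩ := mem_holes.1 hσ
  obtain ⟨v, hv⟩ : σ.Nonempty := Finset.card_pos.1 (hcard ▸ hk)
  have hnonneg : ∀ u ∈ I, 0 ≤ if u ∈ σ then F σ else 0 := fun u _ => ite_nonneg (hF σ) le_rfl
  simpa [hv] using Finset.single_le_sum hnonneg (hσI hv)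

lemma card_holes_le (hk : 3 ≤ k) (hR : 2 * r ≤ R) (I : Finset ι) :
    ((holes x r k I).card : ℝ) ≤ ∑ v ∈ I, thresholdPow k (k - 1) (nearCount x R v I) := by
  refine le_trans ?_ (Finset.sum_le_sum fun v _ => card_holes_mem_le hk hR v I)
  simpa using sum_holes_le_sum_sum (x := x) (r := r) (by lia : 0 < k) (I := I) (F := fun _ => 1)
    (fun _ => zero_le_one)

lemma card_holes_add (hk : 3 ≤ k) (hA : A ⊆ I) (h : Apart x (2 * r) A (I \ A)) :
    (holes x r k I).card = (holes x r k A).card + (holes x r k (I \ A)).card := by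
  have hdisj : Disjoint (holes x r k A) (holes x r k (I \ A)) := by
    refine Finset.disjoint_left.2 fun σ hσA hσ => ?_
    obtain ⟨hσA, hcard, -⟩ := mem_holes.1 hσA
    obtain ⟨u, hu⟩ : σ.Nonempty := Finset.card_pos.1 (by lia)
    exact (Finset.mem_sdiff.1 ((mem_holes.1 hσ).1 hu)).2 (hσA hu)
  rw [← Finset.card_union_of_disjoint hdisj]
  congr 1
  ext σ
  rw [Finset.mem_union]
  refine ⟨fun hσ => ?_, ?_⟩
  · obtain ⟨hσI, hσ'⟩ := mem_holes.1 hσ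
    exact (h.subset_or_subset_sdiff hσI fun u hu w hw => dist_le_of_mem_holes hk hσ hu hw).imp
      (fun hσA => mem_holes.2 ⟨hσA, hσ'⟩) fun hσA => mem_holes.2 ⟨hσA, hσ'⟩
  · rintro (hσ | hσ) <;> obtain ⟨hsub, hσ⟩ := mem_holes.1 hσ
    · exact mem_holes.2 ⟨hsub.trans hA, hσ⟩
    · exact mem_holes.2 ⟨hsub.trans Finset.sdiff_subset, hσ⟩

lemma exists_subset_of_card_le {B : ℕ → Finset ι} (hB : Monotone B) (h₀ : (B 0).Nonempty)
    (hcard : (B k).card ≤ k) : ∃ j < k, B (j + 1) ⊆ B j := by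
  by_contra! hgrow
  have hcard_ge : ∀ j ≤ k, j + 1 ≤ (B j).card := by
    intro j hj
    induction j with
    | zero => exact Finset.card_pos.2 h₀
    | succ j ih =>
      have hlt := Finset.card_lt_card ⟨hB (Nat.le_succ j), hgrow j hj⟩
      have := ih (by lia)
      lia
  have := hcard_ge k le_rfl
  lia

/-- The balls of radii `2 * r * j` about the point, `j ≤ k`, cannot all catch a new point. -/
lemma exists_apart_of_nearCount_lt (hr : 0 ≤ r) (hv : v ∈ I)
    (hnear : nearCount x (2 * r * k) v I < k) :
    ∃ A ⊆ I, v ∈ A ∧ A.card ≤ k ∧ Apart x (2 * r) A (I \ A) := by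
  let B : ℕ → Finset ι := fun j => I.filter fun u => dist (x u) (x v) ≤ 2 * r * j
  have hvB : ∀ j, v ∈ B j := fun j => Finset.mem_filter.2 ⟨hv, by rw [dist_self]; positivity⟩
  have hmono : Monotone B := fun i j hij =>
    Finset.monotone_filter_right I fun u _ hu => hu.trans (by gcongr)
  have hcard : (B k).card ≤ k := by
    have hB : (B k).erase v = near x (2 * r * k) v I := by
      rw [near, ← Finset.filter_erase]
    rw [nearCount, ← hB, Finset.card_erase_of_mem (hvB k)] at hnear
    lia
  obtain ⟨j, hj, hjB⟩ := exists_subset_of_card_le hmono ⟨v, hvB 0⟩ hcard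
  refine ⟨B j, Finset.filter_subset _ _, hvB j, (Finset.card_le_card (hmono hj.le)).trans hcard,
    fun u hu w hw => ?_⟩
  by_contra! hle
  rw [Finset.mem_sdiff] at hw
  refine hw.2 (hjB (Finset.mem_filter.2 ⟨hw.1, ?_⟩))
  have huv := (Finset.mem_filter.1 hu).2
  push_cast
  linarith [dist_triangle_left (x w) (x v) (x u)]

end Cech

section Increments

variable {ι E : Type*} [LinearOrder ι] [PseudoMetricSpace E] {x : ι → E} {r R : ℝ}
  {k : ℕ} {A I σ : Finset ι} {v : ι}

lemma card_powersetCard_union_le (hk : 1 ≤ k) (S : Finset ι) :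
    (S.powersetCard (k - 1) ∪ S.powersetCard k).card ≤ (S.card + 1).choose k := by
  obtain ⟨k, rfl⟩ := Nat.exists_eq_add_of_le' hk
  refine (Finset.card_union_le _ _).trans_eq ?_
  rw [Finset.card_powersetCard, Finset.card_powersetCard, Nat.add_sub_cancel, Nat.choose_succ_succ]

lemma induce_eq_sup (hA : A ⊆ I) (h : Apart x (2 * r) A (I \ A)) :
    induce (cechComplex x r) I = induce (cechComplex x r) A ⊔ induce (cechComplex x r) (I \ A) := by
  refine le_antisymm (fun σ hσ => ?_)
    (sup_le (induce_mono _ hA) (induce_mono _ Finset.sdiff_subset))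
  exact (h.subset_or_subset_sdiff hσ.2 fun u hu w hw =>
    dist_le_of_mem_cechComplex hσ.1 hu hw).imp (fun hσA => ⟨hσ.1, hσA⟩) fun hσA => ⟨hσ.1, hσA⟩

lemma two_mul_le_two_mul_mul (hk : 1 ≤ k) (hr : 0 ≤ r) : 2 * r ≤ 2 * r * k :=
  le_mul_of_one_le_right (by positivity) (by exact_mod_cast hk)

variable [Finite ι]

lemma abs_inducedBetti_sub_erase_le (hk : 3 ≤ k) (hR : 2 * r ≤ R) (v : ι) (I : Finset ι) :
    |inducedBetti x r k I - inducedBetti x r k (I.erase v)|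
      ≤ thresholdPow k 1 (nearCount x R v I) := by
  let S := near x R v I
  have hT : ∀ σ ∈ induce (cechComplex x r) I, σ ∉ induce (cechComplex x r) (I.erase v) →
      σ.card = k - 2 + 1 ∨ σ.card = k - 2 + 2 →
      σ ∈ (S.powersetCard (k - 1 - 1) ∪ S.powersetCard (k - 1)).image (insert v) := by
    rintro σ ⟨hσ, hσI⟩ hσn hcard
    have hvσ : v ∈ σ := by
      by_contra hv
      exact hσn ⟨hσ, Finset.subset_erase.2 ⟨hσI, hv⟩⟩
    have hsub : σ.erase v ⊆ S := erase_subset_near hσI fun u hu =>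
      (dist_le_of_mem_cechComplex hσ hu hvσ).trans hR
    have hcard_erase := Finset.card_erase_of_mem hvσ
    refine Finset.mem_image.2 ⟨σ.erase v, Finset.mem_union.2 ?_, Finset.insert_erase hvσ⟩
    exact hcard.imp (fun h => Finset.mem_powersetCard.2 ⟨hsub, by lia⟩)
      fun h => Finset.mem_powersetCard.2 ⟨hsub, by lia⟩
  calc |inducedBetti x r k I - inducedBetti x r k (I.erase v)|
      ≤ _ := abs_betti_sub_betti_le (induce_mono _ (Finset.erase_subset v I)) hT
    _ ≤ ((nearCount x R v I + 1).choose (k - 1) : ℕ) := by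
        exact_mod_cast Finset.card_image_le.trans (card_powersetCard_union_le (by lia) S)
    _ ≤ _ := choose_add_le_thresholdPow _ le_rfl (by lia) (by lia)

lemma abs_inducedBetti_sub_sdiff_le (hk : 3 ≤ k) (hR : 2 * r ≤ R) (I σ : Finset ι) :
    |inducedBetti x r k I - inducedBetti x r k (I \ σ)|
      ≤ ∑ v ∈ σ, thresholdPow k 1 (nearCount x R v I) := by
  induction σ using Finset.induction_on with
  | empty => simp
  | insert v σ hv ih =>
    have herase := abs_inducedBetti_sub_erase_le (x := x) hk hR v (I \ σ)
    rw [← Finset.sdiff_insert] at herase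
    rw [Finset.sum_insert hv, add_comm]
    exact (abs_sub_le _ _ _).trans (add_le_add ih (herase.trans
      (thresholdPow_mono k 1 (nearCount_mono x R v Finset.sdiff_subset))))

lemma inducedBetti_add (hA : A ⊆ I) (h : Apart x (2 * r) A (I \ A)) :
    inducedBetti x r k I = inducedBetti x r k A + inducedBetti x r k (I \ A) := by
  rw [inducedBetti, induce_eq_sup hA h, betti_sup, Nat.cast_add]
  · rfl
  · refine Set.disjoint_left.2 fun σ hσA hσ => ?_
    obtain ⟨u, hu⟩ := nonempty_of_mem hσA.1
    exact (Finset.mem_sdiff.1 (hσ.2 hu)).2 (hσA.2 hu)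

lemma bettiExcess_add (hk : 3 ≤ k) (hA : A ⊆ I) (h : Apart x (2 * r) A (I \ A)) :
    bettiExcess x r k I = bettiExcess x r k A + bettiExcess x r k (I \ A) := by
  rw [bettiExcess, bettiExcess, bettiExcess, inducedBetti_add hA h, card_holes_add hk hA h]
  push_cast
  ring

lemma inducedBetti_of_card_le (hk : 3 ≤ k) (hA : A.card ≤ k) :
    inducedBetti x r k A = (holes x r k A).card := by
  classical
  rw [inducedBetti, betti_eq_ite_isHole (by lia) (by lia)
      fun σ (hσ : σ ∈ induce (cechComplex x r) A) => hσ.2,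
    isHole_induce_iff subset_rfl, Nat.sub_add_cancel (by lia), Nat.cast_inj]
  split_ifs with h
  · rw [← h.1, holes_eq_singleton h.2, Finset.card_singleton]
  · refine (Finset.card_eq_zero.2 (Finset.eq_empty_iff_forall_notMem.2 fun σ hσ => h ?_)).symm
    obtain ⟨hσA, hcard, hhole⟩ := mem_holes.1 hσ
    obtain rfl := Finset.eq_of_subset_of_card_le hσA (by lia)
    exact ⟨hcard, hhole⟩

lemma bettiExcess_of_card_le (hk : 3 ≤ k) (hA : A.card ≤ k) : bettiExcess x r k A = 0 := by
  rw [bettiExcess, inducedBetti_of_card_le hk hA, sub_self]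

lemma bettiExcess_erase (hk : 3 ≤ k) (hr : 0 ≤ r) (hv : v ∈ I)
    (hnear : nearCount x (2 * r * k) v I < k) :
    bettiExcess x r k (I.erase v) = bettiExcess x r k I := by
  obtain ⟨A, hAI, hvA, hcard, hapart⟩ := exists_apart_of_nearCount_lt hr hv hnear
  have hsdiff : I.erase v \ A.erase v = I \ A := by grind
  have hapart' : Apart x (2 * r) (A.erase v) (I.erase v \ A.erase v) := fun u hu w hw =>
    hapart u (Finset.mem_of_mem_erase hu) w (hsdiff ▸ hw)
  rw [bettiExcess_add hk hAI hapart, bettiExcess_add hk (Finset.erase_subset_erase v hAI) hapart',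
    hsdiff, bettiExcess_of_card_le hk hcard,
    bettiExcess_of_card_le hk (Finset.card_erase_le.trans hcard)]

lemma abs_bettiExcess_sub_erase_le (hk : 3 ≤ k) (hr : 0 ≤ r) (I : Finset ι) (v : ι) :
    |bettiExcess x r k I - bettiExcess x r k (I.erase v)|
      ≤ 2 * thresholdPow k k (nearCount x (2 * r * k) v I) := by
  have hnonneg := thresholdPow_nonneg k k (nearCount x (2 * r * k) v I)
  by_cases hv : v ∈ I
  swap
  · rw [Finset.erase_eq_of_notMem hv, sub_self, abs_zero]
    positivity
  rcases lt_or_ge (nearCount x (2 * r * k) v I) k with hnear | hnear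
  · rw [bettiExcess_erase hk hr hv hnear, sub_self, abs_zero]
    positivity
  have hR : 2 * r ≤ 2 * r * k := two_mul_le_two_mul_mul (by lia) hr
  have hbetti := abs_inducedBetti_sub_erase_le (x := x) hk hR v I
  have hholes := card_holes_mem_le (x := x) hk hR v I
  have hcard := Finset.card_filter_add_card_filter_not (s := holes x r k I) (fun σ => v ∈ σ)
  rw [← holes_erase, ← @Nat.cast_inj ℝ, Nat.cast_add] at hcard
  have threshold_eq : ∀ b ≤ k, thresholdPow k b (nearCount x (2 * r * k) v I) =
      thresholdPow k k (nearCount x (2 * r * k) v I) := fun b hb => by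
    rw [thresholdPow, thresholdPow, if_pos hnear, if_pos (hb.trans hnear)]
  rw [threshold_eq 1 (by lia)] at hbetti
  rw [threshold_eq (k - 1) (Nat.sub_le k 1)] at hholes
  rw [bettiExcess, bettiExcess]
  rw [abs_le] at hbetti ⊢
  constructor <;> linarith [hbetti.1, hbetti.2,
    ((holes x r k I).filter fun σ => v ∈ σ).card.cast_nonneg (α := ℝ)]

lemma abs_bettiExcess_le (hk : 3 ≤ k) (hr : 0 ≤ r) (I : Finset ι) :
    |bettiExcess x r k I| ≤ ∑ v ∈ I, 2 * thresholdPow k k (nearCount x (2 * r * k) v I) := by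
  induction I using Finset.induction_on with
  | empty => rw [bettiExcess_of_card_le hk (by simp)]; simp
  | insert v I hv ih =>
    have herase := abs_bettiExcess_sub_erase_le (x := x) hk hr (insert v I) v
    rw [Finset.erase_insert hv] at herase
    have hmono : ∑ u ∈ I, 2 * thresholdPow k k (nearCount x (2 * r * k) u I) ≤
        ∑ u ∈ I, 2 * thresholdPow k k (nearCount x (2 * r * k) u (insert v I)) := by
      refine Finset.sum_le_sum fun u _ => mul_le_mul_of_nonneg_left ?_ zero_le_two
      exact thresholdPow_mono _ _ (nearCount_mono x _ u (Finset.subset_insert v I))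
    rw [Finset.sum_insert hv]
    linarith [abs_sub_abs_le_abs_sub (bettiExcess x r k (insert v I)) (bettiExcess x r k I)]

lemma inducedBetti_eq_one_add (hk : 3 ≤ k) (hr : 0 ≤ r) (hR : 4 * r ≤ R) (hσ : σ ∈ holes x r k I)
    (hv : v ∈ σ) (hnear : nearCount x R v I < k) :
    inducedBetti x r k I = 1 + inducedBetti x r k (I \ σ) := by
  obtain ⟨hσI, hcard, hhole⟩ := mem_holes.1 hσ
  have hdist : ∀ u ∈ σ, dist (x u) (x v) ≤ 2 * r := fun u hu => dist_le_of_mem_holes hk hσ hu hv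
  have hnear_eq : σ.erase v = near x R v I := by
    refine Finset.eq_of_subset_of_card_le
      (erase_subset_near hσI fun u hu => (hdist u hu).trans (by linarith)) ?_
    rw [Finset.card_erase_of_mem hv, hcard]
    exact Nat.le_sub_one_of_lt hnear
  have hapart : Apart x (2 * r) σ (I \ σ) := by
    intro u hu w hw
    by_contra! hle
    obtain ⟨hwI, hwσ⟩ := Finset.mem_sdiff.1 hw
    have hw_near : w ∈ near x R v I :=
      mem_near.2 ⟨fun heq => hwσ (heq ▸ hv), hwI, by
        linarith [dist_triangle_left (x w) (x v) (x u), hdist u hu]⟩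
    exact hwσ (Finset.mem_of_mem_erase (hnear_eq ▸ hw_near))
  have hholes : holes x r k σ = {σ} := hcard ▸ holes_eq_singleton hhole
  rw [inducedBetti_add hσI hapart, inducedBetti_of_card_le hk hcard.le, hholes,
    Finset.card_singleton, Nat.cast_one]

lemma abs_inducedBetti_sub_sdiff_le_choose (hk : 2 ≤ k) (hR : 4 * r ≤ R)
    (hσ : ∀ u ∈ σ, dist (x u) (x v) ≤ 2 * r) :
    |inducedBetti x r k I - inducedBetti x r k (I \ σ)| ≤ (nearCount x R v I + 2).choose k := by
  let S := insert v (near x R v I)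
  have hT : ∀ τ ∈ induce (cechComplex x r) I, τ ∉ induce (cechComplex x r) (I \ σ) →
      τ.card = k - 2 + 1 ∨ τ.card = k - 2 + 2 → τ ∈ S.powersetCard (k - 1) ∪ S.powersetCard k := by
    rintro τ ⟨hτ, hτI⟩ hτσ hcard
    obtain ⟨u, hu, huσ⟩ : ∃ u ∈ τ, u ∈ σ := by
      by_contra! hdisj
      exact hτσ ⟨hτ, fun u hu => Finset.mem_sdiff.2 ⟨hτI hu, hdisj u hu⟩⟩
    have hsub : τ ⊆ S := Finset.subset_insert_iff.2 (erase_subset_near hτI fun w hw => by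
      linarith [dist_triangle (x w) (x u) (x v), hσ u huσ, dist_le_of_mem_cechComplex hτ hw hu])
    exact Finset.mem_union.2 (hcard.imp (fun h => Finset.mem_powersetCard.2 ⟨hsub, by lia⟩)
      fun h => Finset.mem_powersetCard.2 ⟨hsub, by lia⟩)
  have hS : S.card = nearCount x R v I + 1 :=
    Finset.card_insert_of_notMem fun hv => (mem_near.1 hv).1 rfl
  calc |inducedBetti x r k I - inducedBetti x r k (I \ σ)|
      ≤ _ := abs_betti_sub_betti_le (induce_mono _ Finset.sdiff_subset) hT
    _ ≤ _ := by exact_mod_cast hS ▸ card_powersetCard_union_le (by lia) S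

lemma abs_inducedBetti_sub_hole_le (hk : 3 ≤ k) (hr : 0 ≤ r) (hR : 4 * r ≤ R)
    (hσ : σ ∈ holes x r k I) (hv : v ∈ σ) :
    |inducedBetti x r k I - (1 + inducedBetti x r k (I \ σ))|
      ≤ 2 ^ (k + 1) * thresholdPow k k (nearCount x R v I) := by
  rcases lt_or_ge (nearCount x R v I) k with hnear | hnear
  · rw [inducedBetti_eq_one_add hk hr hR hσ hv hnear, sub_self, abs_zero]
    exact mul_nonneg (by positivity) (thresholdPow_nonneg _ _ _)
  set N := nearCount x R v I
  have hchoose : ((N + 2).choose k : ℝ) ≤ 2 ^ k * (1 + N) ^ k :=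
    calc ((N + 2).choose k : ℝ) ≤ ((N + 2 : ℕ) : ℝ) ^ k := by exact_mod_cast Nat.choose_le_pow _ _
      _ ≤ (2 * (1 + N)) ^ k := by gcongr; exact_mod_cast (by lia : N + 2 ≤ 2 * (1 + N))
      _ = 2 ^ k * (1 + N) ^ k := mul_pow _ _ _
  have hone : (1 : ℝ) ≤ 2 ^ k * (1 + N) ^ k :=
    one_le_mul_of_one_le_of_one_le (one_le_pow₀ one_le_two) (one_le_pow₀ (by simp))
  have hsdiff : |inducedBetti x r k I - inducedBetti x r k (I \ σ)| ≤ (N + 2).choose k :=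
    abs_inducedBetti_sub_sdiff_le_choose (by lia) hR fun u hu => dist_le_of_mem_holes hk hσ hu hv
  rw [thresholdPow, if_pos hnear, pow_succ]
  calc |inducedBetti x r k I - (1 + inducedBetti x r k (I \ σ))|
      ≤ |inducedBetti x r k I - inducedBetti x r k (I \ σ)| + 1 := by
        rw [← sub_sub, sub_right_comm]
        exact (abs_sub _ _).trans_eq (by rw [abs_one])
    _ ≤ _ := by linarith

lemma sum_holes_abs_inducedBetti_sub_le (hk : 3 ≤ k) (hr : 0 ≤ r) (hR : 4 * r ≤ R)
    (I : Finset ι) :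
    ∑ σ ∈ holes x r k I, |inducedBetti x r k I - (1 + inducedBetti x r k (I \ σ))|
      ≤ ∑ v ∈ I, 2 ^ (k + 1) * thresholdPow (k + k) k (nearCount x R v I) := by
  refine (sum_holes_le_sum_sum (by lia) fun σ => abs_nonneg _).trans ?_
  refine Finset.sum_le_sum fun v _ => ?_
  have hcard : (((holes x r k I).filter fun σ => v ∈ σ).card : ℝ) ≤ (1 + nearCount x R v I) ^ k :=
    thresholdPow_zero k _ ▸ (card_holes_mem_le hk (by linarith) v I).trans
      (thresholdPow_le_of_le k (Nat.zero_le _) _)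
  have hnonneg := thresholdPow_nonneg k k (nearCount x R v I)
  calc ∑ σ ∈ (holes x r k I).filter fun σ => v ∈ σ,
        |inducedBetti x r k I - (1 + inducedBetti x r k (I \ σ))|
      ≤ ((holes x r k I).filter fun σ => v ∈ σ).card •
          (2 ^ (k + 1) * thresholdPow k k (nearCount x R v I)) :=
        Finset.sum_le_card_nsmul _ _ _ fun σ hσ => abs_inducedBetti_sub_hole_le hk hr hR
          (Finset.mem_filter.1 hσ).1 (Finset.mem_filter.1 hσ).2
    _ ≤ (1 + nearCount x R v I) ^ k * (2 ^ (k + 1) * thresholdPow k k (nearCount x R v I)) := by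
        rw [nsmul_eq_mul]
        exact mul_le_mul_of_nonneg_right hcard (by positivity)
    _ = 2 ^ (k + 1) * thresholdPow (k + k) k (nearCount x R v I) := by
        rw [← thresholdPow_mul]
        ring

end Increments

/-! ### Moments of near counts -/

section Measurability

instance {ι : Type*} : MeasurableSpace (PreAbstractSimplicialComplex ι) := ⊤

instance {ι : Type*} : DiscreteMeasurableSpace (PreAbstractSimplicialComplex ι) :=
  ⟨fun _ => trivial⟩

instance {ι : Type*} [Finite ι] : Finite (PreAbstractSimplicialComplex ι) :=
  Finite.of_injective (fun K : PreAbstractSimplicialComplex ι => K.faces)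
    fun _ _ h => PreAbstractSimplicialComplex.ext h

lemma integrable_comp_of_finite {Ω T : Type*} [MeasurableSpace Ω] [Finite T] [MeasurableSpace T]
    [DiscreteMeasurableSpace T] {P : Measure Ω} [IsFiniteMeasure P] {h : Ω → T}
    (hh : Measurable h) (F : T → ℝ) : Integrable (fun ω => F (h ω)) P :=
  Integrable.of_finite.comp_measurable hh

variable {ι E : Type*} [PseudoMetricSpace E] [ProperSpace E]

lemma isClosed_setOf_mem_cechComplex (r : ℝ) (σ : Finset ι) :
    IsClosed {x : ι → E | σ ∈ cechComplex x r} := by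
  rcases σ.eq_empty_or_nonempty with rfl | ⟨i₀, hi₀⟩
  · convert isClosed_empty
    exact Set.eq_empty_of_forall_notMem fun x hx => Finset.not_nonempty_empty hx.1
  rcases isEmpty_or_nonempty E with _ | _
  · have : IsEmpty (ι → E) := ⟨fun x => isEmptyElim (x i₀)⟩
    exact (Set.toFinite _).isClosed
  choose! p hp using fun (x : ι → E) (hx : σ ∈ cechComplex x r) => hx.2
  have hdist : ∀ x : ι → E, σ ∈ cechComplex x r → ∀ i ∈ σ, dist (p x) (x i) ≤ r :=
    fun x hx i hi => Metric.mem_closedBall.1 (Set.mem_iInter₂.1 (hp x hx) i hi)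
  refine isClosed_iff_ultrafilter.2 fun x U hUx hU => ?_
  have happly : ∀ i, Tendsto (fun y : ι → E => y i) U (𝓝 (x i)) := fun i =>
    ((continuous_apply i).tendsto x).mono_left hUx
  have hbounded : ∀ᶠ y in U, p y ∈ Metric.closedBall (x i₀) (r + 1) := by
    filter_upwards [hU, (happly i₀).eventually (Metric.ball_mem_nhds (x i₀) one_pos)] with y hy hyx
    exact (dist_triangle _ _ _).trans (add_le_add (hdist y hy i₀ hi₀) hyx.le)
  obtain ⟨q, -, hq⟩ := (isCompact_closedBall (x i₀) (r + 1)).ultrafilter_le_nhds' (U.map p) hbounded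
  refine ⟨⟨i₀, hi₀⟩, q, Set.mem_iInter₂.2 fun i hi => ?_⟩
  exact le_of_tendsto (Tendsto.dist hq (happly i)) (mem_of_superset hU fun y hy => hdist y hy i hi)

lemma measurable_cechComplex [Finite ι] [MeasurableSpace E] [BorelSpace E]
    (r : ℝ) : Measurable fun x : ι → E => cechComplex x r := by
  refine measurable_to_countable' fun K => ?_
  have hpre : (fun x : ι → E => cechComplex x r) ⁻¹' {K} =
      {x | ∀ σ, σ ∈ cechComplex x r ↔ σ ∈ K} := Set.ext fun x => SetLike.ext_iff
  rw [hpre, measurableSet_setOfPred]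
  exact Measurable.forall fun σ => (measurableSet_setOfPred.1
    (isClosed_setOf_mem_cechComplex r σ).measurableSet).iff measurable_const

end Measurability

section Moments

/-- The constant in the comparison of `thresholdPow a b` with binomial coefficients. -/
def thresholdConst (a b : ℕ) : ℝ := (1 + 2 * (a + b)) ^ a + 2 ^ (a + b) * (a + b).factorial

lemma thresholdConst_nonneg (a b : ℕ) : 0 ≤ thresholdConst a b := by
  unfold thresholdConst; positivity

lemma one_add_pow_le_choose {a N : ℕ} (h : 2 * a ≤ N) :
    (1 + N : ℝ) ^ a ≤ 2 ^ a * a.factorial * N.choose a :=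
  calc (1 + N : ℝ) ^ a ≤ (2 * ((N + 1 - a : ℕ) : ℝ)) ^ a := by
        gcongr
        exact_mod_cast (by lia : 1 + N ≤ 2 * (N + 1 - a))
    _ = 2 ^ a * a.factorial * (((N + 1 - a : ℕ) : ℝ) ^ a / a.factorial) := by
        rw [mul_pow]; field_simp
    _ ≤ 2 ^ a * a.factorial * N.choose a := by
        gcongr
        exact Nat.pow_le_choose a N

lemma thresholdPow_le_choose (a b N : ℕ) :
    thresholdPow a b N ≤ thresholdConst a b * (N.choose b + N.choose (a + b)) := by
  unfold thresholdPow
  split_ifs with hbN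
  swap
  · exact mul_nonneg (thresholdConst_nonneg a b) (by positivity)
  rcases le_total N (2 * (a + b)) with hN | hN
  · calc (1 + N : ℝ) ^ a ≤ (1 + 2 * (a + b)) ^ a * 1 := by
          rw [mul_one]; gcongr; exact_mod_cast hN
      _ ≤ thresholdConst a b * (N.choose b + N.choose (a + b)) := by
          have hchoose : (1 : ℝ) ≤ N.choose b := by exact_mod_cast Nat.choose_pos hbN
          unfold thresholdConst
          gcongr
          · exact le_add_of_nonneg_right (by positivity)
          · exact hchoose.trans (le_add_of_nonneg_right (by positivity))
  · calc (1 + N : ℝ) ^ a ≤ (1 + N) ^ (a + b) :=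
          pow_le_pow_right₀ (le_add_of_nonneg_right N.cast_nonneg) (Nat.le_add_right a b)
      _ ≤ 2 ^ (a + b) * (a + b).factorial * N.choose (a + b) := one_add_pow_le_choose hN
      _ ≤ thresholdConst a b * (N.choose b + N.choose (a + b)) := by
          unfold thresholdConst
          gcongr
          · exact le_add_of_nonneg_left (by positivity)
          · exact le_add_of_nonneg_left (by positivity)

variable {ι E : Type*} [PseudoMetricSpace E]

/-- The number of points of index in `J` at distance at most `R` from one of the points of index in
`C`. -/
def closeCount (x : ι → E) (R : ℝ) (C J : Finset ι) : ℕ :=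
  open Classical in (J.filter fun j => ∃ i ∈ C, dist (x j) (x i) ≤ R).card

/-- Every point of index in `S` is at distance at most `R` from one of the points of index in
`C`. -/
def closeSet (E : Type*) [PseudoMetricSpace E] (R : ℝ) (C S : Finset ι) : Set (ι → E) :=
  {x | ∀ j ∈ S, ∃ i ∈ C, dist (x j) (x i) ≤ R}

lemma choose_closeCount (x : ι → E) (R : ℝ) (C J : Finset ι) (s : ℕ) :
    ((closeCount x R C J).choose s : ℝ) =
      ∑ S ∈ J.powersetCard s, (closeSet E R C S).indicator 1 x := by
  classical
  simp_rw [Set.indicator_apply, Pi.one_apply]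
  rw [Finset.sum_boole, closeCount, ← Finset.card_powersetCard]
  congr 2
  ext S
  simp only [closeSet, Finset.mem_powersetCard, Finset.mem_filter, Finset.subset_iff,
    Set.mem_ofPred_eq]
  grind

variable [SecondCountableTopology E] [MeasurableSpace E] [BorelSpace E]

lemma measurable_dist_le (R : ℝ) :
    Measurable fun (x : ι → E) (q : ι × ι) => dist (x q.1) (x q.2) ≤ R :=
  measurable_pi_lambda _ fun _ => measurableSet_setOfPred.1
    (measurableSet_le (by fun_prop) measurable_const)

lemma measurableSet_closeSet [Finite ι] (R : ℝ) (C S : Finset ι) :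
    MeasurableSet (closeSet E R C S) :=
  measurable_dist_le R (MeasurableSet.of_discrete
    (s := {A : ι × ι → Prop | ∀ j ∈ S, ∃ i ∈ C, A (j, i)}))

lemma integrable_closeCount [Finite ι] {P : Measure (ι → E)} [IsFiniteMeasure P] (F : ℕ → ℝ) (R : ℝ)
    (C J : Finset ι) : Integrable (fun x => F (closeCount x R C J)) P :=
  open Classical in integrable_comp_of_finite (measurable_dist_le R)
    fun A => F (J.filter fun j => ∃ i ∈ C, A (j, i)).card

variable [Fintype ι] {μ : Measure E} [IsProbabilityMeasure μ] {R : ℝ} {p : ℝ≥0} {C J S : Finset ι}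

/-- Conditionally on the points of index outside `S`, the others are independent. -/
lemma measure_closeSet_le (hp : ∀ y, μ (Metric.closedBall y R) ≤ p) (hCS : Disjoint C S) :
    Measure.pi (fun _ : ι => μ) (closeSet E R C S) ≤ (C.card * p : ℝ≥0∞) ^ S.card := by
  classical
  have hC : ∀ i : C, (i : ι) ∉ S := fun i hi => Finset.disjoint_left.1 hCS i.2 hi
  let T : Set (({j // j ∈ S} → E) × ({j // j ∉ S} → E)) :=
    {z | ∀ j, ∃ i : C, dist (z.1 j) (z.2 ⟨i, hC i⟩) ≤ R}
  have hT : MeasurableSet T := by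
    simp only [T, Set.ofPred_forall, Set.ofPred_exists]
    exact MeasurableSet.iInter fun j => MeasurableSet.iUnion fun i =>
      measurableSet_le (by fun_prop) measurable_const
  have hpre : closeSet E R C S =
      MeasurableEquiv.piEquivPiSubtypeProd (fun _ : ι => E) (· ∈ S) ⁻¹' T := by
    ext x
    simp [closeSet, T, MeasurableEquiv.piEquivPiSubtypeProd, Equiv.piEquivPiSubtypeProd]
  have hslice : ∀ y, Measure.pi (fun _ : {j // j ∈ S} => μ) ((fun z => (z, y)) ⁻¹' T) ≤
      (C.card * p : ℝ≥0∞) ^ S.card := by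
    intro y
    have hpi : (fun z : {j // j ∈ S} → E => (z, y)) ⁻¹' T =
        Set.univ.pi fun _ => ⋃ i : C, Metric.closedBall (y ⟨i, hC i⟩) R := by
      ext z; simp [T]
    rw [hpi, Measure.pi_pi, Finset.prod_const, Finset.card_univ, Fintype.card_coe]
    gcongr
    refine (measure_iUnion_fintype_le _ _).trans ((Finset.sum_le_sum fun i _ => hp _).trans ?_)
    rw [Finset.sum_const, Finset.card_univ, Fintype.card_coe, nsmul_eq_mul]
  rw [hpre, (measurePreserving_piEquivPiSubtypeProd (fun _ : ι => μ) (· ∈ S)).measure_preimage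
    hT.nullMeasurableSet, Measure.prod_apply_symm hT]
  exact lintegral_le_const (ae_of_all _ fun y => by convert hslice y)

lemma integral_choose_closeCount_le (hp : ∀ y, μ (Metric.closedBall y R) ≤ p)
    (hCJ : Disjoint C J) (s : ℕ) :
    ∫ x, ((closeCount x R C J).choose s : ℝ) ∂(Measure.pi fun _ : ι => μ)
      ≤ (J.card * (C.card * p)) ^ s := by
  have hterm : ∀ S ∈ J.powersetCard s,
      ∫ x, (closeSet E R C S).indicator 1 x ∂(Measure.pi fun _ : ι => μ)
        ≤ (C.card * p : ℝ) ^ s := by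
    intro S hS
    obtain ⟨hSJ, rfl⟩ := Finset.mem_powersetCard.1 hS
    rw [integral_indicator_one (measurableSet_closeSet R C S), measureReal_def]
    refine ENNReal.toReal_le_of_le_ofReal (by positivity) ?_
    convert measure_closeSet_le hp (hCJ.mono_right hSJ)
    rw [ENNReal.ofReal_pow (by positivity), ENNReal.ofReal_mul (by positivity),
      ENNReal.ofReal_natCast, ENNReal.ofReal_coe_nnreal]
  have hint : ∀ S, Integrable ((closeSet E R C S).indicator (1 : (ι → E) → ℝ))
      (Measure.pi fun _ => μ) := fun S =>
    (integrable_const (1 : ℝ)).indicator (measurableSet_closeSet R C S)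
  simp_rw [choose_closeCount]
  rw [integral_finsetSum _ fun S _ => hint S]
  refine (Finset.sum_le_card_nsmul _ _ _ hterm).trans ?_
  rw [Finset.card_powersetCard, nsmul_eq_mul, mul_pow (J.card : ℝ)]
  gcongr
  exact_mod_cast Nat.choose_le_pow _ _

/-- The constant of the moment bound `integral_thresholdPow_le`. -/
def momentConst (a b : ℕ) : ℝ := thresholdConst a b * (4 ^ b + 4 ^ (a + b))

lemma momentConst_nonneg (a b : ℕ) : 0 ≤ momentConst a b :=
  mul_nonneg (thresholdConst_nonneg a b) (by positivity)

lemma integral_thresholdPow_le (hp : ∀ y, μ (Metric.closedBall y R) ≤ p) (hCJ : Disjoint C J)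
    {n : ℕ} (hcard : J.card * C.card ≤ 4 * n) (hn : n * p ≤ 1) (a b : ℕ) :
    ∫ x, thresholdPow a b (closeCount x R C J) ∂(Measure.pi fun _ : ι => μ)
      ≤ momentConst a b * (n * p) ^ b := by
  have hchoose : ∀ s, b ≤ s → ∫ x, ((closeCount x R C J).choose s : ℝ)
      ∂(Measure.pi fun _ : ι => μ) ≤ 4 ^ s * (n * p) ^ b := by
    intro s hbs
    have hmean : (J.card * (C.card * p) : ℝ) ≤ 4 * (n * p) := by
      rw [← mul_assoc, ← mul_assoc]
      exact mul_le_mul_of_nonneg_right (by exact_mod_cast hcard) p.coe_nonneg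
    calc _ ≤ (J.card * (C.card * p) : ℝ) ^ s := integral_choose_closeCount_le hp hCJ s
      _ ≤ (4 * (n * p)) ^ s := by gcongr
      _ = 4 ^ s * (n * p) ^ s := mul_pow _ _ _
      _ ≤ 4 ^ s * (n * p) ^ b :=
          mul_le_mul_of_nonneg_left (pow_le_pow_of_le_one (by positivity) hn hbs) (by positivity)
  have hint : ∀ s, Integrable (fun x : ι → E => ((closeCount x R C J).choose s : ℝ))
      (Measure.pi fun _ : ι => μ) := fun s =>
    integrable_closeCount (fun N => (N.choose s : ℝ)) R C J
  calc _ ≤ ∫ x, thresholdConst a b *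
      ((closeCount x R C J).choose b + (closeCount x R C J).choose (a + b))
        ∂(Measure.pi fun _ : ι => μ) :=
        integral_mono (integrable_closeCount _ R C J) (((hint b).add (hint (a + b))).const_mul _)
          fun x => thresholdPow_le_choose a b _
    _ ≤ thresholdConst a b * (4 ^ b * (n * p) ^ b + 4 ^ (a + b) * (n * p) ^ b) := by
        rw [integral_const_mul, integral_add (hint b) (hint (a + b))]
        exact mul_le_mul_of_nonneg_left
          (add_le_add (hchoose b le_rfl) (hchoose (a + b) (Nat.le_add_left b a)))
          (thresholdConst_nonneg a b)
    _ = momentConst a b * (n * p) ^ b := by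
        rw [momentConst, ← add_mul, mul_assoc]

end Moments

/-! ### Decoupling by independent copies -/

section Copies

variable {ι E : Type*} [DecidableEq ι]

/-- The family made of the second copies of the points of index in `S` and of the first copies of
the others. -/
def select (S : Finset ι) (Y : ι × Bool → E) (j : ι) : E := Y (j, decide (j ∈ S))

/-- Exchanges the two copies of the point of index `m`. -/
def swapCopies (m : ι) : Equiv.Perm (ι × Bool) := Equiv.swap (m, false) (m, true)

lemma select_comp_swapCopies {m : ι} {S : Finset ι} (hm : m ∉ S) (Y : ι × Bool → E) :
    select S (Y ∘ swapCopies m) = select (insert m S) Y := by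
  ext j
  rcases eq_or_ne j m with rfl | hj
  · simp [select, swapCopies, hm]
  · simp [select, swapCopies, Equiv.swap_apply_of_ne_of_ne, hj]

lemma select_insert_comp_swapCopies {m : ι} {S : Finset ι} (hm : m ∉ S) (Y : ι × Bool → E) :
    select (insert m S) (Y ∘ swapCopies m) = select S Y := by
  rw [← select_comp_swapCopies hm, Function.comp_assoc]
  simp [swapCopies, Function.comp_def]

end Copies

section Product

variable {ι κ E : Type*} [Fintype ι] [Fintype κ] [MeasurableSpace E] (μ : Measure E)
  [IsProbabilityMeasure μ]

lemma iIndepFun_eval : iIndepFun (fun (i : ι) (Y : ι → E) => Y i) (Measure.pi fun _ : ι => μ) :=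
  iIndepFun_pi (X := fun _ x => x) fun _ => aemeasurable_id

lemma measurePreserving_comp_injective {e : κ → ι} (he : e.Injective) :
    MeasurePreserving (fun (Y : ι → E) j => Y (e j)) (Measure.pi fun _ : ι => μ)
      (Measure.pi fun _ : κ => μ) := by
  refine ⟨by fun_prop, ?_⟩
  rw [((iIndepFun_iff_map_fun_eq_pi_map fun j => (measurable_pi_apply (e j)).aemeasurable).1
    ((iIndepFun_eval μ).precomp he))]
  congr 1
  exact funext fun j => (measurePreserving_eval (fun _ : ι => μ) (e j)).map_eq

lemma integral_mul_of_dependsOn {S T : Finset ι} (hST : Disjoint S T) {F G : (ι → E) → ℝ}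
    (hF : Measurable F) (hG : Measurable G) (hFS : DependsOn F S) (hGT : DependsOn G T) :
    ∫ x, F x * G x ∂(Measure.pi fun _ : ι => μ) =
      (∫ x, F x ∂(Measure.pi fun _ : ι => μ)) * ∫ x, G x ∂(Measure.pi fun _ : ι => μ) := by
  classical
  obtain ⟨e₀⟩ : Nonempty E := nonempty_of_isProbabilityMeasure μ
  let extend (S : Finset ι) : (S → E) → ι → E := Function.updateFinset (fun _ => e₀) S
  have hextend : ∀ S, Measurable (extend S) := fun S => measurable_updateFinset
  have hfactor : ∀ {F : (ι → E) → ℝ} {S : Finset ι}, DependsOn F S →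
      (F ∘ extend S) ∘ (fun (x : ι → E) (i : S) => x i) = F :=
    fun hFS => funext fun x => hFS fun i hi => dif_pos hi
  have hindep := ((iIndepFun_eval μ).indepFun_finset S T hST fun i => measurable_pi_apply i).comp
    (hF.comp (hextend S)) (hG.comp (hextend T))
  rw [hfactor hFS, hfactor hGT] at hindep
  exact hindep.integral_fun_mul_eq_mul_integral hF.aestronglyMeasurable hG.aestronglyMeasurable

variable [DecidableEq ι] {μ}

lemma measurePreserving_select (S : Finset ι) :
    MeasurePreserving (select S) (Measure.pi fun _ : ι × Bool => μ) (Measure.pi fun _ : ι => μ) :=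
  measurePreserving_comp_injective μ (e := fun j => (j, decide (j ∈ S)))
    fun _ _ h => congrArg Prod.fst h

variable {F G : (ι → E) → ℝ}

lemma integrable_comp_select_mul (hF : MemLp F 2 (Measure.pi fun _ => μ))
    (hG : MemLp G 2 (Measure.pi fun _ => μ)) (S T : Finset ι) :
    Integrable (fun Y => F (select S Y) * G (select T Y)) (Measure.pi fun _ => μ) :=
  (hF.comp_measurePreserving (measurePreserving_select S)).integrable_mul
    (hG.comp_measurePreserving (measurePreserving_select T))

/-- Exchanging the two copies of the point of index `m` changes the sign of the first factor, so
that the second one may be replaced by half of its increment. -/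
lemma two_mul_integral_sub_mul (hF : MemLp F 2 (Measure.pi fun _ => μ))
    (hG : MemLp G 2 (Measure.pi fun _ => μ)) {S T : Finset ι} {m : ι} (hS : m ∉ S) (hT : m ∉ T) :
    2 * ∫ Y, (F (select S Y) - F (select (insert m S) Y)) * G (select T Y)
        ∂(Measure.pi fun _ => μ) =
      ∫ Y, (F (select S Y) - F (select (insert m S) Y)) *
        (G (select T Y) - G (select (insert m T) Y)) ∂(Measure.pi fun _ => μ) := by
  have hint : ∀ T', Integrable
      (fun Y => (F (select S Y) - F (select (insert m S) Y)) * G (select T' Y))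
      (Measure.pi fun _ => μ) := fun T' => by
    simp only [sub_mul]
    exact (integrable_comp_select_mul hF hG S T').sub
      (integrable_comp_select_mul hF hG (insert m S) T')
  have hswap : ∫ Y, (F (select S Y) - F (select (insert m S) Y)) * G (select T Y)
      ∂(Measure.pi fun _ => μ) = -∫ Y, (F (select S Y) - F (select (insert m S) Y)) *
        G (select (insert m T) Y) ∂(Measure.pi fun _ => μ) := by
    have hpres : MeasurePreserving (fun Y : ι × Bool → E => Y ∘ swapCopies m)
        (Measure.pi fun _ => μ) (Measure.pi fun _ => μ) :=
      measurePreserving_comp_injective μ (swapCopies m).injective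
    rw [← integral_neg]
    nth_rw 1 [← hpres.map_eq]
    rw [integral_map hpres.aemeasurable (by rw [hpres.map_eq]; exact (hint T).aestronglyMeasurable)]
    simp only [select_comp_swapCopies, select_insert_comp_swapCopies, hS, hT, not_false_eq_true]
    exact integral_congr_ae (ae_of_all _ fun Y => by ring)
  simp_rw [mul_sub]
  rw [integral_sub (hint _) (hint _), two_mul]
  nth_rw 2 [hswap]
  rw [sub_eq_add_neg]

lemma integral_mul_eq_integral_select (hF : AEStronglyMeasurable F (Measure.pi fun _ => μ))
    (hG : AEStronglyMeasurable G (Measure.pi fun _ => μ)) (S : Finset ι) :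
    ∫ x, F x * G x ∂(Measure.pi fun _ => μ) =
      ∫ Y, F (select S Y) * G (select S Y) ∂(Measure.pi fun _ => μ) := by
  have hpres := measurePreserving_select (μ := μ) S
  rw [← hpres.map_eq] at hF hG ⊢
  exact integral_map hpres.aemeasurable (hF.mul hG)

lemma integral_select_univ_mul_select_empty (hF : Measurable F) (hG : Measurable G) :
    ∫ Y, F (select Finset.univ Y) * G (select ∅ Y) ∂(Measure.pi fun _ => μ) =
      (∫ x, F x ∂(Measure.pi fun _ => μ)) * ∫ x, G x ∂(Measure.pi fun _ => μ) := by
  have hpres : ∀ S : Finset ι, MeasurePreserving (select S) (Measure.pi fun _ => μ)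
      (Measure.pi fun _ => μ) := measurePreserving_select
  have hselect : ∀ {F : (ι → E) → ℝ} (S : Finset ι), Measurable F →
      ∫ Y, F (select S Y) ∂(Measure.pi fun _ => μ) = ∫ x, F x ∂(Measure.pi fun _ => μ) :=
    fun S hF => by
      conv_rhs => rw [← (hpres S).map_eq]
      exact (integral_map (hpres S).aemeasurable hF.aestronglyMeasurable).symm
  rw [← hselect Finset.univ hF, ← hselect ∅ hG]
  refine integral_mul_of_dependsOn μ (S := Finset.univ.filter fun q => q.2 = true)
    (T := Finset.univ.filter fun q => q.2 = false)
    (Finset.disjoint_filter.2 fun q _ h => by simp [h])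
    (hF.comp (hpres _).measurable) (hG.comp (hpres _).measurable)
    (fun Y Y' h => congrArg F (funext fun j => h _ (by simp)))
    fun Y Y' h => congrArg G (funext fun j => h _ (by simp))

lemma abs_covariance_le (hF : MemLp F 2 (Measure.pi fun _ => μ))
    (hG : MemLp G 2 (Measure.pi fun _ => μ)) (hFm : Measurable F) (hGm : Measurable G)
    {B : ι → (ι × Bool → E) → ℝ} (hBint : ∀ m, Integrable (B m) (Measure.pi fun _ => μ))
    (hB : ∀ m S T, m ∉ S → m ∉ T → ∀ Y, |F (select S Y) - F (select (insert m S) Y)| *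
      |G (select T Y) - G (select (insert m T) Y)| ≤ B m Y) :
    |cov[F, G; Measure.pi fun _ => μ]| ≤ ∑ m, ∫ Y, B m Y ∂(Measure.pi fun _ => μ) := by
  have hint := integrable_comp_select_mul hF hG
  let mixed : Finset ι → ℝ := fun S =>
    ∫ Y, F (select S Y) * G (select ∅ Y) ∂(Measure.pi fun _ => μ)
  have hstep : ∀ m S, m ∉ S →
      |mixed S - mixed (insert m S)| ≤ ∫ Y, B m Y ∂(Measure.pi fun _ => μ) := by
    intro m S hm
    have hincr : |2 * (mixed S - mixed (insert m S))| ≤ ∫ Y, B m Y ∂(Measure.pi fun _ => μ) := by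
      rw [← integral_sub (hint _ _) (hint _ _)]
      simp_rw [← sub_mul]
      rw [two_mul_integral_sub_mul hF hG hm (Finset.notMem_empty m)]
      refine abs_integral_le_integral_abs.trans (integral_mono_of_nonneg
        (ae_of_all _ fun Y => abs_nonneg _) (hBint m) (ae_of_all _ fun Y => ?_))
      exact (abs_mul _ _).trans_le (hB m S ∅ hm (Finset.notMem_empty m) Y)
    rw [abs_mul, abs_two] at hincr
    linarith [abs_nonneg (mixed S - mixed (insert m S))]
  have htelescope : ∀ S, |mixed ∅ - mixed S| ≤ ∑ m ∈ S, ∫ Y, B m Y ∂(Measure.pi fun _ => μ) := by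
    intro S
    induction S using Finset.induction_on with
    | empty => simp
    | insert m S hm ih =>
      rw [Finset.sum_insert hm, add_comm]
      exact (abs_sub_le _ _ _).trans (add_le_add ih (hstep m S hm))
  rw [covariance_eq_sub hF hG, ← integral_select_univ_mul_select_empty hFm hGm]
  simp_rw [Pi.mul_apply]
  rw [integral_mul_eq_integral_select hF.1 hG.1 ∅]
  exact htelescope Finset.univ

end Product

section RandomComplex

variable {E : Type*} [PseudoMetricSpace E] {n k : ℕ} {r R : ℝ}

lemma nearCount_eq_closeCount {ι : Type*} [LinearOrder ι] (x : ι → E) (R : ℝ) (v : ι)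
    (I : Finset ι) : nearCount x R v I = closeCount x R {v} (I.erase v) := by
  simp [nearCount, near, closeCount]

lemma inducedBetti_univ (x : Fin n → E) (r : ℝ) (k : ℕ) :
    inducedBetti x r k Finset.univ = (cechComplex x r).betti (k - 2) := by
  rw [inducedBetti, induce_univ]

lemma betti_eq_card_holes_add_bettiExcess (x : Fin n → E) (r : ℝ) (k : ℕ) :
    ((cechComplex x r).betti (k - 2) : ℝ) =
      (holes x r k Finset.univ).card + bettiExcess x r k Finset.univ := by
  rw [bettiExcess, inducedBetti_univ, add_sub_cancel]

/-- The number of points, among both copies of the points of index other than `m`, at distance at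
most `R` from one of the copies of the point of index `m`. -/
def copyCount (Y : Fin n × Bool → E) (R : ℝ) (m : Fin n) : ℕ :=
  closeCount Y R {(m, false), (m, true)} (Finset.univ.filter fun q => q.1 ≠ m)

lemma nearCount_select_le (S : Finset (Fin n)) (Y : Fin n × Bool → E) (R : ℝ) (m : Fin n) :
    nearCount (select S Y) R m Finset.univ ≤ copyCount Y R m := by
  refine Finset.card_le_card_of_injOn (fun j => (j, decide (j ∈ S))) (fun j hj => ?_)
    fun _ _ _ _ h => congrArg Prod.fst h
  obtain ⟨hjm, -, hdist⟩ := mem_near.1 hj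
  simp only [Finset.coe_filter, Finset.mem_filter, Finset.mem_univ, true_and, Set.mem_ofPred_eq]
  refine ⟨hjm, (m, decide (m ∈ S)), ?_, hdist⟩
  cases decide (m ∈ S) <;> simp

/-- Replacing the point of index `m` amounts to deleting it and inserting another one. -/
lemma abs_sub_select_insert_le {Φ : (Fin n → E) → Finset (Fin n) → ℝ}
    (hΦ : ∀ x x' I, (∀ i ∈ I, x i = x' i) → Φ x I = Φ x' I) {τ : ℕ → ℝ} (hτ : Monotone τ)
    (hb : ∀ x v, |Φ x Finset.univ - Φ x (Finset.univ.erase v)| ≤ τ (nearCount x R v Finset.univ))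
    (m : Fin n) (S : Finset (Fin n)) (Y : Fin n × Bool → E) :
    |Φ (select S Y) Finset.univ - Φ (select (insert m S) Y) Finset.univ| ≤
      2 * τ (copyCount Y R m) := by
  have hdelete : ∀ T, |Φ (select T Y) Finset.univ - Φ (select T Y) (Finset.univ.erase m)| ≤
      τ (copyCount Y R m) := fun T => (hb _ m).trans (hτ (nearCount_select_le T Y R m))
  have hcommon : Φ (select S Y) (Finset.univ.erase m) =
      Φ (select (insert m S) Y) (Finset.univ.erase m) :=
    hΦ _ _ _ fun j hj => by simp [select, Finset.ne_of_mem_erase hj]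
  calc _ ≤ |Φ (select S Y) Finset.univ - Φ (select S Y) (Finset.univ.erase m)| +
        |Φ (select S Y) (Finset.univ.erase m) - Φ (select (insert m S) Y) Finset.univ| :=
        abs_sub_le _ _ _
    _ ≤ τ (copyCount Y R m) + τ (copyCount Y R m) := by
        refine add_le_add (hdelete S) ?_
        rw [hcommon, abs_sub_comm]
        exact hdelete (insert m S)
    _ = 2 * τ (copyCount Y R m) := (two_mul _).symm

lemma abs_sub_le_of_lipschitzWith {g : ℕ → ℝ} {L : ℝ≥0} (hg : LipschitzWith L g) (a b : ℕ) :
    |g a - g b| ≤ L * |(a : ℝ) - b| := by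
  simpa only [Real.dist_eq, Nat.dist_eq] using hg.dist_le_mul a b

lemma abs_integral_sub_integral_le {Ω : Type*} [MeasurableSpace Ω] {P : Measure Ω} {f g h : Ω → ℝ}
    (hf : Integrable f P) (hg : Integrable g P) (hh : Integrable h P)
    (hfg : ∀ ω, |f ω - g ω| ≤ h ω) : |∫ ω, f ω ∂P - ∫ ω, g ω ∂P| ≤ ∫ ω, h ω ∂P := by
  rw [← integral_sub hf hg]
  exact abs_integral_le_integral_abs.trans (integral_mono (hf.sub hg).abs hh hfg)

lemma exists_card_holes_eq_comp (r : ℝ) (k : ℕ) (I : Finset (Fin n)) :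
    ∃ F : PreAbstractSimplicialComplex (Fin n) → ℝ,
      ∀ x : Fin n → E, ((holes x r k I).card : ℝ) = F (cechComplex x r) :=
  open Classical in ⟨fun K => ((I.powersetCard k).filter fun σ => IsHole K σ).card, fun _ => rfl⟩

lemma exists_bettiExcess_eq_comp (r : ℝ) (k : ℕ) (I : Finset (Fin n)) :
    ∃ F : PreAbstractSimplicialComplex (Fin n) → ℝ,
      ∀ x : Fin n → E, bettiExcess x r k I = F (cechComplex x r) := by
  obtain ⟨F, hF⟩ := exists_card_holes_eq_comp (E := E) r k I
  exact ⟨fun K => (induce K I).betti (k - 2) - F K, fun x => by rw [bettiExcess, hF, inducedBetti]⟩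

variable [MeasurableSpace E] [BorelSpace E] {μ : Measure E} [IsProbabilityMeasure μ] {p : ℝ≥0}

section SecondCountable

variable [SecondCountableTopology E]

lemma integrable_nearCount (F : ℕ → ℝ) (R : ℝ) (v : Fin n) (I : Finset (Fin n)) :
    Integrable (fun x : Fin n → E => F (nearCount x R v I)) (Measure.pi fun _ => μ) := by
  simp_rw [nearCount_eq_closeCount]
  exact integrable_closeCount F R _ _

lemma integral_sum_nearCount_le (hp : ∀ y, μ (Metric.closedBall y R) ≤ p) (hn : n * p ≤ 1)
    (a b : ℕ) (σ : Finset (Fin n)) :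
    ∫ x : Fin n → E, ∑ v ∈ σ, thresholdPow a b (nearCount x R v Finset.univ)
      ∂(Measure.pi fun _ => μ) ≤ σ.card * (momentConst a b * (n * p) ^ b) := by
  rw [integral_finsetSum _ fun v _ => integrable_nearCount _ R v _, ← nsmul_eq_mul]
  refine Finset.sum_le_card_nsmul _ _ _ fun v _ => ?_
  simp_rw [nearCount_eq_closeCount]
  refine integral_thresholdPow_le hp (by simp) ?_ hn a b
  rw [Finset.card_singleton, mul_one, Finset.card_erase_of_mem (Finset.mem_univ v),
    Finset.card_univ, Fintype.card_fin]
  lia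

lemma integral_copyCount_le (hp : ∀ y, μ (Metric.closedBall y R) ≤ p) (hn : n * p ≤ 1)
    (a b : ℕ) (m : Fin n) :
    ∫ Y, thresholdPow a b (copyCount Y R m) ∂(Measure.pi fun _ => μ)
      ≤ momentConst a b * (n * p) ^ b := by
  refine integral_thresholdPow_le hp (by simp [Finset.disjoint_left]) ?_ hn a b
  calc _ ≤ (Finset.univ : Finset (Fin n × Bool)).card * 2 :=
        Nat.mul_le_mul (Finset.card_le_univ _) Finset.card_le_two
    _ = 4 * n := by simp; lia

end SecondCountable

variable [ProperSpace E]

lemma measurable_comp_cechComplex {α : Type*} [MeasurableSpace α] (r : ℝ)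
    (F : PreAbstractSimplicialComplex (Fin n) → α) :
    Measurable (fun x : Fin n → E => F (cechComplex x r)) :=
  Measurable.of_discrete.comp (measurable_cechComplex r)

lemma integrable_comp_cechComplex (F : PreAbstractSimplicialComplex (Fin n) → ℝ) :
    Integrable (fun x : Fin n → E => F (cechComplex x r)) (Measure.pi fun _ => μ) :=
  integrable_comp_of_finite (measurable_cechComplex r) F

lemma memLp_comp_cechComplex (F : PreAbstractSimplicialComplex (Fin n) → ℝ) (q : ℝ≥0∞) :
    MemLp (fun x : Fin n → E => F (cechComplex x r)) q (Measure.pi fun _ => μ) :=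
  MemLp.comp_of_map MemLp.of_discrete (measurable_cechComplex r).aemeasurable

lemma integrable_card_holes (I : Finset (Fin n)) :
    Integrable (fun x : Fin n → E => ((holes x r k I).card : ℝ)) (Measure.pi fun _ => μ) := by
  obtain ⟨F, hF⟩ := exists_card_holes_eq_comp (E := E) r k I
  simpa only [hF] using integrable_comp_cechComplex F

lemma integrable_bettiExcess (I : Finset (Fin n)) :
    Integrable (fun x : Fin n → E => bettiExcess x r k I) (Measure.pi fun _ => μ) := by
  obtain ⟨F, hF⟩ := exists_bettiExcess_eq_comp (E := E) r k I
  simpa only [hF] using integrable_comp_cechComplex F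

lemma integral_card_holes_le (hk : 3 ≤ k) (hr : 0 ≤ r)
    (hp : ∀ y, μ (Metric.closedBall y (2 * r * k)) ≤ p) (hn : n * p ≤ 1) :
    ∫ x : Fin n → E, ((holes x r k Finset.univ).card : ℝ) ∂(Measure.pi fun _ => μ)
      ≤ n * (momentConst k (k - 1) * (n * p) ^ (k - 1)) :=
  calc _ ≤ ∫ x : Fin n → E, ∑ v, thresholdPow k (k - 1) (nearCount x (2 * r * k) v Finset.univ)
        ∂(Measure.pi fun _ => μ) :=
        integral_mono (integrable_card_holes _)
          (integrable_finsetSum _ fun v _ => integrable_nearCount _ _ v _)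
          fun x => card_holes_le hk (two_mul_le_two_mul_mul (by lia) hr) Finset.univ
    _ ≤ _ := by simpa using integral_sum_nearCount_le hp hn k (k - 1) Finset.univ

lemma integral_abs_bettiExcess_le (hk : 3 ≤ k) (hr : 0 ≤ r)
    (hp : ∀ y, μ (Metric.closedBall y (2 * r * k)) ≤ p) (hn : n * p ≤ 1) :
    ∫ x : Fin n → E, |bettiExcess x r k Finset.univ| ∂(Measure.pi fun _ => μ)
      ≤ n * (2 * momentConst k k * (n * p) ^ k) :=
  calc _ ≤ ∫ x : Fin n → E, 2 * ∑ v, thresholdPow k k (nearCount x (2 * r * k) v Finset.univ)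
        ∂(Measure.pi fun _ => μ) := by
        refine integral_mono (integrable_bettiExcess _).abs ((integrable_finsetSum _
          fun v _ => integrable_nearCount _ _ v _).const_mul 2) fun x => ?_
        simpa only [Finset.mul_sum] using abs_bettiExcess_le hk hr Finset.univ
    _ ≤ 2 * (n * (momentConst k k * (n * p) ^ k)) := by
        rw [integral_const_mul]
        gcongr
        simpa using integral_sum_nearCount_le hp hn k k Finset.univ
    _ = _ := by ring

end RandomComplex

/-! ### The approximate Stein identity -/

section SteinIdentity

variable {E : Type*} [PseudoMetricSpace E] {n k : ℕ} {r : ℝ} {g : ℕ → ℝ} {L : ℝ≥0}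

/-- The indicator that `σ` is a hole of `K`. -/
def holeIndicator {ι : Type*} [LinearOrder ι] (K : PreAbstractSimplicialComplex ι)
    (σ : Finset ι) : ℝ :=
  open Classical in if IsHole K σ then 1 else 0

lemma holeIndicator_nonneg {ι : Type*} [LinearOrder ι] (K : PreAbstractSimplicialComplex ι)
    (σ : Finset ι) : 0 ≤ holeIndicator K σ := by
  unfold holeIndicator; split_ifs <;> simp

lemma sum_holeIndicator_mul (x : Fin n → E) (r : ℝ) (k : ℕ) (F : Finset (Fin n) → ℝ) :
    ∑ σ ∈ Finset.univ.powersetCard k, holeIndicator (cechComplex x r) σ * F σ =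
      ∑ σ ∈ holes x r k Finset.univ, F σ := by
  simp only [holeIndicator, ite_mul, one_mul, zero_mul, holes, Finset.sum_filter]

lemma card_holes_eq_sum (x : Fin n → E) (r : ℝ) (k : ℕ) :
    ((holes x r k Finset.univ).card : ℝ) =
      ∑ σ ∈ Finset.univ.powersetCard k, holeIndicator (cechComplex x r) σ := by
  simpa using (sum_holeIndicator_mul x r k fun _ => 1).symm

lemma abs_bettiExcess_sub_mul_abs_sub_le (hk : 3 ≤ k) (hr : 0 ≤ r) (hg : LipschitzWith L g)
    (m : Fin n) (S T : Finset (Fin n)) (Y : Fin n × Bool → E) :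
    |bettiExcess (select S Y) r k Finset.univ -
        bettiExcess (select (insert m S) Y) r k Finset.univ| *
      |g ((cechComplex (select T Y) r).betti (k - 2)) -
        g ((cechComplex (select (insert m T) Y) r).betti (k - 2))| ≤
      8 * L * thresholdPow (k + k) k (copyCount Y (2 * r * k) m) := by
  have hexcess : |bettiExcess (select S Y) r k Finset.univ -
      bettiExcess (select (insert m S) Y) r k Finset.univ| ≤
      2 * (2 * thresholdPow k k (copyCount Y (2 * r * k) m)) :=
    abs_sub_select_insert_le (Φ := fun x I => bettiExcess x r k I) (fun _ _ _ => bettiExcess_congr)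
      (fun _ _ h => mul_le_mul_of_nonneg_left (thresholdPow_mono k k h) zero_le_two)
      (fun _ v => abs_bettiExcess_sub_erase_le hk hr Finset.univ v) m S Y
  have hbetti : |inducedBetti (select T Y) r k Finset.univ -
      inducedBetti (select (insert m T) Y) r k Finset.univ| ≤
      2 * thresholdPow k 1 (copyCount Y (2 * r * k) m) :=
    abs_sub_select_insert_le (Φ := fun x I => (inducedBetti x r k I : ℝ))
      (fun _ _ _ h => by rw [inducedBetti_congr h])
      (fun _ _ => thresholdPow_mono k 1)
      (fun _ v => abs_inducedBetti_sub_erase_le hk (two_mul_le_two_mul_mul (by lia) hr) v _) m T Y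
  have hG : |g ((cechComplex (select T Y) r).betti (k - 2)) -
      g ((cechComplex (select (insert m T) Y) r).betti (k - 2))| ≤
      L * (2 * thresholdPow k 0 (copyCount Y (2 * r * k) m)) := by
    refine (abs_sub_le_of_lipschitzWith hg _ _).trans ?_
    gcongr
    simpa only [inducedBetti_univ] using hbetti.trans
      (mul_le_mul_of_nonneg_left (thresholdPow_le_of_le k zero_le_one _) zero_le_two)
  have hnonneg := thresholdPow_nonneg k k (copyCount Y (2 * r * k) m)
  refine (mul_le_mul hexcess hG (abs_nonneg _) (by positivity)).trans_eq ?_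
  rw [← thresholdPow_mul, ← thresholdPow_zero]
  ring

variable [ProperSpace E] [MeasurableSpace E] [BorelSpace E]
  {μ : Measure E} [IsProbabilityMeasure μ] {p : ℝ≥0}

lemma integral_holeIndicator_mul (σ : Finset (Fin n))
    (F : PreAbstractSimplicialComplex (Fin n) → ℝ) :
    ∫ x : Fin n → E, holeIndicator (cechComplex x r) σ * F (induce (cechComplex x r) σᶜ)
        ∂(Measure.pi fun _ => μ) =
      (∫ x : Fin n → E, holeIndicator (cechComplex x r) σ ∂(Measure.pi fun _ => μ)) *
        ∫ x : Fin n → E, F (induce (cechComplex x r) σᶜ) ∂(Measure.pi fun _ => μ) :=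
  integral_mul_of_dependsOn μ (S := σ) (T := σᶜ) disjoint_compl_right
    (measurable_comp_cechComplex r fun K => holeIndicator K σ)
    (measurable_comp_cechComplex r fun K => F (induce K σᶜ))
    (fun x x' h => by classical exact if_congr (isHole_congr fun i hi => h i hi) rfl rfl)
    fun x x' h => by simp only [induce_congr h]

/-- Given that `σ` is a hole, the Betti number is compared with one plus that of the rest, which is
independent of `σ` and is in turn compared with the Betti number. -/
lemma abs_integral_holeIndicator_mul_sub_le (hg : LipschitzWith L g) (σ : Finset (Fin n)) :
    |∫ x : Fin n → E, holeIndicator (cechComplex x r) σ * g ((cechComplex x r).betti (k - 2))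
        ∂(Measure.pi fun _ => μ) -
      (∫ x : Fin n → E, holeIndicator (cechComplex x r) σ ∂(Measure.pi fun _ => μ)) *
        ∫ x : Fin n → E, g ((cechComplex x r).betti (k - 2) + 1) ∂(Measure.pi fun _ => μ)| ≤
      L * ∫ x : Fin n → E, holeIndicator (cechComplex x r) σ *
        |inducedBetti x r k Finset.univ - (1 + inducedBetti x r k σᶜ)| ∂(Measure.pi fun _ => μ) +
      (∫ x : Fin n → E, holeIndicator (cechComplex x r) σ ∂(Measure.pi fun _ => μ)) *
        (L * ∫ x : Fin n → E, |inducedBetti x r k Finset.univ - inducedBetti x r k σᶜ|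
          ∂(Measure.pi fun _ => μ)) := by
  set ν : Measure (Fin n → E) := Measure.pi fun _ => μ
  let N : PreAbstractSimplicialComplex (Fin n) → ℕ := fun K => K.betti (k - 2)
  let ξ : PreAbstractSimplicialComplex (Fin n) → ℝ := fun K => holeIndicator K σ
  have hN : ∀ x : Fin n → E, inducedBetti x r k Finset.univ = N (cechComplex x r) :=
    fun x => inducedBetti_univ x r k
  have hNσ : ∀ x : Fin n → E, inducedBetti x r k σᶜ = N (induce (cechComplex x r) σᶜ) :=
    fun _ => rfl
  simp_rw [hN, hNσ]
  have hint : ∀ F : PreAbstractSimplicialComplex (Fin n) → ℝ,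
      Integrable (fun x => F (cechComplex x r)) ν := integrable_comp_cechComplex
  have hremove : |∫ x, ξ (cechComplex x r) * g (N (cechComplex x r)) ∂ν -
      ∫ x, ξ (cechComplex x r) * g (N (induce (cechComplex x r) σᶜ) + 1) ∂ν| ≤
      L * ∫ x, ξ (cechComplex x r) *
        |(N (cechComplex x r) : ℝ) - (1 + N (induce (cechComplex x r) σᶜ))| ∂ν := by
    rw [← integral_const_mul]
    refine abs_integral_sub_integral_le (hint fun K => ξ K * g (N K))
      (hint fun K => ξ K * g (N (induce K σᶜ) + 1))
      ((hint fun K => ξ K * |(N K : ℝ) - (1 + N (induce K σᶜ))|).const_mul L) fun x => ?_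
    rw [← mul_sub, abs_mul, abs_of_nonneg (holeIndicator_nonneg _ σ), mul_left_comm]
    refine mul_le_mul_of_nonneg_left ?_ (holeIndicator_nonneg _ σ)
    exact (abs_sub_le_of_lipschitzWith hg _ _).trans_eq (by rw [Nat.cast_add_one, add_comm 1])
  have hrestore : |∫ x, g (N (induce (cechComplex x r) σᶜ) + 1) ∂ν -
      ∫ x, g (N (cechComplex x r) + 1) ∂ν| ≤
      L * ∫ x, |(N (cechComplex x r) : ℝ) - N (induce (cechComplex x r) σᶜ)| ∂ν := by
    rw [abs_sub_comm, ← integral_const_mul]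
    refine abs_integral_sub_integral_le (hint fun K => g (N K + 1))
      (hint fun K => g (N (induce K σᶜ) + 1))
      ((hint fun K => |(N K : ℝ) - N (induce K σᶜ)|).const_mul L) fun x => ?_
    refine (abs_sub_le_of_lipschitzWith hg _ _).trans_eq ?_
    rw [Nat.cast_add_one, Nat.cast_add_one, add_sub_add_right_eq_sub]
  have hindep := integral_holeIndicator_mul (μ := μ) (r := r) σ fun K => g (N K + 1)
  have hξ : 0 ≤ ∫ x, ξ (cechComplex x r) ∂ν := integral_nonneg fun x => holeIndicator_nonneg _ σ
  refine (abs_sub_le _ _ _).trans (add_le_add hremove ?_)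
  rw [hindep, ← mul_sub, abs_mul, abs_of_nonneg hξ]
  exact mul_le_mul_of_nonneg_left hrestore hξ

/-- The constant of the Stein bound for the contribution of the holes. -/
def holesConst (k : ℕ) : ℝ :=
  2 ^ (k + 1) * momentConst (k + k) k + momentConst k (k - 1) * k * momentConst k 1

lemma sum_integral_holeIndicator_mul_le (hk : 3 ≤ k) (hr : 0 ≤ r)
    (hp : ∀ y, μ (Metric.closedBall y (2 * r * k)) ≤ p) (hn : n * p ≤ 1) :
    ∑ σ ∈ Finset.univ.powersetCard k, ∫ x : Fin n → E, holeIndicator (cechComplex x r) σ *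
        |inducedBetti x r k Finset.univ - (1 + inducedBetti x r k σᶜ)| ∂(Measure.pi fun _ => μ) ≤
      2 ^ (k + 1) * (n * (momentConst (k + k) k * (n * p) ^ k)) := by
  have hR : 4 * r ≤ 2 * r * k := by
    have hk' : (3 : ℝ) ≤ k := by exact_mod_cast hk
    nlinarith
  have hint : ∀ σ, Integrable (fun x : Fin n → E => holeIndicator (cechComplex x r) σ *
      |inducedBetti x r k Finset.univ - (1 + inducedBetti x r k σᶜ)|) (Measure.pi fun _ => μ) :=
    fun σ => integrable_comp_cechComplex fun K => holeIndicator K σ *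
      |((induce K Finset.univ).betti (k - 2) : ℝ) - (1 + (induce K σᶜ).betti (k - 2))|
  rw [← integral_finsetSum _ fun σ _ => hint σ]
  calc _ ≤ ∫ x : Fin n → E, 2 ^ (k + 1) *
          ∑ v, thresholdPow (k + k) k (nearCount x (2 * r * k) v Finset.univ)
        ∂(Measure.pi fun _ => μ) := by
        refine integral_mono (integrable_finsetSum _ fun σ _ => hint σ) ((integrable_finsetSum _
          fun v _ => integrable_nearCount _ _ v _).const_mul _) fun x => ?_
        simp only [sum_holeIndicator_mul, Finset.mul_sum, Finset.compl_eq_univ_sdiff]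
        exact sum_holes_abs_inducedBetti_sub_le hk hr hR Finset.univ
    _ ≤ 2 ^ (k + 1) * (n * (momentConst (k + k) k * (n * p) ^ k)) := by
        rw [integral_const_mul]
        gcongr
        simpa using integral_sum_nearCount_le hp hn (k + k) k Finset.univ

lemma integral_abs_inducedBetti_sub_compl_le (hk : 3 ≤ k) (hr : 0 ≤ r)
    (hp : ∀ y, μ (Metric.closedBall y (2 * r * k)) ≤ p) (hn : n * p ≤ 1) (σ : Finset (Fin n)) :
    ∫ x : Fin n → E, |inducedBetti x r k Finset.univ - inducedBetti x r k σᶜ|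
      ∂(Measure.pi fun _ => μ) ≤ σ.card * (momentConst k 1 * (n * p)) := by
  have hint : Integrable (fun x : Fin n → E =>
      |inducedBetti x r k Finset.univ - inducedBetti x r k σᶜ|) (Measure.pi fun _ => μ) :=
    integrable_comp_cechComplex fun K =>
      |((induce K Finset.univ).betti (k - 2) : ℝ) - (induce K σᶜ).betti (k - 2)|
  calc _ ≤ ∫ x : Fin n → E, ∑ v ∈ σ, thresholdPow k 1 (nearCount x (2 * r * k) v Finset.univ)
        ∂(Measure.pi fun _ => μ) := by
        refine integral_mono hint (integrable_finsetSum _ fun v _ => integrable_nearCount _ _ v _)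
          fun x => ?_
        rw [Finset.compl_eq_univ_sdiff]
        exact abs_inducedBetti_sub_sdiff_le hk (two_mul_le_two_mul_mul (by lia) hr) Finset.univ σ
    _ ≤ _ := by simpa using integral_sum_nearCount_le hp hn k 1 σ

lemma abs_integral_card_holes_mul_sub_le (hk : 3 ≤ k) (hr : 0 ≤ r)
    (hp : ∀ y, μ (Metric.closedBall y (2 * r * k)) ≤ p) (hn : n * p ≤ 1)
    (hg : LipschitzWith L g) :
    |∫ x : Fin n → E, (holes x r k Finset.univ).card * g ((cechComplex x r).betti (k - 2))
        ∂(Measure.pi fun _ => μ) -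
      (∫ x : Fin n → E, ((holes x r k Finset.univ).card : ℝ) ∂(Measure.pi fun _ => μ)) *
        ∫ x : Fin n → E, g ((cechComplex x r).betti (k - 2) + 1) ∂(Measure.pi fun _ => μ)|
      ≤ holesConst k * L * (n * (n * p) ^ k) := by
  set ν : Measure (Fin n → E) := Measure.pi fun _ => μ
  have hmean : ∫ x, ((holes x r k Finset.univ).card : ℝ) ∂ν =
      ∑ σ ∈ Finset.univ.powersetCard k, ∫ x, holeIndicator (cechComplex x r) σ ∂ν := by
    simp_rw [card_holes_eq_sum]
    exact integral_finsetSum _ fun σ _ => integrable_comp_cechComplex fun K => holeIndicator K σ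
  have hmul : ∫ x, (holes x r k Finset.univ).card * g ((cechComplex x r).betti (k - 2)) ∂ν =
      ∑ σ ∈ Finset.univ.powersetCard k,
        ∫ x, holeIndicator (cechComplex x r) σ * g ((cechComplex x r).betti (k - 2)) ∂ν := by
    simp_rw [card_holes_eq_sum, Finset.sum_mul]
    exact integral_finsetSum _ fun σ _ =>
      integrable_comp_cechComplex fun K => holeIndicator K σ * g (K.betti (k - 2))
  have hξ : ∀ σ, 0 ≤ ∫ x, holeIndicator (cechComplex x r) σ ∂ν := fun σ =>
    integral_nonneg fun x => holeIndicator_nonneg _ σ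
  calc _ ≤ ∑ σ ∈ Finset.univ.powersetCard k, (L * ∫ x, holeIndicator (cechComplex x r) σ *
          |inducedBetti x r k Finset.univ - (1 + inducedBetti x r k σᶜ)| ∂ν +
        (∫ x, holeIndicator (cechComplex x r) σ ∂ν) *
          (L * (k * (momentConst k 1 * (n * p))))) := by
        rw [hmean, hmul, Finset.sum_mul, ← Finset.sum_sub_distrib]
        refine (Finset.abs_sum_le_sum_abs _ _).trans (Finset.sum_le_sum fun σ hσ => ?_)
        refine (abs_integral_holeIndicator_mul_sub_le hg σ).trans ?_
        gcongr
        · exact hξ σ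
        · exact (Finset.mem_powersetCard.1 hσ).2 ▸
            integral_abs_inducedBetti_sub_compl_le hk hr hp hn σ
    _ ≤ L * (2 ^ (k + 1) * (n * (momentConst (k + k) k * (n * p) ^ k))) +
        n * (momentConst k (k - 1) * (n * p) ^ (k - 1)) *
          (L * (k * (momentConst k 1 * (n * p)))) := by
        rw [Finset.sum_add_distrib, ← Finset.mul_sum, ← Finset.sum_mul, ← hmean]
        have hmoment := momentConst_nonneg k 1
        gcongr
        · exact sum_integral_holeIndicator_mul_le hk hr hp hn
        · exact integral_card_holes_le hk hr hp hn
    _ = holesConst k * L * (n * (n * p) ^ k) := by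
        rw [holesConst, ← pow_sub_one_mul (by lia : k ≠ 0) ((n : ℝ) * p)]
        ring

lemma abs_covariance_bettiExcess_le (hk : 3 ≤ k) (hr : 0 ≤ r)
    (hp : ∀ y, μ (Metric.closedBall y (2 * r * k)) ≤ p) (hn : n * p ≤ 1)
    (hg : LipschitzWith L g) :
    |cov[fun x : Fin n → E => bettiExcess x r k Finset.univ,
        fun x => g ((cechComplex x r).betti (k - 2)); Measure.pi fun _ => μ]| ≤
      8 * momentConst (k + k) k * L * (n * (n * p) ^ k) := by
  obtain ⟨F, hF⟩ := exists_bettiExcess_eq_comp (E := E) r k (Finset.univ : Finset (Fin n))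
  let G : PreAbstractSimplicialComplex (Fin n) → ℝ := fun K => g (K.betti (k - 2))
  calc _ ≤ ∑ m, ∫ Y, 8 * L * thresholdPow (k + k) k (copyCount Y (2 * r * k) m)
        ∂(Measure.pi fun _ => μ) := by
        refine abs_covariance_le ?_ (memLp_comp_cechComplex G 2) ?_
          (measurable_comp_cechComplex r G)
          (fun m => (integrable_closeCount _ _ _ _).const_mul _)
          fun m S T _ _ Y => abs_bettiExcess_sub_mul_abs_sub_le hk hr hg m S T Y
        · simpa only [hF] using memLp_comp_cechComplex F 2
        · simpa only [hF] using measurable_comp_cechComplex r F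
    _ ≤ ∑ _m : Fin n, 8 * L * (momentConst (k + k) k * (n * p) ^ k) := by
        refine Finset.sum_le_sum fun m _ => ?_
        rw [integral_const_mul]
        gcongr
        exact integral_copyCount_le hp hn (k + k) k m
    _ = 8 * momentConst (k + k) k * L * (n * (n * p) ^ k) := by
        rw [Finset.sum_const, Finset.card_univ, Fintype.card_fin, nsmul_eq_mul]
        ring

/-- The constant of the Stein bound for the contribution of the excess. -/
def excessConst (k : ℕ) : ℝ := 8 * momentConst (k + k) k + 2 * momentConst k k

lemma abs_integral_bettiExcess_mul_sub_le (hk : 3 ≤ k) (hr : 0 ≤ r)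
    (hp : ∀ y, μ (Metric.closedBall y (2 * r * k)) ≤ p) (hn : n * p ≤ 1)
    (hg : LipschitzWith L g) :
    |∫ x : Fin n → E, bettiExcess x r k Finset.univ * g ((cechComplex x r).betti (k - 2))
        ∂(Measure.pi fun _ => μ) -
      (∫ x : Fin n → E, bettiExcess x r k Finset.univ ∂(Measure.pi fun _ => μ)) *
        ∫ x : Fin n → E, g ((cechComplex x r).betti (k - 2) + 1) ∂(Measure.pi fun _ => μ)|
      ≤ excessConst k * L * (n * (n * p) ^ k) := by
  set ν : Measure (Fin n → E) := Measure.pi fun _ => μ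
  obtain ⟨F, hF⟩ := exists_bettiExcess_eq_comp (E := E) r k (Finset.univ : Finset (Fin n))
  let N : (Fin n → E) → ℕ := fun x => (cechComplex x r).betti (k - 2)
  have hshift : |∫ x, g (N x) ∂ν - ∫ x, g (N x + 1) ∂ν| ≤ L := by
    refine (abs_integral_sub_integral_le (integrable_comp_cechComplex fun K => g (K.betti (k - 2)))
      (integrable_comp_cechComplex fun K => g (K.betti (k - 2) + 1)) (integrable_const (L : ℝ))
      fun x => ?_).trans_eq (by simp)
    simpa [N] using abs_sub_le_of_lipschitzWith hg (N x) (N x + 1)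
  have hmean : |∫ x, bettiExcess x r k Finset.univ ∂ν| ≤ n * (2 * momentConst k k * (n * p) ^ k) :=
    abs_integral_le_integral_abs.trans (integral_abs_bettiExcess_le hk hr hp hn)
  have hcov : cov[fun x : Fin n → E => bettiExcess x r k Finset.univ, fun x => g (N x); ν] =
      ∫ x, bettiExcess x r k Finset.univ * g (N x) ∂ν -
        (∫ x, bettiExcess x r k Finset.univ ∂ν) * ∫ x, g (N x) ∂ν := by
    simp_rw [hF]
    exact covariance_eq_sub (memLp_comp_cechComplex F 2)
      (memLp_comp_cechComplex (fun K => g (K.betti (k - 2))) 2)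
  calc _ = |cov[fun x : Fin n → E => bettiExcess x r k Finset.univ, fun x => g (N x); ν] +
        (∫ x, bettiExcess x r k Finset.univ ∂ν) * (∫ x, g (N x) ∂ν - ∫ x, g (N x + 1) ∂ν)| := by
        rw [hcov, mul_sub, sub_add_sub_cancel]
    _ ≤ 8 * momentConst (k + k) k * L * (n * (n * p) ^ k) +
        n * (2 * momentConst k k * (n * p) ^ k) * L := by
        refine (abs_add_le _ _).trans (add_le_add (abs_covariance_bettiExcess_le hk hr hp hn hg) ?_)
        rw [abs_mul]
        exact mul_le_mul hmean hshift (abs_nonneg _) ((abs_nonneg _).trans hmean)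
    _ = excessConst k * L * (n * (n * p) ^ k) := by rw [excessConst]; ring

/-- The constant in the approximate Stein identity of the Betti number. -/
def steinConst (k : ℕ) : ℝ := holesConst k + excessConst k

theorem abs_stein_le (hk : 3 ≤ k) (hr : 0 ≤ r)
    (hp : ∀ y, μ (Metric.closedBall y (2 * r * k)) ≤ p) (hn : n * p ≤ 1)
    (hg : LipschitzWith L g) :
    |∫ x : Fin n → E, ((cechComplex x r).betti (k - 2) : ℝ) * g ((cechComplex x r).betti (k - 2))
        ∂(Measure.pi fun _ => μ) -
      (∫ x : Fin n → E, ((cechComplex x r).betti (k - 2) : ℝ) ∂(Measure.pi fun _ => μ)) *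
        ∫ x : Fin n → E, g ((cechComplex x r).betti (k - 2) + 1) ∂(Measure.pi fun _ => μ)|
      ≤ steinConst k * L * (n * (n * p) ^ k) := by
  obtain ⟨F, hF⟩ := exists_bettiExcess_eq_comp (E := E) r k (Finset.univ : Finset (Fin n))
  obtain ⟨H, hH⟩ := exists_card_holes_eq_comp (E := E) r k (Finset.univ : Finset (Fin n))
  have hHg := integrable_comp_cechComplex (r := r) (μ := μ) fun K => H K * g (K.betti (k - 2))
  have hFg := integrable_comp_cechComplex (r := r) (μ := μ) fun K => F K * g (K.betti (k - 2))
  have hholes := abs_integral_card_holes_mul_sub_le (μ := μ) hk hr hp hn hg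
  have hexcess := abs_integral_bettiExcess_mul_sub_le (μ := μ) hk hr hp hn hg
  simp_rw [← hF, ← hH] at hHg hFg
  simp_rw [betti_eq_card_holes_add_bettiExcess, add_mul]
  rw [integral_add hHg hFg, integral_add (integrable_card_holes _) (integrable_bettiExcess _),
    steinConst, add_mul, add_mul, add_mul, add_sub_add_comm]
  exact (abs_add_le _ _).trans (add_le_add hholes hexcess)

end SteinIdentity

/-! ### The Stein equation -/

section SteinSolution

lemma lipschitzWith_of_abs_succ_sub_le {g : ℕ → ℝ} {L : ℝ≥0} (hg : ∀ j, |g (j + 1) - g j| ≤ L) :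
    LipschitzWith L g := by
  have hle : ∀ {a b : ℕ}, a ≤ b → dist (g a) (g b) ≤ L * dist a b := fun {a b} hab => by
    refine (dist_le_Ico_sum_of_dist_le (d := fun _ => (L : ℝ)) hab fun {j} _ _ => ?_).trans_eq ?_
    · rw [dist_comm, Real.dist_eq]
      exact hg j
    · rw [Finset.sum_const, Nat.card_Ico, nsmul_eq_mul, Nat.dist_eq, abs_sub_comm,
        abs_of_nonneg (sub_nonneg.2 (Nat.cast_le.2 hab)), Nat.cast_sub hab, mul_comm]
  refine LipschitzWith.of_dist_le_mul fun a b => ?_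
  rcases le_total a b with hab | hba
  · exact hle hab
  · rw [dist_comm, dist_comm a]
    exact hle hba

variable {lam : ℝ≥0} {f : ℕ → ℝ}

lemma succ_mul_poissonMeasure_real_singleton (lam : ℝ≥0) (j : ℕ) :
    ((j : ℝ) + 1) * (poissonMeasure lam).real {j + 1} = lam * (poissonMeasure lam).real {j} := by
  rw [poissonMeasure_real_singleton, poissonMeasure_real_singleton, Nat.factorial_succ]
  push_cast
  field_simp
  ring

/-- The integral of `f` against the Poisson measure restricted to `{0, …, i - 1}`. -/
def poissonPartialSum (lam : ℝ≥0) (f : ℕ → ℝ) (i : ℕ) : ℝ :=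
  ∑ l ∈ Finset.range i, (poissonMeasure lam).real {l} * f l

lemma poissonPartialSum_succ (lam : ℝ≥0) (f : ℕ → ℝ) (i : ℕ) :
    poissonPartialSum lam f (i + 1) =
      poissonPartialSum lam f i + (poissonMeasure lam).real {i} * f i :=
  Finset.sum_range_succ _ _

lemma poissonPartialSum_nonneg (hf : 0 ≤ f) (i : ℕ) : 0 ≤ poissonPartialSum lam f i :=
  Finset.sum_nonneg fun l _ => mul_nonneg measureReal_nonneg (hf l)

lemma hasSum_poissonMeasure_real_mul (hf : Integrable f (poissonMeasure lam)) :
    HasSum (fun l => (poissonMeasure lam).real {l} * f l) (∫ l, f l ∂(poissonMeasure lam)) := by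
  simpa only [poissonMeasure_real_singleton, smul_eq_mul] using hasSum_integral_poissonMeasure hf

lemma poissonPartialSum_le_integral (hf : Integrable f (poissonMeasure lam)) (hf0 : 0 ≤ f)
    (i : ℕ) : poissonPartialSum lam f i ≤ ∫ l, f l ∂(poissonMeasure lam) :=
  sum_le_hasSum _ (fun l _ => mul_nonneg measureReal_nonneg (hf0 l))
    (hasSum_poissonMeasure_real_mul hf)

lemma poissonPartialSum_one_le_one (lam : ℝ≥0) (i : ℕ) : poissonPartialSum lam 1 i ≤ 1 := by
  simpa using poissonPartialSum_le_integral (lam := lam) (f := 1) (integrable_const 1) zero_le_one i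

lemma mul_poissonPartialSum_one_le (lam : ℝ≥0) (i : ℕ) :
    lam * poissonPartialSum lam 1 i ≤ i * poissonPartialSum lam 1 (i + 1) := by
  simp only [poissonPartialSum, Pi.one_apply, mul_one, Finset.mul_sum]
  rw [Finset.sum_range_succ']
  refine le_add_of_le_of_nonneg (Finset.sum_le_sum fun l hl => ?_) (by positivity)
  rw [← succ_mul_poissonMeasure_real_singleton]
  gcongr
  exact_mod_cast Finset.mem_range.1 hl

lemma mul_one_sub_poissonPartialSum_one_le (lam : ℝ≥0) (i : ℕ) :
    i * (1 - poissonPartialSum lam 1 (i + 1)) ≤ lam * (1 - poissonPartialSum lam 1 i) := by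
  have htail : ∀ i, HasSum (fun l => (poissonMeasure lam).real {l + i})
      (1 - poissonPartialSum lam 1 i) := fun i => by
    simp only [poissonPartialSum, Pi.one_apply, mul_one]
    refine (hasSum_nat_add_iff' (f := fun l => (poissonMeasure lam).real {l}) i).2 ?_
    simpa using hasSum_poissonMeasure_real_mul (lam := lam) (integrable_const 1)
  refine hasSum_le (fun l => ?_) ((htail (i + 1)).mul_left (i : ℝ)) ((htail i).mul_left (lam : ℝ))
  rw [← add_assoc, ← succ_mul_poissonMeasure_real_singleton]
  gcongr
  push_cast
  linarith [l.cast_nonneg (α := ℝ)]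

/-- The solution of Stein's equation `λ g (j + 1) - j * g j = f j - ∫ f` of the Poisson
distribution, shifted: `steinSolution lam f j` is the value of `g` at `j + 1`. -/
def steinSolution (lam : ℝ≥0) (f : ℕ → ℝ) (j : ℕ) : ℝ :=
  (poissonPartialSum lam f (j + 1) -
      (∫ l, f l ∂(poissonMeasure lam)) * poissonPartialSum lam 1 (j + 1)) /
    (lam * (poissonMeasure lam).real {j})

lemma mul_steinSolution_zero (hlam : 0 < lam) (f : ℕ → ℝ) :
    lam * steinSolution lam f 0 = f 0 - ∫ l, f l ∂(poissonMeasure lam) := by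
  have hweight := poissonMeasure_real_singleton_pos 0 hlam
  simp only [steinSolution, poissonPartialSum, zero_add, Finset.sum_range_one, Pi.one_apply]
  field_simp

lemma mul_steinSolution_succ_sub (hlam : 0 < lam) (f : ℕ → ℝ) (j : ℕ) :
    lam * steinSolution lam f (j + 1) - (j + 1 : ℕ) * steinSolution lam f j =
      f (j + 1) - ∫ l, f l ∂(poissonMeasure lam) := by
  have hweight := poissonMeasure_real_singleton_pos (j + 1) hlam
  rw [steinSolution, steinSolution, poissonPartialSum_succ lam f (j + 1),
    poissonPartialSum_succ lam 1 (j + 1), ← succ_mul_poissonMeasure_real_singleton lam j,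
    Pi.one_apply]
  push_cast
  field_simp
  ring

lemma integrable_of_mem_Icc (hf : ∀ j, f j ∈ Set.Icc 0 1) : Integrable f (poissonMeasure lam) :=
  Integrable.of_mem_Icc 0 1 Measurable.of_discrete.aemeasurable (.of_forall hf)

lemma steinSolution_one_sub (hf : Integrable f (poissonMeasure lam)) (j : ℕ) :
    steinSolution lam (1 - f) j = -steinSolution lam f j := by
  have hmean : ∫ l, (1 - f) l ∂(poissonMeasure lam) = 1 - ∫ l, f l ∂(poissonMeasure lam) := by
    simp [integral_sub (integrable_const (1 : ℝ)) hf]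
  rw [steinSolution, steinSolution, hmean, ← neg_div]
  simp only [poissonPartialSum, Pi.sub_apply, Pi.one_apply, mul_sub, mul_one,
    Finset.sum_sub_distrib]
  ring

lemma steinSolution_succ_sub (hlam : 0 < lam) (f : ℕ → ℝ) (j : ℕ) :
    steinSolution lam f (j + 1) - steinSolution lam f j =
      ((j + 1) * (poissonPartialSum lam f (j + 2) -
          (∫ l, f l ∂(poissonMeasure lam)) * poissonPartialSum lam 1 (j + 2)) -
        lam * (poissonPartialSum lam f (j + 1) -
          (∫ l, f l ∂(poissonMeasure lam)) * poissonPartialSum lam 1 (j + 1))) /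
      (lam * ((j + 1) * (poissonMeasure lam).real {j + 1})) := by
  have hweight := poissonMeasure_real_singleton_pos (j + 1) hlam
  rw [steinSolution, steinSolution, ← succ_mul_poissonMeasure_real_singleton lam j]
  field_simp

lemma steinSolution_succ_sub_le (hlam : 0 < lam) (hf : ∀ j, f j ∈ Set.Icc 0 1) (j : ℕ) :
    steinSolution lam f (j + 1) - steinSolution lam f j ≤ (lam : ℝ)⁻¹ := by
  have hlow := mul_poissonPartialSum_one_le lam (j + 1)
  have htail := mul_one_sub_poissonPartialSum_one_le lam (j + 1)
  have hrest := poissonPartialSum_le_integral (integrable_of_mem_Icc (lam := lam) hf)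
    (fun l => (hf l).1) (j + 2)
  have hweight : 0 < (poissonMeasure lam).real {j + 1} := poissonMeasure_real_singleton_pos _ hlam
  have hnonneg := poissonPartialSum_nonneg (lam := lam) (fun l => (hf l).1) (j + 1)
  have hnonneg_one :=
    poissonPartialSum_nonneg (lam := lam) (f := 1) (fun _ => zero_le_one) (j + 1)
  have htotal : 0 ≤ 1 - poissonPartialSum lam 1 (j + 2) :=
    sub_nonneg.2 (poissonPartialSum_one_le_one lam _)
  obtain ⟨hv0, hv1⟩ := hf (j + 1)
  rw [steinSolution_succ_sub hlam, poissonPartialSum_succ lam f (j + 1)]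
  rw [poissonPartialSum_succ lam f (j + 1)] at hrest
  rw [Nat.cast_add_one] at hlow htail
  set w := (poissonMeasure lam).real {j + 1}
  set u := poissonPartialSum lam f (j + 1)
  set a := poissonPartialSum lam 1 (j + 1)
  set b := poissonPartialSum lam 1 (j + 1 + 1)
  set m := ∫ l, f l ∂(poissonMeasure lam)
  set v := f (j + 1)
  have hnumerator : (j + 1) * (u + w * v - m * b) - lam * (u - m * a) ≤ (j + 1) * w :=
    calc _ = u * ((j + 1) * (1 - b) - lam * (1 - a)) +
          (m - (u + w * v)) * (lam * a - (j + 1) * b) +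
          w * v * ((j + 1) * (1 - b) + lam * a) := by ring
      _ ≤ 0 + 0 + w * 1 * ((j + 1) * (1 - b) + (j + 1) * b) := by
        gcongr
        · exact mul_nonpos_of_nonneg_of_nonpos hnonneg (sub_nonpos.2 htail)
        · exact mul_nonpos_of_nonneg_of_nonpos (sub_nonneg.2 hrest) (sub_nonpos.2 hlow)
      _ = (j + 1) * w := by ring
  calc _ ≤ ((j + 1) * w) / (lam * ((j + 1) * w)) := by gcongr
    _ = (lam : ℝ)⁻¹ := by field_simp

theorem exists_stein_solution (hlam : 0 < lam) (hf : ∀ j, f j ∈ Set.Icc 0 1) :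
    ∃ g : ℕ → ℝ, LipschitzWith lam⁻¹ g ∧
      ∀ j : ℕ, lam * g (j + 1) - j * g j = f j - ∫ l, f l ∂(poissonMeasure lam) := by
  refine ⟨fun j => steinSolution lam f (j - 1), lipschitzWith_of_abs_succ_sub_le fun j => ?_,
    fun j => ?_⟩
  · rcases j with _ | j
    · simp
    have hcompl := steinSolution_succ_sub_le (f := 1 - f) hlam
      (fun l => ⟨sub_nonneg.2 (hf l).2, sub_le_self _ (hf l).1⟩) j
    rw [steinSolution_one_sub (integrable_of_mem_Icc hf),
      steinSolution_one_sub (integrable_of_mem_Icc hf), neg_sub_neg] at hcompl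
    rw [NNReal.coe_inv, abs_sub_le_iff]
    exact ⟨steinSolution_succ_sub_le hlam hf j, hcompl⟩
  · rcases j with _ | j
    · simpa using mul_steinSolution_zero hlam f
    · exact mul_steinSolution_succ_sub hlam f j

end SteinSolution

section PoissonApproximation

variable {E : Type*} [PseudoMetricSpace E] [ProperSpace E] [MeasurableSpace E]
  [BorelSpace E] {μ : Measure E} [IsProbabilityMeasure μ] {n k : ℕ} {r : ℝ} {p lam : ℝ≥0}

theorem abs_integral_betti_sub_poisson_le (hk : 3 ≤ k) (hr : 0 ≤ r)
    (hp : ∀ y, μ (Metric.closedBall y (2 * r * k)) ≤ p) (hn : n * p ≤ 1)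
    {h : ℕ → ℝ} (hh : ∀ j, |h j| ≤ 1) (hpos : 0 < lam)
    (hlam : (lam : ℝ) =
      ∫ x : Fin n → E, ((cechComplex x r).betti (k - 2) : ℝ) ∂(Measure.pi fun _ => μ)) :
    |∫ x : Fin n → E, h ((cechComplex x r).betti (k - 2)) ∂(Measure.pi fun _ => μ) -
      ∫ j, h j ∂(poissonMeasure lam)| ≤ 2 * steinConst k * (n * (n * p) ^ k) / lam := by
  set ν : Measure (Fin n → E) := Measure.pi fun _ => μ
  let N : (Fin n → E) → ℕ := fun x => (cechComplex x r).betti (k - 2)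
  obtain ⟨g, hgLip, hg⟩ := exists_stein_solution (f := fun j => (h j + 1) / 2) hpos fun j => by
    have := abs_le.1 (hh j)
    constructor <;> linarith
  have hstein := abs_stein_le (μ := μ) hk hr hp hn hgLip
  have hinth : Integrable h (poissonMeasure lam) :=
    Integrable.of_bound Measurable.of_discrete.aestronglyMeasurable 1 (.of_forall hh)
  have hmean : ∫ j, (h j + 1) / 2 ∂(poissonMeasure lam) =
      (∫ j, h j ∂(poissonMeasure lam) + 1) / 2 := by
    simp [integral_div, integral_add hinth (integrable_const _)]
  have hpointwise : ∀ x, h (N x) - ∫ j, h j ∂(poissonMeasure lam) =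
      2 * (lam * g (N x + 1) - N x * g (N x)) := fun x => by
    rw [hg, hmean]
    ring
  have heq : ∫ x, h (N x) ∂ν - ∫ j, h j ∂(poissonMeasure lam) =
      2 * (lam * ∫ x, g (N x + 1) ∂ν - ∫ x, N x * g (N x) ∂ν) := by
    have hintN : ∀ F : ℕ → ℝ, Integrable (fun x => F (N x)) ν := fun F =>
      integrable_comp_cechComplex fun K => F (K.betti (k - 2))
    rw [← integral_const_mul, ← integral_sub ((hintN fun j => g (j + 1)).const_mul _)
      (hintN fun j => j * g j), ← integral_const_mul]
    simp_rw [← hpointwise]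
    simp [integral_sub (hintN h) (integrable_const _)]
  calc _ = 2 * |∫ x, N x * g (N x) ∂ν - lam * ∫ x, g (N x + 1) ∂ν| := by
        rw [heq, abs_mul, abs_two, abs_sub_comm]
    _ ≤ 2 * (steinConst k * (lam⁻¹ : ℝ≥0) * (n * (n * p) ^ k)) := by
        rw [hlam]
        gcongr
    _ = 2 * steinConst k * (n * (n * p) ^ k) / lam := by
        rw [NNReal.coe_inv]
        ring

end PoissonApproximation

/-! ### Lower bound for the expected Betti number -/

section StableHole

/-- Points that are not all within distance less than one of a single point, although all of them
except any given one lie in a ball of radius `ρ`. If `ρ < 1`, these are the vertices of a hole of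
the Čech complex that survives small perturbations of the points. -/
structure IsStableHole {ι E : Type*} [PseudoMetricSpace E] (y : ι → E) (ρ : ℝ) : Prop where
  exists_one_le_dist : ∀ q, ∃ i, 1 ≤ dist q (y i)
  exists_forall_ne_dist_le : ∀ j, ∃ q, ∀ i ≠ j, dist q (y i) ≤ ρ

lemma IsStableHole.nonneg {ι E : Type*} [Nontrivial ι] [PseudoMetricSpace E] {y : ι → E} {ρ : ℝ}
    (hy : IsStableHole y ρ) : 0 ≤ ρ := by
  obtain ⟨i, j, hij⟩ := exists_pair_ne ι
  obtain ⟨q, hq⟩ := hy.exists_forall_ne_dist_le j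
  exact dist_nonneg.trans (hq i hij)

variable {F : Type*} [NormedAddCommGroup F] [InnerProductSpace ℝ F]

lemma inner_pos_of_dist_lt_one {q y : F} (hy : ‖y‖ = 1) (hq : dist q y < 1) :
    0 < inner ℝ q y := by
  rw [dist_eq_norm, ← sq_lt_one_iff₀ (norm_nonneg _), norm_sub_sq_real, hy] at hq
  linarith [sq_nonneg ‖q‖]

lemma exists_one_le_dist_of_sum_smul_eq_zero {ι : Type*} [Fintype ι] [Nonempty ι] {y : ι → F}
    {c : ι → ℝ} (hy : ∀ i, ‖y i‖ = 1) (hc : ∀ i, 0 < c i) (hsum : ∑ i, c i • y i = 0) (q : F) :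
    ∃ i, 1 ≤ dist q (y i) := by
  by_contra! hlt
  have hpos : 0 < inner ℝ q (∑ i, c i • y i) := by
    simp_rw [inner_sum, real_inner_smul_right]
    exact Finset.sum_pos (fun i _ => mul_pos (hc i) (inner_pos_of_dist_lt_one (hy i) (hlt i)))
      Finset.univ_nonempty
  simp [hsum] at hpos

lemma eventually_dist_smul_lt_one {q y : F} (hy : ‖y‖ = 1) (hq : 0 < inner ℝ q y) :
    ∀ᶠ ε in 𝓝[>] (0 : ℝ), dist (ε • q) y < 1 := by
  have hlim : Tendsto (fun ε : ℝ => ε * ‖q‖ ^ 2) (𝓝[>] 0) (𝓝 0) :=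
    ((continuous_mul_const _).tendsto' 0 0 (zero_mul _)).mono_left nhdsWithin_le_nhds
  filter_upwards [hlim.eventually (gt_mem_nhds (mul_pos two_pos hq)), self_mem_nhdsWithin]
    with ε hsmall (hε : 0 < ε)
  have hsq : ‖ε • q - y‖ ^ 2 = ε * (ε * ‖q‖ ^ 2 - 2 * inner ℝ q y) + 1 := by
    rw [norm_sub_sq_real, hy, norm_smul, real_inner_smul_left, Real.norm_of_nonneg hε.le]
    ring
  rw [dist_eq_norm, ← sq_lt_one_iff₀ (norm_nonneg _), hsq]
  linarith [mul_neg_of_pos_of_neg hε (sub_neg.2 hsmall)]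

lemma exists_isStableHole_of_inner_pos {ι : Type*} [Finite ι] {y : ι → F} (hy : ∀ i, ‖y i‖ = 1)
    (hfar : ∀ q, ∃ i, 1 ≤ dist q (y i)) (hinner : ∀ j, ∃ q, ∀ i ≠ j, 0 < inner ℝ q (y i)) :
    ∃ ρ < 1, IsStableHole y ρ := by
  have hnear : ∀ j, ∃ q, ∀ i ≠ j, dist q (y i) < 1 := fun j => by
    obtain ⟨q, hq⟩ := hinner j
    have hsmall : ∀ᶠ ε in 𝓝[>] (0 : ℝ), ∀ i ≠ j, dist (ε • q) (y i) < 1 := by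
      simp_rw [eventually_all]
      exact fun i hi => eventually_dist_smul_lt_one (hy i) (hq i hi)
    obtain ⟨ε, hε⟩ := hsmall.exists
    exact ⟨_, hε⟩
  choose q hq using hnear
  have hlarge : ∀ᶠ ρ in 𝓝[<] (1 : ℝ), ∀ j, ∀ i ≠ j, dist (q j) (y i) ≤ ρ := by
    simp_rw [eventually_all]
    exact fun j i hi => (eventually_ge_nhds (hq j i hi)).filter_mono nhdsWithin_le_nhds
  obtain ⟨ρ, hdist, hρ⟩ := (hlarge.and self_mem_nhdsWithin).exists
  exact ⟨ρ, hρ, hfar, fun j => ⟨q j, hdist j⟩⟩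

/-- The family `e`, preceded by the unit vector opposite to its sum when `e` is orthonormal: the
vertices of a simplex inscribed in the unit sphere whose interior contains the center. -/
def simplexVertices {m : ℕ} (e : Fin m → F) : Fin (m + 1) → F :=
  Fin.cons (-(√m)⁻¹ • ∑ i, e i) e

variable {m : ℕ} {e : Fin m → F}

lemma inner_sum_left_eq_one (he : Orthonormal ℝ e) (i : Fin m) : inner ℝ (∑ j, e j) (e i) = 1 := by
  simpa using he.inner_left_fintype (fun _ => 1) i

lemma inner_sum_sum_eq (he : Orthonormal ℝ e) : inner ℝ (∑ j, e j) (∑ j, e j) = (m : ℝ) := by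
  rw [inner_sum]
  simp [inner_sum_left_eq_one he]

lemma norm_simplexVertices [NeZero m] (he : Orthonormal ℝ e) (i : Fin (m + 1)) :
    ‖simplexVertices e i‖ = 1 := by
  have hm : (0 : ℝ) < m := Nat.cast_pos.2 (NeZero.pos m)
  refine Fin.cases ?_ (fun i => ?_) i
  · have hsum : ‖∑ j, e j‖ = √m := by rw [norm_eq_sqrt_real_inner, inner_sum_sum_eq he]
    rw [simplexVertices, Fin.cons_zero, norm_smul, norm_neg, norm_inv, hsum,
      Real.norm_of_nonneg (Real.sqrt_nonneg _), inv_mul_cancel₀ (Real.sqrt_pos.2 hm).ne']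
  · simpa [simplexVertices] using he.norm_eq_one i

lemma exists_forall_ne_inner_simplexVertices_pos [NeZero m] (he : Orthonormal ℝ e)
    (j : Fin (m + 1)) : ∃ q, ∀ i ≠ j, 0 < inner ℝ q (simplexVertices e i) := by
  have hm : (0 : ℝ) < m := Nat.cast_pos.2 (NeZero.pos m)
  refine Fin.cases ⟨∑ l, e l, fun i hi => ?_⟩ (fun j => ⟨∑ l, e l - (m + 1 : ℝ) • e j, ?_⟩) j
  · obtain ⟨i, rfl⟩ := Fin.exists_succ_eq.2 hi
    simp [simplexVertices, inner_sum_left_eq_one he]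
  · refine Fin.cases (fun _ => ?_) fun i hij => ?_
    · have hinner : inner ℝ (∑ l, e l - (m + 1 : ℝ) • e j) (∑ l, e l) = -1 := by
        rw [inner_sub_left, real_inner_smul_left, inner_sum_sum_eq he, real_inner_comm,
          inner_sum_left_eq_one he]
        ring
      rw [simplexVertices, Fin.cons_zero, real_inner_smul_right, hinner, neg_mul_neg, mul_one]
      positivity
    · have hji : j ≠ i := fun h => hij (congrArg Fin.succ h.symm)
      simp [simplexVertices, inner_sub_left, real_inner_smul_left, inner_sum_left_eq_one he,
        he.inner_eq_zero hji]

theorem exists_isStableHole [NeZero m] (he : Orthonormal ℝ e) :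
    ∃ ρ < 1, IsStableHole (simplexVertices e) ρ := by
  have hm : 0 < √(m : ℝ) := Real.sqrt_pos.2 (Nat.cast_pos.2 (NeZero.pos m))
  refine exists_isStableHole_of_inner_pos (norm_simplexVertices he)
    (exists_one_le_dist_of_sum_smul_eq_zero (c := Fin.cons √m fun _ => 1) (norm_simplexVertices he)
      (Fin.cases hm fun _ => one_pos) ?_)
    (exists_forall_ne_inner_simplexVertices_pos he)
  simp [Fin.sum_univ_succ, simplexVertices, smul_smul, hm.ne']

lemma isHole_of_dist_le {ι E : Type*} [Fintype ι] [LinearOrder ι] [Nontrivial ι]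
    [NormedAddCommGroup E] [NormedSpace ℝ E] {y x : ι → E} {a : E} {ρ r : ℝ}
    (hy : IsStableHole y ρ) (hρ : ρ < 1) (hr : 0 < r)
    (hx : ∀ i, dist (x i) (a + (2 * r / (1 + ρ)) • y i) ≤ (1 - ρ) / 4 * (2 * r / (1 + ρ))) :
    IsHole (cechComplex x r) Finset.univ := by
  have hρ0 := hy.nonneg
  set s : ℝ := 2 * r / (1 + ρ) with hs
  have hs0 : 0 < s := by positivity
  have hrs : r = s * ((1 + ρ) / 2) := by rw [hs]; field_simp
  have hgap : 0 < s * (1 - ρ) := mul_pos hs0 (sub_pos.2 hρ)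
  have hscale : ∀ q i, dist (a + s • q) (a + s • y i) = s * dist q (y i) := fun q i => by
    rw [dist_add_left, dist_smul₀, Real.norm_of_nonneg hs0.le]
  constructor
  · rintro ⟨-, q, hq⟩
    obtain ⟨i, hi⟩ := hy.exists_one_le_dist (s⁻¹ • (q - a))
    have hfar : s ≤ dist q (a + s • y i) := by
      simpa [hs0.ne'] using (le_mul_of_one_le_right hs0.le hi).trans_eq (hscale _ i).symm
    have hqx : dist q (x i) ≤ r := Set.mem_iInter₂.1 hq i (Finset.mem_univ i)
    linarith [dist_triangle q (x i) (a + s • y i), hx i]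
  · intro j _
    obtain ⟨q, hq⟩ := hy.exists_forall_ne_dist_le j
    refine ⟨?_, a + s • q, Set.mem_iInter₂.2 fun i hi => ?_⟩
    · obtain ⟨i, hij⟩ := exists_ne j
      exact ⟨i, Finset.mem_erase.2 ⟨hij, Finset.mem_univ i⟩⟩
    · have hnear : s * dist q (y i) ≤ s * ρ := by
        gcongr
        exact hq i (Finset.ne_of_mem_erase hi)
      rw [← hscale] at hnear
      rw [Metric.mem_closedBall]
      linarith [dist_triangle_right (a + s • q) (x i) (a + s • y i), hx i]

open scoped Pointwise in
lemma isHole_of_differences_mem {E : Type*} [NormedAddCommGroup E] [NormedSpace ℝ E] [NeZero m]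
    {y x : Fin (m + 1) → E} {ρ r : ℝ} (hy : IsStableHole y ρ) (hρ : ρ < 1) (hr : 0 < r)
    (hx : (fun i : Fin m => x i.succ - x 0) ∈ (2 * r / (1 + ρ)) •
      Metric.closedBall (fun i : Fin m => y i.succ - y 0) ((1 - ρ) / 4)) :
    IsHole (cechComplex x r) Finset.univ := by
  have hρ0 := hy.nonneg
  have hs : 0 < 2 * r / (1 + ρ) := by positivity
  have hgap : 0 < (1 - ρ) / 4 := by linarith
  rw [smul_closedBall _ _ hgap.le, mem_closedBall_iff_norm,
    pi_norm_le_iff_of_nonneg (by positivity), Real.norm_of_nonneg hs.le,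
    mul_comm _ ((1 - ρ) / 4)] at hx
  refine isHole_of_dist_le hy hρ hr (a := x 0 - (2 * r / (1 + ρ)) • y 0)
    (Fin.cases ?_ fun i => ?_)
  · rw [sub_add_cancel, dist_self]
    positivity
  · convert hx i using 1
    rw [dist_eq_norm, Pi.sub_apply, Pi.smul_apply, smul_sub]
    congr 1
    abel

end StableHole

section LowerBound

lemma exists_smul_restrict_le_withDensity {α : Type*} [MeasurableSpace α] [TopologicalSpace α]
    [OpensMeasurableSpace α] [T2Space α] {ν : Measure α} [ν.InnerRegular] {f : α → ℝ≥0∞}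
    (hf : Measurable f) (hf0 : ν.withDensity f ≠ 0) :
    ∃ t : ℝ≥0∞, t ≠ 0 ∧ ∃ S, IsCompact S ∧ ν S ≠ 0 ∧ t • ν.restrict S ≤ ν.withDensity f := by
  have hpos : ν {x | f x ≠ 0} ≠ 0 := fun h =>
    hf0 ((withDensity_eq_zero_iff hf.aemeasurable).2 (ae_iff.2 h))
  obtain ⟨N, hN⟩ : ∃ N : ℕ, ν {x | (N : ℝ≥0∞)⁻¹ ≤ f x} ≠ 0 := by
    by_contra! hnull
    refine hpos (measure_mono_null (fun x hx => ?_) (measure_iUnion_null hnull))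
    obtain ⟨N, hN⟩ := ENNReal.exists_inv_nat_lt hx
    exact Set.mem_iUnion.2 ⟨N, hN.le⟩
  obtain ⟨S, hSf, hSc, hS0⟩ := (measurableSet_le measurable_const hf).exists_lt_isCompact
    (pos_iff_ne_zero.2 hN)
  refine ⟨(N : ℝ≥0∞)⁻¹, by simp, S, hSc, hS0.ne', ?_⟩
  rw [← withDensity_const, ← withDensity_indicator hSc.measurableSet]
  exact withDensity_mono (ae_of_all _ (Set.indicator_le fun x hx => hSf hx))

lemma smul_pi_restrict_le_pi {ι α : Type*} [Fintype ι] [MeasurableSpace α] {ν μ : Measure α}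
    [SigmaFinite ν] {t : ℝ≥0∞} {S : Set α} (hS : MeasurableSet S) (hμ : t • ν.restrict S ≤ μ) :
    t ^ Fintype.card ι • (Measure.pi fun _ : ι => ν).restrict (Set.univ.pi fun _ => S) ≤
      Measure.pi fun _ => μ := by
  refine Measure.le_iff.2 fun A hA => ?_
  conv_rhs => rw [Measure.pi, toMeasure_apply _ _ hA]
  refine OuterMeasure.le_pi.2 (fun s _ => ?_) A
  calc t ^ Fintype.card ι * (Measure.pi fun _ : ι => ν).restrict (Set.univ.pi fun _ => S)
        (Set.univ.pi s)
      = ∏ i, t * ν (s i ∩ S) := by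
        rw [Measure.restrict_apply' (.univ_pi fun _ => hS), ← Set.pi_inter_distrib, Measure.pi_pi,
          Finset.prod_mul_distrib, Finset.prod_const, Finset.card_univ]
    _ ≤ ∏ i, μ (s i) := Finset.prod_le_prod' fun i _ => by
        simpa [Measure.restrict_apply' hS] using hμ (s i)

section Translation

variable {E : Type*} [AddCommGroup E] [TopologicalSpace E] [IsTopologicalAddGroup E]
  [MeasurableSpace E] [BorelSpace E] {ν : Measure E} {S : Set E} {m : ℕ}

open scoped Pointwise in
lemma eventually_half_le_measure_translates [LocallyCompactSpace E] [T2Space E]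
    [IsFiniteMeasureOnCompacts ν] [ν.InnerRegularCompactLTTop] [ν.IsAddLeftInvariant]
    (hS : IsCompact S) (hS0 : ν S ≠ 0) :
    ∀ᶠ u in 𝓝 (0 : Fin m → E), ν S / 2 ≤ ν {x | x ∈ S ∧ ∀ i, x + u i ∈ S} := by
  have hfin : ν S / 2 ≠ ∞ := ENNReal.div_ne_top hS.measure_lt_top.ne two_ne_zero
  have hlim : Tendsto (fun u : Fin m → E => ∑ i, ν ((u i +ᵥ S) \ S)) (𝓝 0) (𝓝 0) := by
    simpa using tendsto_finsetSum Finset.univ fun i _ =>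
      (tendsto_measure_vadd_sdiff_isCompact_isClosed (μ := ν) hS hS.isClosed).comp
        ((continuous_apply i).tendsto' 0 0 rfl)
  filter_upwards [hlim.eventually (ge_mem_nhds (ENNReal.half_pos hS0))] with u hu
  have hcover : S ⊆ {x | x ∈ S ∧ ∀ i, x + u i ∈ S} ∪ ⋃ i, (u i + ·) ⁻¹' ((u i +ᵥ S) \ S) := by
    intro x hx
    by_cases hmem : ∀ i, x + u i ∈ S
    · exact .inl ⟨hx, hmem⟩
    · obtain ⟨i, hi⟩ := not_forall.1 hmem
      exact .inr (Set.mem_iUnion.2 ⟨i, Set.vadd_mem_vadd_set hx, by simpa only [add_comm] using hi⟩)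
  refine (ENNReal.add_le_add_iff_right hfin).1 ?_
  calc ν S / 2 + ν S / 2 = ν S := ENNReal.add_halves _
    _ ≤ ν {x | x ∈ S ∧ ∀ i, x + u i ∈ S} + ∑ i, ν ((u i + ·) ⁻¹' ((u i +ᵥ S) \ S)) :=
        (measure_mono hcover).trans ((measure_union_le _ _).trans
          (add_le_add_right (measure_iUnion_fintype_le _ _) _))
    _ ≤ ν {x | x ∈ S ∧ ∀ i, x + u i ∈ S} + ν S / 2 := by
        gcongr
        simpa only [measure_preimage_add] using hu

variable [SecondCountableTopology E] [SigmaFinite ν] [ν.IsAddLeftInvariant]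

lemma measurePreserving_differences :
    MeasurePreserving (fun x : Fin (m + 1) → E => (x 0, fun i : Fin m => x i.succ - x 0))
      (Measure.pi fun _ => ν) (ν.prod (Measure.pi fun _ => ν)) :=
  ((MeasurePreserving.id ν).skew_product (g := fun (a : E) (y : Fin m → E) => y - fun _ => a)
    (by fun_prop) (ae_of_all _ fun a => (measurePreserving_sub_right _ _).map_eq)).comp
    (measurePreserving_piFinSuccAbove (fun _ : Fin (m + 1) => ν) 0)

lemma mul_measure_pi_le_measure_differences_mem {v : ℝ≥0∞} {B : Set (Fin m → E)}
    (hS : MeasurableSet S) (hB : MeasurableSet B)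
    (hv : ∀ u ∈ B, v ≤ ν {x | x ∈ S ∧ ∀ i, x + u i ∈ S}) :
    v * Measure.pi (fun _ => ν) B ≤ Measure.pi (fun _ : Fin (m + 1) => ν)
      {x | (fun i => x i.succ - x 0) ∈ B ∧ ∀ i, x i ∈ S} := by
  set A : Set (E × (Fin m → E)) := {z | z.2 ∈ B ∧ z.1 ∈ S ∧ ∀ i, z.1 + z.2 i ∈ S} with hA
  have hAmeas : MeasurableSet A := by
    simp only [hA, Set.ofPred_and, Set.ofPred_forall]
    exact (measurable_snd hB).inter ((measurable_fst hS).inter (.iInter fun i =>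
      (show Measurable fun z : E × (Fin m → E) => z.1 + z.2 i by fun_prop) hS))
  calc v * Measure.pi (fun _ => ν) B
      = ∫⁻ _ in B, v ∂(Measure.pi fun _ => ν) := (setLIntegral_const _ _).symm
    _ ≤ ∫⁻ u in B, ν ((·, u) ⁻¹' A) ∂(Measure.pi fun _ => ν) :=
        setLIntegral_mono' hB fun u hu =>
          (hv u hu).trans (measure_mono fun x hx => ⟨hu, hx⟩)
    _ ≤ ν.prod (Measure.pi fun _ => ν) A := by
        rw [Measure.prod_apply_symm hAmeas]
        exact setLIntegral_le_lintegral _ _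
    _ = _ := by
        rw [← measurePreserving_differences.measure_preimage hAmeas.nullMeasurableSet]
        congr 1 with x
        simp [hA, Fin.forall_fin_succ]

end Translation

variable {E : Type*} [NormedAddCommGroup E] [MeasurableSpace E] [BorelSpace E] {m : ℕ}

open scoped Pointwise in
lemma exists_eventually_le_measure_differences_mem [NormedSpace ℝ E] [FiniteDimensional ℝ E]
    {ν : Measure E} [ν.IsAddHaarMeasure] {f : E → ℝ≥0∞} (hf : Measurable f)
    [IsProbabilityMeasure (ν.withDensity f)] {B : Set (Fin m → E)} (hB : MeasurableSet B)
    (hbounded : Bornology.IsBounded B) (hB0 : Measure.pi (fun _ => ν) B ≠ 0) :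
    ∃ c : ℝ, 0 < c ∧ ∀ᶠ s in 𝓝[>] (0 : ℝ), c * s ^ (m * Module.finrank ℝ E) ≤
      (Measure.pi fun _ : Fin (m + 1) => ν.withDensity f).real
        {x | (fun i : Fin m => x i.succ - x 0) ∈ s • B} := by
  obtain ⟨t, ht, S, hS, hS0, hμ⟩ :=
    exists_smul_restrict_le_withDensity hf (IsProbabilityMeasure.ne_zero (ν.withDensity f))
  have hne : t ^ (m + 1) * (ν S / 2 * Measure.pi (fun _ => ν) B) ≠ 0 := by
    simp [ht, hS0, hB0]
  obtain ⟨c, hc0, hc⟩ := ENNReal.lt_iff_exists_nnreal_btwn.1 (pos_iff_ne_zero.2 hne)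
  refine ⟨c, by exact_mod_cast hc0, ?_⟩
  have hsmall : ∀ᶠ s in 𝓝[>] (0 : ℝ), {0} + s • B ⊆
      {u | ν S / 2 ≤ ν {x | x ∈ S ∧ ∀ i, x + u i ∈ S}} :=
    (eventually_singleton_add_smul_subset hbounded
      (eventually_half_le_measure_translates hS hS0)).filter_mono nhdsWithin_le_nhds
  filter_upwards [hsmall, self_mem_nhdsWithin] with s hs (hs0 : 0 < s)
  rw [Set.singleton_zero, zero_add] at hs
  have hsB : Measure.pi (fun _ => ν) (s • B) =
      ENNReal.ofReal (s ^ (m * Module.finrank ℝ E)) * Measure.pi (fun _ => ν) B := by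
    rw [Measure.addHaar_smul_of_nonneg _ hs0.le, Module.finrank_pi_fintype]
    simp
  refine (ENNReal.ofReal_le_iff_le_toReal (measure_ne_top _ _)).1 ?_
  calc ENNReal.ofReal (c * s ^ (m * Module.finrank ℝ E))
      = c * ENNReal.ofReal (s ^ (m * Module.finrank ℝ E)) := by
        rw [ENNReal.ofReal_mul c.coe_nonneg, ENNReal.ofReal_coe_nnreal]
    _ ≤ t ^ (m + 1) * (ν S / 2 * Measure.pi (fun _ => ν) B) *
          ENNReal.ofReal (s ^ (m * Module.finrank ℝ E)) := by gcongr
    _ = t ^ (m + 1) * (ν S / 2 * Measure.pi (fun _ => ν) (s • B)) := by rw [hsB]; ring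
    _ ≤ t ^ (m + 1) * Measure.pi (fun _ : Fin (m + 1) => ν)
          {x | (fun i : Fin m => x i.succ - x 0) ∈ s • B ∧ ∀ i, x i ∈ S} := by
        gcongr
        exact mul_measure_pi_le_measure_differences_mem hS.measurableSet
          (hB.const_smul₀ s) fun u hu => hs hu
    _ ≤ _ := by
        refine le_trans ?_ (smul_pi_restrict_le_pi hS.measurableSet hμ _)
        rw [Measure.smul_apply, Fintype.card_fin, smul_eq_mul,
          Measure.restrict_apply' (.univ_pi fun _ => hS.measurableSet)]
        gcongr
        exact fun x hx => ⟨hx.1, fun i _ => hx.2 i⟩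

open scoped Pointwise in
theorem exists_eventually_le_measure_isHole [InnerProductSpace ℝ E] [FiniteDimensional ℝ E]
    [NeZero m] (hm : m ≤ Module.finrank ℝ E) {ν : Measure E} [ν.IsAddHaarMeasure] {f : E → ℝ≥0∞}
    (hf : Measurable f) [IsProbabilityMeasure (ν.withDensity f)] :
    ∃ c : ℝ, 0 < c ∧ ∀ᶠ r in 𝓝[>] (0 : ℝ), c * r ^ (m * Module.finrank ℝ E) ≤
      (Measure.pi fun _ : Fin (m + 1) => ν.withDensity f).real
        {x | IsHole (cechComplex x r) Finset.univ} := by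
  obtain ⟨ρ, hρ, hstable⟩ := exists_isStableHole
    ((stdOrthonormalBasis ℝ E).orthonormal.comp _ (Fin.castLE_injective hm))
  set y : Fin (m + 1) → E := simplexVertices _
  have hρ0 := hstable.nonneg
  have hgap : 0 < (1 - ρ) / 4 := by linarith
  set B := Metric.closedBall (fun i : Fin m => y i.succ - y 0) ((1 - ρ) / 4)
  obtain ⟨c, hc, hlower⟩ := exists_eventually_le_measure_differences_mem hf
    Metric.isClosed_closedBall.measurableSet Metric.isBounded_closedBall
    (B := B) (Metric.measure_closedBall_pos (Measure.pi fun _ => ν) _ hgap).ne'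
  have hscale : Tendsto (fun r : ℝ => 2 * r / (1 + ρ)) (𝓝[>] 0) (𝓝[>] 0) := by
    refine tendsto_nhdsWithin_iff.2 ⟨?_, ?_⟩
    · exact (Continuous.tendsto' (by fun_prop) 0 0 (by simp)).mono_left nhdsWithin_le_nhds
    · filter_upwards [self_mem_nhdsWithin] with r (hr : 0 < r)
      exact div_pos (mul_pos two_pos hr) (by positivity)
  refine ⟨c, hc, ?_⟩
  filter_upwards [hscale.eventually hlower, self_mem_nhdsWithin] with r hr (hr0 : 0 < r)
  have hrs : r ≤ 2 * r / (1 + ρ) := by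
    rw [le_div_iff₀ (by positivity)]
    nlinarith
  calc c * r ^ (m * Module.finrank ℝ E)
      ≤ c * (2 * r / (1 + ρ)) ^ (m * Module.finrank ℝ E) := by gcongr
    _ ≤ _ := hr
    _ ≤ _ := measureReal_mono fun x hx =>
        isHole_of_differences_mem hstable hρ hr0 hx

end LowerBound

section ExpectedBetti

lemma mem_cechComplex_comp {ι κ E : Type*} [PseudoMetricSpace E] (x : ι → E) (r : ℝ) (e : κ ↪ ι)
    (τ : Finset κ) : τ ∈ cechComplex (fun j => x (e j)) r ↔ τ.map e ∈ cechComplex x r := by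
  change (_ ∧ _) ↔ (_ ∧ _)
  simp

lemma isHole_cechComplex_comp {ι κ E : Type*} [LinearOrder ι] [LinearOrder κ]
    [PseudoMetricSpace E] (x : ι → E) (r : ℝ) (e : κ ↪ ι) (τ : Finset κ) :
    IsHole (cechComplex (fun j => x (e j)) r) τ ↔ IsHole (cechComplex x r) (τ.map e) := by
  simp only [IsHole, mem_cechComplex_comp, Finset.map_erase, Finset.mem_map, forall_exists_index,
    and_imp, forall_apply_eq_imp_iff₂]

lemma div_pow_le_choose {n k : ℕ} (hk : 1 ≤ k) (hn : k ≤ n) :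
    ((n : ℝ) / k) ^ k / k.factorial ≤ n.choose k := by
  refine le_trans ?_ (Nat.pow_le_choose k n)
  have hk1 : (1 : ℝ) ≤ k := by exact_mod_cast hk
  have hn1 : (k : ℝ) ≤ n := by exact_mod_cast hn
  gcongr
  rw [div_le_iff₀ (by positivity), Nat.cast_sub (by lia), Nat.cast_add_one]
  nlinarith

variable {E : Type*} [PseudoMetricSpace E] [ProperSpace E] [MeasurableSpace E]
  [BorelSpace E] {μ : Measure E} [IsProbabilityMeasure μ] {n k : ℕ} {r : ℝ} {p : ℝ≥0}

lemma integral_holeIndicator_eq {σ : Finset (Fin n)} (hσ : σ.card = k) :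
    ∫ x : Fin n → E, holeIndicator (cechComplex x r) σ ∂(Measure.pi fun _ => μ) =
      (Measure.pi fun _ : Fin k => μ).real {x | IsHole (cechComplex x r) Finset.univ} := by
  have hmeas {j : ℕ} (τ : Finset (Fin j)) :
      MeasurableSet {x : Fin j → E | IsHole (cechComplex x r) τ} :=
    measurable_cechComplex r (.of_discrete (s := {K | IsHole K τ}))
  have hindicator (x : Fin n → E) : holeIndicator (cechComplex x r) σ =
      {x : Fin n → E | IsHole (cechComplex x r) σ}.indicator 1 x := by
    unfold holeIndicator Set.indicator
    congr
  simp_rw [hindicator]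
  rw [integral_indicator_one (hmeas σ),
    ← (measurePreserving_comp_injective μ (σ.orderEmbOfFin hσ).injective).measureReal_preimage
      (hmeas _).nullMeasurableSet]
  congr 1 with x
  have hiff := isHole_cechComplex_comp x r (σ.orderEmbOfFin hσ).toEmbedding Finset.univ
  rw [Finset.map_orderEmbOfFin_univ] at hiff
  exact hiff.symm

lemma integral_card_holes_eq :
    ∫ x : Fin n → E, ((holes x r k Finset.univ).card : ℝ) ∂(Measure.pi fun _ => μ) =
      n.choose k * (Measure.pi fun _ : Fin k => μ).real
        {x | IsHole (cechComplex x r) Finset.univ} := by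
  simp_rw [card_holes_eq_sum]
  rw [integral_finsetSum _ fun σ _ => integrable_comp_cechComplex fun K => holeIndicator K σ,
    Finset.sum_congr rfl fun σ hσ => integral_holeIndicator_eq (Finset.mem_powersetCard.1 hσ).2]
  simp

lemma integral_betti_eq :
    ∫ x : Fin n → E, ((cechComplex x r).betti (k - 2) : ℝ) ∂(Measure.pi fun _ => μ) =
      ∫ x : Fin n → E, ((holes x r k Finset.univ).card : ℝ) ∂(Measure.pi fun _ => μ) +
        ∫ x : Fin n → E, bettiExcess x r k Finset.univ ∂(Measure.pi fun _ => μ) := by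
  simp_rw [betti_eq_card_holes_add_bettiExcess]
  exact integral_add (integrable_card_holes _) (integrable_bettiExcess _)

lemma abs_integral_bettiExcess_le (hk : 3 ≤ k) (hr : 0 ≤ r)
    (hp : ∀ y, μ (Metric.closedBall y (2 * r * k)) ≤ p) (hn : n * p ≤ 1) :
    |∫ x : Fin n → E, bettiExcess x r k Finset.univ ∂(Measure.pi fun _ => μ)| ≤
      n * (2 * momentConst k k * (n * p) ^ k) :=
  (abs_integral_le_integral_abs).trans (integral_abs_bettiExcess_le hk hr hp hn)

theorem integral_betti_le (hk : 3 ≤ k) (hr : 0 ≤ r)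
    (hp : ∀ y, μ (Metric.closedBall y (2 * r * k)) ≤ p) (hn : n * p ≤ 1) :
    ∫ x : Fin n → E, ((cechComplex x r).betti (k - 2) : ℝ) ∂(Measure.pi fun _ => μ) ≤
      (momentConst k (k - 1) + 2 * momentConst k k) * (n * (n * p) ^ (k - 1)) := by
  have hconst := momentConst_nonneg k k
  have hpow : ((n : ℝ) * p) ^ k ≤ (n * p) ^ (k - 1) :=
    pow_le_pow_of_le_one (by positivity) (by exact_mod_cast hn) (Nat.sub_le k 1)
  calc _ ≤ n * (momentConst k (k - 1) * (n * p) ^ (k - 1)) +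
        n * (2 * momentConst k k * (n * p) ^ k) := by
        rw [integral_betti_eq]
        exact add_le_add (integral_card_holes_le hk hr hp hn)
          ((le_abs_self _).trans (abs_integral_bettiExcess_le hk hr hp hn))
    _ ≤ n * (momentConst k (k - 1) * (n * p) ^ (k - 1)) +
        n * (2 * momentConst k k * (n * p) ^ (k - 1)) := by gcongr
    _ = _ := by ring

lemma le_integral_card_holes {q : ℝ} (hk : 1 ≤ k) (hn : k ≤ n) (hq0 : 0 ≤ q)
    (hq : q ≤ (Measure.pi fun _ : Fin k => μ).real {x | IsHole (cechComplex x r) Finset.univ}) :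
    q / (k ^ k * k.factorial) * n ^ k ≤
      ∫ x : Fin n → E, ((holes x r k Finset.univ).card : ℝ) ∂(Measure.pi fun _ => μ) :=
  calc _ = ((n : ℝ) / k) ^ k / k.factorial * q := by rw [div_pow]; field_simp
    _ ≤ _ := by
      rw [integral_card_holes_eq]
      gcongr
      exact div_pow_le_choose hk hn

variable {F : Type*} [NormedAddCommGroup F] [InnerProductSpace ℝ F] [FiniteDimensional ℝ F]
  [MeasurableSpace F] [BorelSpace F] {ν : Measure F} [ν.IsAddHaarMeasure] {f : F → ℝ≥0∞}
  [IsProbabilityMeasure (ν.withDensity f)]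

lemma exists_le_integral_card_holes (hk : 2 ≤ k) (hkd : k ≤ Module.finrank ℝ F + 1)
    (hf : Measurable f) :
    ∃ c : ℝ, 0 < c ∧ ∃ ε : ℝ, 0 < ε ∧ ∀ n ≥ k, ∀ r : ℝ, 0 < r →
      n * r ^ Module.finrank ℝ F ≤ ε →
      c * (n * (n * r ^ Module.finrank ℝ F) ^ (k - 1)) ≤
        ∫ x : Fin n → F, ((holes x r k Finset.univ).card : ℝ)
          ∂(Measure.pi fun _ => ν.withDensity f) := by
  obtain ⟨m, rfl⟩ := Nat.exists_eq_add_of_le' (one_le_two.trans hk)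
  have : NeZero m := ⟨by lia⟩
  obtain ⟨c, hc, hsmall⟩ := exists_eventually_le_measure_isHole (ν := ν) (m := m) (by lia) hf
  obtain ⟨r₀, hr₀, hhole⟩ := (mem_nhdsGT_iff_exists_Ioc_subset).1 hsmall
  refine ⟨c / ((m + 1 : ℕ) ^ (m + 1) * (m + 1).factorial), by positivity,
    r₀ ^ Module.finrank ℝ F, pow_pos hr₀ _, fun n hn r hr hnr => ?_⟩
  have hn1 : (1 : ℝ) ≤ n := by exact_mod_cast (Nat.le_add_left 1 m).trans hn
  have hrr₀ : r ≤ r₀ := le_of_pow_le_pow_left₀ (n := Module.finrank ℝ F) (by lia) hr₀.le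
    ((le_mul_of_one_le_left (by positivity) hn1).trans hnr)
  calc _ = c * r ^ (m * Module.finrank ℝ F) / ((m + 1 : ℕ) ^ (m + 1) * (m + 1).factorial) *
        n ^ (m + 1) := by
        rw [Nat.add_sub_cancel, mul_pow, ← pow_mul, mul_comm (Module.finrank ℝ F) m]
        ring
    _ ≤ _ := le_integral_card_holes (Nat.le_add_left 1 m) hn (by positivity) (hhole ⟨hr, hrr₀⟩)

lemma mul_mul_mul_pow_eq (hk : k ≠ 0) (a b x : ℝ) :
    a * (a * (b * x)) ^ k = b ^ k * (a * x) * (a * (a * x) ^ (k - 1)) := by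
  rw [mul_left_comm a b, mul_pow, ← mul_pow_sub_one hk (a * x)]
  ring

theorem exists_le_integral_betti {A : ℝ≥0} (hk : 3 ≤ k) (hkd : k ≤ Module.finrank ℝ F + 1)
    (hf : Measurable f) (hball : ∀ (r : ℝ≥0) y, ν.withDensity f (Metric.closedBall y (2 * r * k)) ≤
      (A * r ^ Module.finrank ℝ F : ℝ≥0)) :
    ∃ c : ℝ, 0 < c ∧ ∃ ε : ℝ, 0 < ε ∧ ∀ n ≥ k, ∀ r : ℝ≥0, 0 < r →
      n * (r : ℝ) ^ Module.finrank ℝ F ≤ ε →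
      c * (n * (n * r ^ Module.finrank ℝ F) ^ (k - 1)) ≤
        ∫ x : Fin n → F, ((cechComplex x r).betti (k - 2) : ℝ)
          ∂(Measure.pi fun _ => ν.withDensity f) := by
  obtain ⟨c, hc, ε, hε, hholes⟩ := exists_le_integral_card_holes (ν := ν) (by lia) hkd hf
  have hconst := momentConst_nonneg k k
  set D : ℝ := 2 * momentConst k k * A ^ k
  have : 0 ≤ D := by positivity
  refine ⟨c / 2, by positivity, min ε (min (1 / (A + 1)) (c / (2 * (D + 1)))), by positivity,
    fun n hn r hr hnr => ?_⟩
  set s : ℝ := n * r ^ Module.finrank ℝ F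
  have hs0 : 0 ≤ s := by positivity
  obtain ⟨hsε, hsA, hsD⟩ : s ≤ ε ∧ s * (A + 1) ≤ 1 ∧ s * (2 * (D + 1)) ≤ c := by
    simpa only [le_min_iff, le_div_iff₀ (by positivity : 0 < (A : ℝ) + 1),
      le_div_iff₀ (by positivity : 0 < 2 * (D + 1))] using hnr
  have hnA : (n : ℝ≥0) * (A * r ^ Module.finrank ℝ F) ≤ 1 := by
    rw [← NNReal.coe_le_coe]
    push_cast
    linarith
  have hexcess := abs_integral_bettiExcess_le hk r.2 (hball r) hnA
  have hsmall : n * (2 * momentConst k k * (n * (A * r ^ Module.finrank ℝ F)) ^ k) ≤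
      c / 2 * (n * s ^ (k - 1)) :=
    calc _ = s * D * (n * s ^ (k - 1)) := by
          rw [mul_left_comm, mul_mul_mul_pow_eq (by lia)]
          ring
      _ ≤ _ := by
        gcongr
        linarith
  push_cast at hexcess
  calc _ = c * (n * s ^ (k - 1)) + -(c / 2 * (n * s ^ (k - 1))) := by ring
    _ ≤ _ := by
      rw [integral_betti_eq]
      exact add_le_add (hholes n hn r hr hsε) (neg_le_of_abs_le (hexcess.trans hsmall))

end ExpectedBetti

/-! ### From Poisson to normal approximation -/

section TotalVariation

variable {S : Type*} [MeasurableSpace S] {μ ν : Measure S}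

lemma abs_integral_sub_integral_le_two [IsProbabilityMeasure μ] [IsProbabilityMeasure ν]
    {g : S → ℝ} (hg : ∀ x, |g x| ≤ 1) : |∫ x, g x ∂μ - ∫ x, g x ∂ν| ≤ 2 := by
  have abs_integral_le_one (ρ : Measure S) [IsProbabilityMeasure ρ] : |∫ x, g x ∂ρ| ≤ 1 := by
    simpa using norm_integral_le_of_norm_le_const (μ := ρ) (f := g) (.of_forall hg)
  linarith [abs_sub (∫ x, g x ∂μ) (∫ x, g x ∂ν), abs_integral_le_one μ, abs_integral_le_one ν]

variable [TopologicalSpace S]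

lemma tvDist_nonneg : 0 ≤ tvDist μ ν := Real.iSup_nonneg fun _ => abs_nonneg _

lemma tvDist_le {C : ℝ} (hC : 0 ≤ C)
    (h : ∀ g : S → ℝ, (∀ x, |g x| ≤ 1) → |∫ x, g x ∂μ - ∫ x, g x ∂ν| ≤ C) : tvDist μ ν ≤ C :=
  Real.iSup_le (fun g => h g.1 g.2) hC

lemma tvDist_le_two [IsProbabilityMeasure μ] [IsProbabilityMeasure ν] : tvDist μ ν ≤ 2 :=
  tvDist_le zero_le_two fun _ => abs_integral_sub_integral_le_two

lemma abs_integral_sub_integral_le_tvDist [DiscreteTopology S] [IsProbabilityMeasure μ]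
    [IsProbabilityMeasure ν] {g : S → ℝ} (hg : ∀ x, |g x| ≤ 1) :
    |∫ x, g x ∂μ - ∫ x, g x ∂ν| ≤ tvDist μ ν :=
  le_ciSup (f := fun g : {g : C(S, ℝ) // ∀ x, |g x| ≤ 1} => |∫ x, g.1 x ∂μ - ∫ x, g.1 x ∂ν|)
    ⟨2, Set.forall_mem_range.2 fun g => abs_integral_sub_integral_le_two g.2⟩
    ⟨⟨g, continuous_of_discreteTopology⟩, hg⟩

lemma norm_integral_sub_integral_le_two_mul_tvDist [DiscreteTopology S]
    [DiscreteMeasurableSpace S] [Countable S] [IsProbabilityMeasure μ] [IsProbabilityMeasure ν]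
    {g : S → ℂ} (hg : ∀ x, ‖g x‖ ≤ 1) :
    ‖∫ x, g x ∂μ - ∫ x, g x ∂ν‖ ≤ 2 * tvDist μ ν := by
  have hint (ρ : Measure S) [IsProbabilityMeasure ρ] : Integrable g ρ :=
    Integrable.of_bound Measurable.of_discrete.aestronglyMeasurable 1 (.of_forall hg)
  have hre : (∫ x, g x ∂μ - ∫ x, g x ∂ν).re = ∫ x, (g x).re ∂μ - ∫ x, (g x).re ∂ν := by
    simpa using (congr_arg₂ (· - ·) (integral_re (hint μ)) (integral_re (hint ν))).symm
  have him : (∫ x, g x ∂μ - ∫ x, g x ∂ν).im = ∫ x, (g x).im ∂μ - ∫ x, (g x).im ∂ν := by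
    simpa using (congr_arg₂ (· - ·) (integral_im (hint μ)) (integral_im (hint ν))).symm
  calc _ ≤ |∫ x, (g x).re ∂μ - ∫ x, (g x).re ∂ν| + |∫ x, (g x).im ∂μ - ∫ x, (g x).im ∂ν| :=
        hre ▸ him ▸ Complex.norm_le_abs_re_add_abs_im _
    _ ≤ tvDist μ ν + tvDist μ ν := add_le_add
        (abs_integral_sub_integral_le_tvDist fun x => (Complex.abs_re_le_norm _).trans (hg x))
        (abs_integral_sub_integral_le_tvDist fun x => (Complex.abs_im_le_norm _).trans (hg x))
    _ = _ := (two_mul _).symm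

end TotalVariation

section PoissonCLT

lemma integral_cexp_poissonMeasure (a : ℝ≥0) (u : ℝ) :
    ∫ j : ℕ, Complex.exp ((u * (j - a) : ℝ) * Complex.I) ∂(poissonMeasure a) =
      Complex.exp (a * (Complex.exp (u * Complex.I) - 1 - u * Complex.I)) := by
  have hsplit : ∀ j : ℕ, Complex.exp ((u * (j - a) : ℝ) * Complex.I) =
      Complex.exp (-(a * (u * Complex.I))) * Complex.exp (u * (j : ℝ) * Complex.I) := fun j => by
    rw [← Complex.exp_add]
    congr 1
    push_cast
    ring
  simp_rw [hsplit]
  rw [integral_const_mul, mul_sub, sub_eq_neg_add, Complex.exp_add,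
    ← charFun_map_cast_poissonMeasure, charFun_apply_real, integral_map .of_discrete (by fun_prop)]

lemma norm_cexp_mul_I_sub_le {u : ℝ} (hu : |u| ≤ 1) :
    ‖Complex.exp (u * Complex.I) - 1 - u * Complex.I + (u : ℂ) ^ 2 / 2‖ ≤ |u| ^ 3 := by
  have htaylor := Complex.exp_bound (x := u * Complex.I) (n := 3) (by simpa using hu) (by simp)
  calc _ = ‖Complex.exp (u * Complex.I) -
        ∑ m ∈ Finset.range 3, (u * Complex.I) ^ m / m.factorial‖ := by
        simp only [Finset.sum_range_succ, Finset.sum_range_zero, mul_pow, Complex.I_sq]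
        congr 1
        push_cast [Nat.factorial]
        ring
    _ ≤ |u| ^ 3 * (4 * (6 * 3)⁻¹) := by simpa [Nat.factorial] using htaylor
    _ ≤ |u| ^ 3 := mul_le_of_le_one_right (by positivity) (by norm_num)

variable {ι : Type*} {l : Filter ι} {lam u : ι → ℝ} {a : ℝ}

lemma tendsto_zero_of_tendsto_mul_sq (hlam : Tendsto lam l atTop)
    (hu : Tendsto (fun i => lam i * u i ^ 2) l (𝓝 a)) : Tendsto u l (𝓝 0) := by
  have hsq : Tendsto (fun i => u i ^ 2) l (𝓝 0) :=
    (hu.div_atTop hlam).congr' <| (hlam.eventually_ne_atTop 0).mono fun i hi =>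
      mul_div_cancel_left₀ _ hi
  refine (tendsto_zero_iff_abs_tendsto_zero u).2 ?_
  simpa [Function.comp_def, Real.sqrt_sq_eq_abs] using hsq.sqrt

lemma tendsto_mul_cexp_sub (hlam : Tendsto lam l atTop)
    (hu : Tendsto (fun i => lam i * u i ^ 2) l (𝓝 a)) :
    Tendsto (fun i => lam i * (Complex.exp (u i * Complex.I) - 1 - u i * Complex.I)) l
      (𝓝 (-(a / 2 : ℝ))) := by
  have hu0 : Tendsto u l (𝓝 0) := tendsto_zero_of_tendsto_mul_sq hlam hu
  have hquadratic : Tendsto (fun i => -((lam i * u i ^ 2 / 2 : ℝ) : ℂ)) l (𝓝 (-(a / 2 : ℝ))) :=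
    (Complex.continuous_ofReal.tendsto _).comp (hu.div_const 2) |>.neg
  have hremainder : Tendsto (fun i => |lam i * u i ^ 2| * |u i|) l (𝓝 0) := by
    simpa using hu.abs.mul hu0.abs
  refine hquadratic.congr_dist (squeeze_zero' (.of_forall fun _ => dist_nonneg) ?_ hremainder)
  filter_upwards [hu0.abs.eventually_le_const (by simp : |(0 : ℝ)| < 1)] with i hi
  calc _ = |lam i| *
        ‖Complex.exp (u i * Complex.I) - 1 - u i * Complex.I + (u i : ℂ) ^ 2 / 2‖ := by
        rw [dist_comm, dist_eq_norm, ← Real.norm_eq_abs, ← Complex.norm_real, ← norm_mul]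
        congr 1
        push_cast
        ring
    _ ≤ |lam i| * |u i| ^ 3 := by gcongr; exact norm_cexp_mul_I_sub_le hi
    _ = _ := by rw [abs_mul, abs_pow]; ring

theorem tendstoInDistribution_of_tendsto_tvDist_poisson {Ω : Type*} [MeasurableSpace Ω]
    {P : Measure Ω} [IsProbabilityMeasure P] {Z : ℕ → Ω → ℕ} (hZ : ∀ n, AEMeasurable (Z n) P)
    {lam : ℕ → ℝ≥0} {s : ℕ → ℝ} (hlam : Tendsto (fun n => (lam n : ℝ)) atTop atTop)
    (htv : Tendsto (fun n => tvDist (P.map (Z n)) (poissonMeasure (lam n))) atTop (𝓝 0))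
    (hs : Tendsto (fun n => s n ^ 2 / lam n) atTop (𝓝 1)) :
    TendstoInDistribution (fun n ω => ((Z n ω : ℝ) - lam n) / s n) atTop (id : ℝ → ℝ)
      (fun _ => P) (gaussianReal 0 1) := by
  have hmeas (n) : AEMeasurable (fun ω => ((Z n ω : ℝ) - lam n) / s n) P :=
    Measurable.of_discrete (f := fun j : ℕ => ((j : ℝ) - lam n) / s n) |>.comp_aemeasurable (hZ n)
  refine ⟨hmeas, aemeasurable_id, ProbabilityMeasure.tendsto_iff_tendsto_charFun.2 fun t => ?_⟩
  change Tendsto (fun n => charFun (P.map fun ω => ((Z n ω : ℝ) - lam n) / s n) t) atTop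
    (𝓝 (charFun ((gaussianReal 0 1).map id) t))
  let e (n j : ℕ) : ℂ := Complex.exp ((t / s n * (j - lam n) : ℝ) * Complex.I)
  have hchar (n) : charFun (P.map fun ω => ((Z n ω : ℝ) - lam n) / s n) t =
      ∫ j, e n j ∂(P.map (Z n)) := by
    rw [charFun_apply_real, integral_map (hmeas n) (by fun_prop),
      integral_map (hZ n) Measurable.of_discrete.aestronglyMeasurable]
    congr with ω
    simp only [e]
    congr 2
    push_cast
    ring
  have hgaussian : charFun ((gaussianReal 0 1).map id) t = Complex.exp (-(t ^ 2 / 2 : ℝ)) := by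
    rw [Measure.map_id, charFun_gaussianReal]
    congr 1
    push_cast
    ring
  have hpoisson : Tendsto (fun n => ∫ j, e n j ∂(poissonMeasure (lam n))) atTop
      (𝓝 (Complex.exp (-(t ^ 2 / 2 : ℝ)))) := by
    simp only [e, integral_cexp_poissonMeasure]
    refine (Complex.continuous_exp.tendsto _).comp (tendsto_mul_cexp_sub hlam ?_)
    convert (hs.inv₀ one_ne_zero).const_mul (t ^ 2) using 2
    · field_simp
    · simp
  simp_rw [hchar, hgaussian]
  refine hpoisson.congr_dist (squeeze_zero (fun _ => dist_nonneg) (fun n => ?_)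
    (by simpa using htv.const_mul 2))
  have : IsProbabilityMeasure (P.map (Z n)) := Measure.isProbabilityMeasure_map (hZ n)
  rw [dist_comm, dist_eq_norm]
  exact norm_integral_sub_integral_le_two_mul_tvDist fun j =>
    (Complex.norm_exp_ofReal_mul_I _).le

end PoissonCLT

/-! ### Random Čech complexes -/

section Law

variable {Ω E : Type*} [MeasurableSpace Ω] {P : Measure Ω}

lemma tendsto_measure_eq_zero_of_tendsto_integral {ι : Type*} {l : Filter ι}
    [IsProbabilityMeasure P] {Z : ι → Ω → ℕ} (hZ : ∀ i, Integrable (fun ω => (Z i ω : ℝ)) P)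
    (h : Tendsto (fun i => ∫ ω, (Z i ω : ℝ) ∂P) l (𝓝 0)) :
    Tendsto (fun i => P {ω | Z i ω = 0}) l (𝓝 1) := by
  have compl_le (i : ι) : P {ω | Z i ω = 0}ᶜ ≤ ENNReal.ofReal (∫ ω, (Z i ω : ℝ) ∂P) := by
    have hmarkov := mul_meas_ge_le_integral_of_nonneg (.of_forall fun ω => (Z i ω).cast_nonneg)
      (hZ i) 1
    have hset : {ω | Z i ω = 0}ᶜ = {ω | 1 ≤ (Z i ω : ℝ)} := by
      ext ω
      simp [Nat.one_le_iff_ne_zero]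
    rw [hset, ← ofReal_measureReal]
    exact ENNReal.ofReal_le_ofReal (by simpa using hmarkov)
  have hlim : Tendsto (fun i => 1 - ENNReal.ofReal (∫ ω, (Z i ω : ℝ) ∂P)) l (𝓝 1) := by
    simpa using ENNReal.Tendsto.sub tendsto_const_nhds (ENNReal.tendsto_ofReal h)
      (.inl ENNReal.one_ne_top)
  refine tendsto_of_tendsto_of_tendsto_of_le_of_le hlim tendsto_const_nhds (fun i => ?_)
    fun i => prob_le_one
  rw [tsub_le_iff_right, ← measure_univ (μ := P), ← Set.union_compl_self {ω | Z i ω = 0}]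
  exact (measure_union_le _ _).trans (by gcongr; exact compl_le i)

variable [PseudoMetricSpace E] [ProperSpace E] [MeasurableSpace E] [BorelSpace E]
  {μ : Measure E} {X : ℕ → Ω → E}

lemma measurable_betti_cechComplex (n : ℕ) (r : ℝ) (j : ℕ) :
    Measurable fun x : Fin n → E => (cechComplex x r).betti j :=
  measurable_comp_cechComplex r fun K => K.betti j

lemma hasLaw_cechBetti (hX : iIndepFun X P) (hlaw : ∀ i, HasLaw (X i) μ P) (n : ℕ) (r : ℝ)
    (j : ℕ) :
    HasLaw (cechBetti X n r j)
      ((Measure.pi fun _ => μ).map fun x : Fin n → E => (cechComplex x r).betti j) P :=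
  HasLaw.comp (Y := fun x : Fin n → E => (cechComplex x r).betti j)
    ⟨(measurable_betti_cechComplex n r j).aemeasurable, rfl⟩
    ((hX.precomp Fin.val_injective).hasLaw_pi fun i : Fin n => hlaw i)

lemma integral_cechBetti (hX : iIndepFun X P) (hlaw : ∀ i, HasLaw (X i) μ P) (n : ℕ) (r : ℝ)
    (j : ℕ) :
    ∫ ω, (cechBetti X n r j ω : ℝ) ∂P =
      ∫ x : Fin n → E, ((cechComplex x r).betti j : ℝ) ∂(Measure.pi fun _ => μ) := by
  have hmeas := (Measurable.of_discrete (f := fun m : ℕ => (m : ℝ)))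
  rw [← integral_map (measurable_betti_cechComplex n r j).aemeasurable hmeas.aestronglyMeasurable,
    ← (hasLaw_cechBetti hX hlaw n r j).integral_comp hmeas.aestronglyMeasurable]
  rfl

lemma integrable_cechBetti [IsProbabilityMeasure μ] (hX : iIndepFun X P)
    (hlaw : ∀ i, HasLaw (X i) μ P) (n : ℕ) (r : ℝ) (j : ℕ) :
    Integrable (fun ω => (cechBetti X n r j ω : ℝ)) P := by
  have hbetti := integrable_comp_cechComplex (r := r) (μ := μ) (n := n) fun K => (K.betti j : ℝ)
  have hpts := (hX.precomp Fin.val_injective).hasLaw_pi fun i : Fin n => hlaw i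
  rw [← hpts.map_eq] at hbetti
  exact hbetti.comp_aemeasurable hpts.aemeasurable

lemma variance_cechBetti (hX : iIndepFun X P) (hlaw : ∀ i, HasLaw (X i) μ P) (n : ℕ) (r : ℝ)
    (j : ℕ) :
    Var[fun ω => (cechBetti X n r j ω : ℝ); P] =
      Var[fun x : Fin n → E => ((cechComplex x r).betti j : ℝ); Measure.pi fun _ => μ] := by
  have hmeas := (Measurable.of_discrete (f := fun m : ℕ => (m : ℝ)))
  have hZ := hasLaw_cechBetti hX hlaw n r j
  have hP := variance_map hmeas.aemeasurable hZ.aemeasurable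
  rw [hZ.map_eq, variance_map hmeas.aemeasurable
    (measurable_betti_cechComplex n r j).aemeasurable] at hP
  exact hP.symm

end Law

section Approximation

variable {E : Type*} [PseudoMetricSpace E]

lemma betti_cechComplex_eq_zero_of_lt {n k : ℕ} (hk : 3 ≤ k) (hn : n < k) (x : Fin n → E) (r : ℝ) :
    (cechComplex x r).betti (k - 2) = 0 := by
  have hcard : (Finset.univ : Finset (Fin n)).card < k := by simpa
  rw [← Nat.cast_eq_zero (R := ℝ), ← inducedBetti_univ, inducedBetti_of_card_le hk hcard.le,
    Nat.cast_eq_zero, Finset.card_eq_zero]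
  refine Finset.eq_empty_of_forall_notMem fun σ hσ => ?_
  exact (σ.card_le_univ.trans_lt hcard).ne (mem_holes.1 hσ).2.1

variable [ProperSpace E] [MeasurableSpace E] [BorelSpace E]
  {μ : Measure E} [IsProbabilityMeasure μ] {n k : ℕ} {r : ℝ} {p lam : ℝ≥0}

lemma steinConst_nonneg (k : ℕ) : 0 ≤ steinConst k := by
  have := momentConst_nonneg (k + k) k
  have := momentConst_nonneg k (k - 1)
  have := momentConst_nonneg k 1
  have := momentConst_nonneg k k
  unfold steinConst holesConst excessConst
  positivity

theorem tvDist_map_betti_le (hk : 3 ≤ k) (hr : 0 ≤ r)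
    (hp : ∀ y, μ (Metric.closedBall y (2 * r * k)) ≤ p) (hn : n * p ≤ 1) (hpos : 0 < lam)
    (hlam : (lam : ℝ) =
      ∫ x : Fin n → E, ((cechComplex x r).betti (k - 2) : ℝ) ∂(Measure.pi fun _ => μ)) :
    tvDist ((Measure.pi fun _ => μ).map fun x : Fin n → E => (cechComplex x r).betti (k - 2))
      (poissonMeasure lam) ≤ 2 * steinConst k * (n * (n * p) ^ k / lam) := by
  have := steinConst_nonneg k
  refine tvDist_le (by positivity) fun g hg => ?_
  rw [integral_map (measurable_betti_cechComplex n r (k - 2)).aemeasurable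
    Measurable.of_discrete.aestronglyMeasurable, ← mul_div_assoc]
  exact abs_integral_betti_sub_poisson_le hk hr hp hn hg hpos hlam

theorem abs_variance_betti_div_sub_one_le (hk : 3 ≤ k) (hr : 0 ≤ r)
    (hp : ∀ y, μ (Metric.closedBall y (2 * r * k)) ≤ p) (hn : n * p ≤ 1) (hpos : 0 < lam)
    (hlam : (lam : ℝ) =
      ∫ x : Fin n → E, ((cechComplex x r).betti (k - 2) : ℝ) ∂(Measure.pi fun _ => μ)) :
    |Var[fun x : Fin n → E => ((cechComplex x r).betti (k - 2) : ℝ); Measure.pi fun _ => μ] / lam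
      - 1| ≤ steinConst k * (n * (n * p) ^ k / lam) := by
  have hstein := abs_stein_le (μ := μ) (n := n) (L := 1) (g := fun m => m) hk hr hp hn
    (LipschitzWith.of_dist_le_mul fun a b => by simp [Nat.dist_cast_real])
  have hshift : ∫ x : Fin n → E, (((cechComplex x r).betti (k - 2) + 1 : ℕ) : ℝ)
      ∂(Measure.pi fun _ => μ) = lam + 1 := by
    push_cast
    rw [hlam, integral_add (integrable_comp_cechComplex fun K => (K.betti (k - 2) : ℝ))
      (integrable_const _), integral_const]
    simp
  rw [hshift, ← hlam] at hstein
  have hlam0 : (0 : ℝ) < lam := hpos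
  rw [variance_eq_sub (memLp_comp_cechComplex (fun K => (K.betti (k - 2) : ℝ)) 2), ← hlam,
    div_sub_one hlam0.ne', abs_div, abs_of_pos hlam0, ← mul_div_assoc]
  gcongr
  simpa [sq, sub_sub, mul_add] using hstein

end Approximation

section Sparse

variable {k n : ℕ}

lemma pow_mul_pow_mul_eq (hk : k ≠ 0) (a b : ℝ) (d : ℕ) :
    a ^ k * b ^ (d * (k - 1)) = a * (a * b ^ d) ^ (k - 1) := by
  rw [mul_pow, pow_mul, ← mul_assoc, mul_pow_sub_one hk]

lemma mul_pow_div_le (hk : k ≠ 0) {a b c x l : ℝ} (ha : 0 ≤ a) (hb : 0 ≤ b) (hx : 0 ≤ x)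
    (hc : 0 < c) (hl : 0 < l) (hle : c * (a * (a * x) ^ (k - 1)) ≤ l) :
    a * (a * (b * x)) ^ k / l ≤ b ^ k / c * (a * x) := by
  rw [mul_mul_mul_pow_eq hk, div_le_iff₀ hl]
  calc _ = b ^ k / c * (a * x) * (c * (a * (a * x) ^ (k - 1))) := by field_simp
    _ ≤ _ := by gcongr

variable {E : Type*} [PseudoMetricSpace E] [MeasurableSpace E] {μ : Measure E}
  [IsProbabilityMeasure μ] {A : ℝ≥0} {d : ℕ}

lemma tvDist_map_betti_of_eq_zero {j : ℕ} {r : ℝ} {lam : ℝ≥0}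
    (h : ∀ x : Fin n → E, (cechComplex x r).betti j = 0)
    (hlam : (lam : ℝ) = ∫ x : Fin n → E, ((cechComplex x r).betti j : ℝ) ∂(Measure.pi fun _ => μ)) :
    tvDist ((Measure.pi fun _ => μ).map fun x : Fin n → E => (cechComplex x r).betti j)
      (poissonMeasure lam) = 0 := by
  obtain rfl : lam = 0 := by simpa [h] using hlam
  refine le_antisymm (tvDist_le le_rfl fun g _ => ?_) tvDist_nonneg
  simp_rw [h]
  rw [integral_poissonMeasure, tsum_eq_single 0 fun j hj => by simp [hj]]
  simp

variable [ProperSpace E] [BorelSpace E]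

lemma tendsto_integral_betti_zero (hk : 3 ≤ k)
    (hball : ∀ (r : ℝ≥0) y, μ (Metric.closedBall y (2 * r * k)) ≤ (A * r ^ d : ℝ≥0))
    {r : ℕ → ℝ≥0}
    (h : Tendsto (fun n : ℕ => (n : ℝ) ^ k * (r n : ℝ) ^ (d * (k - 1))) atTop (𝓝 0)) :
    Tendsto (fun n => ∫ x : Fin n → E, ((cechComplex x (r n)).betti (k - 2) : ℝ)
      ∂(Measure.pi fun _ => μ)) atTop (𝓝 0) := by
  have hlim : Tendsto (fun n : ℕ => (A : ℝ) ^ (k - 1) * ((n : ℝ) ^ k * (r n : ℝ) ^ (d * (k - 1))))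
      atTop (𝓝 0) := by simpa using h.const_mul ((A : ℝ) ^ (k - 1))
  have hscale : ∀ n : ℕ, (A : ℝ) ^ (k - 1) * ((n : ℝ) ^ k * (r n : ℝ) ^ (d * (k - 1))) =
      n * (n * (A * (r n : ℝ) ^ d)) ^ (k - 1) := fun n => by
    rw [pow_mul_pow_mul_eq (by lia), mul_left_comm (n : ℝ) A, mul_pow (A : ℝ), mul_left_comm]
  refine squeeze_zero' (.of_forall fun n => integral_nonneg fun x => Nat.cast_nonneg _) ?_
    (by simpa using hlim.const_mul (momentConst k (k - 1) + 2 * momentConst k k))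
  filter_upwards [hlim.eventually_le_const one_pos, eventually_ge_atTop 1] with n hle hn
  have hpow : ((n : ℝ) * (A * r n ^ d)) ^ (k - 1) ≤ 1 :=
    (le_mul_of_one_le_left (by positivity) (by exact_mod_cast hn)).trans
      ((hscale n).symm.trans_le hle)
  have hsmall : (n : ℝ≥0) * (A * r n ^ d) ≤ 1 := by
    exact_mod_cast (pow_le_one_iff_of_nonneg (by positivity) (by lia)).1 hpow
  rw [hscale]
  exact_mod_cast integral_betti_le hk (r n).2 (hball (r n)) hsmall

variable {F : Type*} [NormedAddCommGroup F] [InnerProductSpace ℝ F] [FiniteDimensional ℝ F]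
  [MeasurableSpace F] [BorelSpace F] {ν : Measure F} [ν.IsAddHaarMeasure] {f : F → ℝ≥0∞}

lemma exists_withDensity_closedBall_le {M : ℝ≥0} (hM : ∀ x, f x ≤ M) (k : ℕ) :
    ∃ A : ℝ≥0, ∀ (r : ℝ≥0) y, ν.withDensity f (Metric.closedBall y (2 * r * k)) ≤
      (A * r ^ Module.finrank ℝ F : ℝ≥0) := by
  refine ⟨M * ((2 * k) ^ Module.finrank ℝ F * (ν (Metric.ball 0 1)).toNNReal), fun r y => ?_⟩
  rw [withDensity_apply _ Metric.isClosed_closedBall.measurableSet]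
  calc _ ≤ ∫⁻ _ in Metric.closedBall y (2 * r * k), M ∂ν := lintegral_mono hM
    _ = M * (ENNReal.ofReal ((2 * r * k) ^ Module.finrank ℝ F) * ν (Metric.ball 0 1)) := by
      rw [setLIntegral_const, Measure.addHaar_closedBall _ _ (by positivity)]
    _ = _ := by
      have hradius : (2 * r * k : ℝ) ^ Module.finrank ℝ F =
          ((2 * k) ^ Module.finrank ℝ F * r ^ Module.finrank ℝ F : ℝ≥0) := by
        push_cast
        ring
      rw [hradius, ENNReal.ofReal_coe_nnreal, ← ENNReal.coe_toNNReal measure_ball_lt_top.ne]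
      norm_cast
      ring

variable [IsProbabilityMeasure (ν.withDensity f)]

theorem exists_poisson_approximation (hk : 3 ≤ k) (hkd : k ≤ Module.finrank ℝ F + 1)
    (hf : Measurable f) (hball : ∀ (r : ℝ≥0) y, ν.withDensity f (Metric.closedBall y (2 * r * k)) ≤
      (A * r ^ Module.finrank ℝ F : ℝ≥0)) :
    ∃ c : ℝ, 0 < c ∧ ∃ C : ℝ, 0 ≤ C ∧ ∃ ε : ℝ, 0 < ε ∧ ∀ n ≥ k, ∀ r : ℝ≥0, 0 < r →
      n * (r : ℝ) ^ Module.finrank ℝ F ≤ ε → ∀ lam : ℝ≥0,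
      (lam : ℝ) = ∫ x : Fin n → F, ((cechComplex x r).betti (k - 2) : ℝ)
        ∂(Measure.pi fun _ => ν.withDensity f) →
      c * (n * (n * r ^ Module.finrank ℝ F) ^ (k - 1)) ≤ lam ∧
      tvDist ((Measure.pi fun _ => ν.withDensity f).map
          fun x : Fin n → F => (cechComplex x r).betti (k - 2)) (poissonMeasure lam) ≤
        C * (n * r ^ Module.finrank ℝ F) ∧
      |Var[fun x : Fin n → F => ((cechComplex x r).betti (k - 2) : ℝ);
          Measure.pi fun _ => ν.withDensity f] / lam - 1| ≤ C * (n * r ^ Module.finrank ℝ F) := by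
  obtain ⟨c, hc, ε, hε, hlow⟩ := exists_le_integral_betti (ν := ν) hk hkd hf hball
  have hstein := steinConst_nonneg k
  refine ⟨c, hc, 2 * steinConst k * (A ^ k / c), by positivity, min ε (1 / (A + 1)), by positivity,
    fun n hn r hr hnr lam hlam => ?_⟩
  have hle := (hlow n hn r hr (hnr.trans (min_le_left _ _))).trans_eq hlam.symm
  have hn0 : 0 < n := by lia
  have hpos : 0 < (lam : ℝ) := hle.trans_lt' (by positivity)
  have hsmall : (n : ℝ≥0) * (A * r ^ Module.finrank ℝ F) ≤ 1 := by
    have hnr' := hnr.trans (min_le_right _ _)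
    rw [le_div_iff₀ (by positivity)] at hnr'
    have : 0 ≤ (n : ℝ) * r ^ Module.finrank ℝ F := by positivity
    rw [← NNReal.coe_le_coe]
    push_cast
    linarith
  have herror : (n : ℝ) * (n * (A * r ^ Module.finrank ℝ F : ℝ≥0)) ^ k / lam ≤
      A ^ k / c * (n * r ^ Module.finrank ℝ F) := by
    push_cast
    exact mul_pow_div_le (by lia) n.cast_nonneg A.2 (by positivity) hc hpos hle
  have htv := tvDist_map_betti_le hk r.2 (hball r) hsmall hpos hlam
  have hvar := abs_variance_betti_div_sub_one_le hk r.2 (hball r) hsmall hpos hlam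
  rw [mul_assoc (2 * steinConst k)]
  refine ⟨hle, htv.trans (by gcongr), hvar.trans ?_⟩
  gcongr
  linarith

theorem exists_tvDist_map_betti_le (hk : 3 ≤ k) (hf : Measurable f)
    (hball : ∀ (r : ℝ≥0) y, ν.withDensity f (Metric.closedBall y (2 * r * k)) ≤
      (A * r ^ Module.finrank ℝ F : ℝ≥0)) :
    ∃ C : ℝ, ∀ n, ∀ r : ℝ≥0, 0 < r → ∀ lam : ℝ≥0,
      (lam : ℝ) = ∫ x : Fin n → F, ((cechComplex x r).betti (k - 2) : ℝ)
        ∂(Measure.pi fun _ => ν.withDensity f) →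
      tvDist ((Measure.pi fun _ => ν.withDensity f).map
          fun x : Fin n → F => (cechComplex x r).betti (k - 2)) (poissonMeasure lam) ≤
        C * (n * r ^ Module.finrank ℝ F) := by
  rcases lt_or_ge (Module.finrank ℝ F + 1) k with hkd | hkd
  · refine ⟨0, fun n r _ lam hlam => ?_⟩
    rw [tvDist_map_betti_of_eq_zero
      (fun x => betti_cechComplex_eq_zero x r (by lia) (by lia)) hlam, zero_mul]
  obtain ⟨_, _, C, hC, ε, hε, happrox⟩ := exists_poisson_approximation (ν := ν) hk hkd hf hball
  refine ⟨C + 2 / ε, fun n r hr lam hlam => ?_⟩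
  rcases lt_or_ge n k with hn | hn
  · rw [tvDist_map_betti_of_eq_zero (betti_cechComplex_eq_zero_of_lt hk hn · r) hlam]
    positivity
  rcases le_total (n * (r : ℝ) ^ Module.finrank ℝ F) ε with hnr | hnr
  · refine (happrox n hn r hr hnr lam hlam).2.1.trans ?_
    gcongr
    exact le_add_of_nonneg_right (by positivity)
  · have := Measure.isProbabilityMeasure_map (μ := Measure.pi fun _ => ν.withDensity f)
      (measurable_betti_cechComplex (E := F) n r (k - 2)).aemeasurable
    calc _ ≤ (2 : ℝ) := tvDist_le_two
      _ = 2 / ε * ε := (div_mul_cancel₀ _ hε.ne').symm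
      _ ≤ (C + 2 / ε) * (n * r ^ Module.finrank ℝ F) := by
        gcongr
        exact le_add_of_nonneg_left hC

variable {Ω : Type*} [MeasurableSpace Ω] {P : Measure Ω} [IsProbabilityMeasure P] {X : ℕ → Ω → F}

theorem tendstoInDistribution_cechBetti (hk : 3 ≤ k) (hkd : k ≤ Module.finrank ℝ F + 1)
    (hf : Measurable f) (hball : ∀ (r : ℝ≥0) y, ν.withDensity f (Metric.closedBall y (2 * r * k)) ≤
      (A * r ^ Module.finrank ℝ F : ℝ≥0))
    (hX : iIndepFun X P) (hlaw : ∀ i, HasLaw (X i) (ν.withDensity f) P)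
    {r : ℕ → ℝ≥0} (hr : ∀ n, 0 < r n)
    (hnr : Tendsto (fun n : ℕ => (n : ℝ) * (r n : ℝ) ^ Module.finrank ℝ F) atTop (𝓝 0))
    (h : Tendsto (fun n : ℕ => (n : ℝ) ^ k * (r n : ℝ) ^ (Module.finrank ℝ F * (k - 1)))
      atTop atTop) :
    TendstoInDistribution
      (fun (n : ℕ) ω => ((cechBetti X n (r n) (k - 2) ω : ℝ)
          - ∫ ω', (cechBetti X n (r n) (k - 2) ω' : ℝ) ∂P)
        / √(Var[fun ω' => (cechBetti X n (r n) (k - 2) ω' : ℝ); P]))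
      atTop (id : ℝ → ℝ) (fun _ => P) (gaussianReal 0 1) := by
  obtain ⟨c, hc, C, -, ε, hε, happrox⟩ := exists_poisson_approximation (ν := ν) hk hkd hf hball
  have hbound : Tendsto (fun n : ℕ => C * ((n : ℝ) * (r n : ℝ) ^ Module.finrank ℝ F))
      atTop (𝓝 0) := by simpa using hnr.const_mul C
  let lam (n : ℕ) : ℝ≥0 := ⟨∫ ω, (cechBetti X n (r n) (k - 2) ω : ℝ) ∂P,
    integral_nonneg fun _ => Nat.cast_nonneg _⟩
  have hlarge := ((eventually_ge_atTop k).and (hnr.eventually_le_const hε)).mono fun n hn =>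
    happrox n hn.1 (r n) (hr n) hn.2 (lam n) (integral_cechBetti hX hlaw n (r n) (k - 2))
  refine tendstoInDistribution_of_tendsto_tvDist_poisson (lam := lam)
    (fun n => (hasLaw_cechBetti hX hlaw n (r n) (k - 2)).aemeasurable) ?_ ?_ ?_
  · refine tendsto_atTop_mono' _ (hlarge.mono fun n hn => ?_) (h.const_mul_atTop hc)
    rw [pow_mul_pow_mul_eq (by lia)]
    exact hn.1
  · refine squeeze_zero' (.of_forall fun _ => tvDist_nonneg) (hlarge.mono fun n hn => ?_) hbound
    rw [(hasLaw_cechBetti hX hlaw n (r n) (k - 2)).map_eq]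
    exact hn.2.1
  · refine tendsto_iff_dist_tendsto_zero.2
      (squeeze_zero' (.of_forall fun _ => dist_nonneg) (hlarge.mono fun n hn => ?_) hbound)
    rw [Real.sq_sqrt (variance_nonneg _ _), variance_cechBetti hX hlaw]
    exact hn.2.2

end Sparse

end RandomCech

end

open RandomCech in
theorem theorem3p1_general {F : Type*} [NormedAddCommGroup F] [InnerProductSpace ℝ F]
    [FiniteDimensional ℝ F] [MeasurableSpace F] [BorelSpace F] (ν : Measure F)
    [ν.IsAddHaarMeasure] {k : ℕ} (hk : 3 ≤ k) {f : F → ℝ≥0∞} (hf : Measurable f)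
    {M : ℝ≥0} (hM : ∀ x, f x ≤ M) :
    ∃ c : ℝ, ∀ (Ω : Type*) [MeasurableSpace Ω] (P : Measure Ω) [IsProbabilityMeasure P]
      (X : ℕ → Ω → F),
      iIndepFun X P →
      (∀ i, HasLaw (X i) (ν.withDensity f) P) →
      (∀ (n : ℕ) (r : ℝ), 0 < r →
        tvDist (P.map (cechBetti X n r (k - 2)))
          (poissonMeasure (∫ ω, (cechBetti X n r (k - 2) ω : ℝ) ∂P).toNNReal) ≤
        c * (n * r ^ Module.finrank ℝ F)) ∧
      ∀ r : ℕ → ℝ, (∀ n, 0 < r n) →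
      (Tendsto (fun n : ℕ => (n : ℝ) ^ k * r n ^ (Module.finrank ℝ F * (k - 1))) atTop (𝓝 0) →
        Tendsto (fun n : ℕ => P {ω | cechBetti X n (r n) (k - 2) ω = 0}) atTop (𝓝 1)) ∧
      (Tendsto (fun n : ℕ => (n : ℝ) * r n ^ Module.finrank ℝ F) atTop (𝓝 0) →
        k ≤ Module.finrank ℝ F + 1 →
        Tendsto (fun n : ℕ => (n : ℝ) ^ k * r n ^ (Module.finrank ℝ F * (k - 1))) atTop atTop →
        TendstoInDistribution
          (fun (n : ℕ) ω => ((cechBetti X n (r n) (k - 2) ω : ℝ)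
              - ∫ ω', (cechBetti X n (r n) (k - 2) ω' : ℝ) ∂P)
            / √(Var[fun ω' => (cechBetti X n (r n) (k - 2) ω' : ℝ); P]))
          atTop (id : ℝ → ℝ) (fun _ => P) (gaussianReal 0 1)) := by
  by_cases hprob : IsProbabilityMeasure (ν.withDensity f)
  swap
  · exact ⟨0, fun Ω _ P _ X _ hlaw =>
      absurd ((hlaw 0).isProbabilityMeasure_iff.1 inferInstance) hprob⟩
  obtain ⟨A, hball⟩ := exists_withDensity_closedBall_le (ν := ν) hM k
  obtain ⟨c, hc⟩ := exists_tvDist_map_betti_le (ν := ν) hk hf hball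
  refine ⟨c, fun Ω _ P _ X hX hlaw => ⟨fun n r hr => ?_, fun r hr => ?_⟩⟩
  · lift r to ℝ≥0 using hr.le
    rw [(hasLaw_cechBetti hX hlaw n r (k - 2)).map_eq]
    refine hc n r hr _ ?_
    rw [integral_cechBetti hX hlaw,
      Real.coe_toNNReal _ (integral_nonneg fun _ => Nat.cast_nonneg _)]
  · lift r to ℕ → ℝ≥0 using fun n => (hr n).le
    refine ⟨fun h => ?_, fun hnr hkd h =>
      tendstoInDistribution_cechBetti hk hkd hf hball hX hlaw hr hnr h⟩
    refine tendsto_measure_eq_zero_of_tendsto_integral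
      (fun n => integrable_cechBetti hX hlaw n (r n) (k - 2)) ?_
    simp_rw [integral_cechBetti hX hlaw]
    exact tendsto_integral_betti_zero hk hball h

theorem theorem3p1 (d k : ℕ) (hk : 3 ≤ k) (f : EuclideanSpace ℝ (Fin d) → ℝ)
    (hf_meas : Measurable f) (hf_nonneg : ∀ x, 0 ≤ f x) (hf_bdd : ∃ M, ∀ x, f x ≤ M) :
    ∃ c : ℝ, ∀ (Ω : Type*) [MeasurableSpace Ω] (P : Measure Ω) [IsProbabilityMeasure P]
      (X : ℕ → Ω → EuclideanSpace ℝ (Fin d)) (r : ℕ → ℝ),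
      iIndepFun X P →
      (∀ i, HasLaw (X i) (volume.withDensity fun x => ENNReal.ofReal (f x)) P) →
      (∀ n, 0 < r n) →
      Tendsto (fun n : ℕ => (n : ℝ) * r n ^ d) atTop (𝓝 0) →
      (Tendsto (fun n : ℕ => (n : ℝ) ^ k * r n ^ (d * (k - 1))) atTop (𝓝 0) →
        Tendsto (fun n : ℕ => P {ω | cechBetti X n (r n) (k - 2) ω = 0}) atTop (𝓝 1)) ∧
      (∀ α : ℝ, 0 < α →
        Tendsto (fun n : ℕ => (n : ℝ) ^ k * r n ^ (d * (k - 1))) atTop (𝓝 α) →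
        ∀ n : ℕ,
          tvDist (P.map (cechBetti X n (r n) (k - 2)))
            (poissonMeasure (∫ ω, (cechBetti X n (r n) (k - 2) ω : ℝ) ∂P).toNNReal)
            ≤ c * ((n : ℝ) * r n ^ d)) ∧
      (k ≤ d + 1 →
        Tendsto (fun n : ℕ => (n : ℝ) ^ k * r n ^ (d * (k - 1))) atTop atTop →
        TendstoInDistribution
          (fun (n : ℕ) (ω : Ω) =>
            ((cechBetti X n (r n) (k - 2) ω : ℝ)
                - ∫ ω', (cechBetti X n (r n) (k - 2) ω' : ℝ) ∂P)
              / √(variance (fun ω' => (cechBetti X n (r n) (k - 2) ω' : ℝ)) P))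
          atTop (id : ℝ → ℝ) (fun _ => P) (gaussianReal 0 1)) := by
  obtain ⟨M, hM⟩ := hf_bdd
  obtain ⟨c, hc⟩ := theorem3p1_general volume hk hf_meas.ennreal_ofReal
    fun x => ENNReal.ofReal_le_ofReal (hM x)
  rw [finrank_euclideanSpace_fin] at hc
  refine ⟨c, fun Ω _ P _ X r hX hlaw hr hnr => ?_⟩
  obtain ⟨hTV, hlim⟩ := hc Ω P X hX hlaw
  exact ⟨(hlim r hr).1, fun _ _ _ n => hTV n (r n) (hr n), (hlim r hr).2 hnr⟩
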